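/- Let $S$ be a non-empty set of $n$ points in the plane, each coloured red or blue, no two sharing an $x$- or a $y$-coordinate. Definitions. A point $p\in S$ *participates* in $S$ if there is $q\in S$ of the opposite colour such that the interior of the axis-aligned box spanned by $p$ and $q$ contains no point of $S$. For an axis-aligned box $B=[x_0,x_1]\times[y_0,y_1]$ let $\mathrm{cross}(B)$ be the set of points $(x,y)$ with $x_0\le x\le x_1$ or $y_0\le y\le y_1$; the four components of its complement are the quadrants of $B$. The NE-minimal set of a point set $A$ consists of the $p\in A$ for which no $q\in A$, $q\ne p$, has $x(q)\le x(p)$ and $y(q)\le y(p)$; NW-, SE- and SW-minimal sets are obtained by reflection. For a colour $c$, the box $B$ is *$c$-safe* for a point set $A$ if all points of $A\cap\mathrm{cross}(B)$ have colour $c$ and, for each of the four quadrants $D$ of $B$, all points of the corresponding minimal set of $A\cap D$ have colour $c$; it is *safe* for $A$ if it is red-safe or blue-safe. The structural entropy $\mathcal H(S)$ is the minimum of $\sum_k\frac{|S_k|}{n}\log_2\frac{n}{|S_k|}$ over all partitions $\{S_k\}$ of $S$ in which every $S_k$ is a singleton or can be enclosed by a box that is safe for $S$. Algorithm 1 (with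 parameter $\delta>0$). Set $Q=S$. For $j=0,1,\dots,\lfloor\log_2(\delta\log_2 n)\rfloor$ (no iteration if this number is negative or undefined): partition $Q$ by a kd-tree (alternating splits at the median $x$- and the median $y$-coordinate) into $r_j=2^{2^j}$ subsets $Q_1,\dots,Q_{r_j}$ of size at most $\lceil |Q|/r_j\rceil$, with bounding boxes $B_1,\dots,B_{r_j}$; for every $i$ such that $Q_i\neq\emptyset$ and $B_i$ is safe for $Q$, remove all points of $Q_i$ from $Q$. Finally report all points that participate in the remaining set $Q$ by a direct algorithm that takes $O(|Q|\log |Q|)$ time. Theorem. Let $\alpha>0$, $c$ and $k$ be constants. Suppose that $S$ has been preprocessed so that, for every subset $S'\subseteq S$ containing all points that participate in $S$ and every axis-aligned box $B$ containing at least one point of $S'$, one can test whether $B$ is safe for $S'$ in at most $c\,n^{1-\alpha}$ time plus the cost of at most $k$ orthogonal range-emptiness queries on $S'$ (each possibly restricted to the points of one colour). Then, for every sufficiently small constant $\delta>0$ (depending only on $\alpha,c,k$), Algorithm 1, implemented as a comparison-based algorithm (coordinates are accessed only through comparisons; the kd-tree is computed with linear-time median selection, and the range-emptiness queries of the safety tests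 of an iteration are answered in at most $k$ batches), reports exactly the points that participate in $S$, each once, in at most $C\,n(\mathcal H(S)+1)$ time for every order in which the points are given. The constant $C$ depends only on $\alpha,c,k,\delta$. The time counts everything that happens after the preprocessing, including the kd-tree partitions, the safety tests, the answering of their range-emptiness queries and the final direct algorithm. -/

import Mathlib

/-!
# Reporting the participating points of a red/blue point set

First part: the geometry (visibility, participation, safety, structural entropy).
Second part: the running-time model and the algorithm, written out completely.

Everything that is executed is polymorphic in an arbitrary linear order `R` of coordinates, so that
coordinates can only be compared and copied (comparison-based algorithms).
-/

namespace RedBlue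

inductive Color where
  | red
  | blue
  deriving DecidableEq

/-- A coloured point of the plane. -/
@[ext]
structure CPoint (R : Type) where
  x : R
  y : R
  color : Color
  deriving DecidableEq

/-- The closed axis-aligned box `[xmin, xmax] × [ymin, ymax]`. -/
structure Box (R : Type) where
  xmin : R
  xmax : R
  ymin : R
  ymax : R

section Geometry

variable {R : Type} [LinearOrder R]

/-- No two points share an `x` or a `y` coordinate (in particular the list has no repetition). -/
def GeneralPosition (S : List (CPoint R)) : Prop :=
  S.Pairwise fun p q => p.x ≠ q.x ∧ p.y ≠ q.y

/-- The interior of the axis-aligned box spanned by `p` and `q` contains no point of `S`. -/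
def Sees (S : Finset (CPoint R)) (p q : CPoint R) : Prop :=
  ∀ s ∈ S, ¬ (min p.x q.x < s.x ∧ s.x < max p.x q.x ∧ min p.y q.y < s.y ∧ s.y < max p.y q.y)

/-- `p ∈ S` participates in `S`: it is visible from a point of `S` of the opposite colour. -/
def Participates (S : Finset (CPoint R)) (p : CPoint R) : Prop :=
  p ∈ S ∧ ∃ q ∈ S, q.color ≠ p.color ∧ Sees S p q

/-- `S'` is a subset of `S` containing all points which participate in `S`. -/
def Conforms (S' S : Finset (CPoint R)) : Prop :=
  S' ⊆ S ∧ ∀ p, Participates S p → p ∈ S'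

def Box.Contains (B : Box R) (p : CPoint R) : Prop :=
  (B.xmin ≤ p.x ∧ p.x ≤ B.xmax) ∧ (B.ymin ≤ p.y ∧ p.y ≤ B.ymax)

/-- `p` lies in `cross(B)`. -/
def Box.InCross (B : Box R) (p : CPoint R) : Prop :=
  (B.xmin ≤ p.x ∧ p.x ≤ B.xmax) ∨ (B.ymin ≤ p.y ∧ p.y ≤ B.ymax)

/-- `p` lies in a quadrant of `B`: `east = north = true` is `NE(B)`, `east = false` and
`north = true` is `NW(B)`, and so on. -/
def Box.InQuadrant (B : Box R) (east north : Bool) (p : CPoint R) : Prop :=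
  (if east then B.xmax < p.x else p.x < B.xmin) ∧
  (if north then B.ymax < p.y else p.y < B.ymin)

/-- Domination of `q` by `p ≠ q` in one of the four directions; `east = north = true` is the
usual one, `x(q) ≤ x(p)` and `y(q) ≤ y(p)`. -/
def Dominates (east north : Bool) (p q : CPoint R) : Prop :=
  q ≠ p ∧ (if east then q.x ≤ p.x else p.x ≤ q.x) ∧ (if north then q.y ≤ p.y else p.y ≤ q.y)

/-- `p` belongs to the `NE`-minimal (`NW`-minimal, ...) set of the point set `A`. -/
def InMinimalSet (east north : Bool) (A : Set (CPoint R)) (p : CPoint R) : Prop :=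
  p ∈ A ∧ ∀ q ∈ A, ¬ Dominates east north p q

/-- All points of `S ∩ cross(B)` have colour `c`. -/
def Box.CrossSafeColor (B : Box R) (S : Finset (CPoint R)) (c : Color) : Prop :=
  ∀ p ∈ S, B.InCross p → p.color = c

/-- `B` is `c`-safe for `S`: it is `c`-cross-safe, and for each of the four quadrants the
corresponding minimal set of the points of `S` in the quadrant has colour `c`. -/
def Box.SafeColor (B : Box R) (S : Finset (CPoint R)) (c : Color) : Prop :=
  B.CrossSafeColor S c ∧
  ∀ east north : Bool, ∀ p : CPoint R,
    InMinimalSet east north {s | s ∈ S ∧ B.InQuadrant east north s} p → p.color = c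

/-- `B` is safe for `S`: it is red-safe or blue-safe. -/
def Box.Safe (B : Box R) (S : Finset (CPoint R)) : Prop :=
  B.SafeColor S Color.red ∨ B.SafeColor S Color.blue

/-- A subset of `S` is safe if it can be enclosed by a box that is safe for `S`. -/
def SafeSubset (S A : Finset (CPoint R)) : Prop :=
  ∃ B : Box R, (∀ p ∈ A, B.Contains p) ∧ B.Safe S

/-- A partition of `S` is respectful if every member is a singleton or a safe subset of `S`. -/
def Respectful {S : Finset (CPoint R)} (P : Finpartition S) : Prop :=
  ∀ A ∈ P.parts, A.card = 1 ∨ SafeSubset S A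

/-- The entropy `∑ₖ |Sₖ|/n · log₂ (n/|Sₖ|)` of a partition of a set of `n` points. -/
noncomputable def partitionEntropy {S : Finset (CPoint R)} (P : Finpartition S) : ℝ :=
  ∑ A ∈ P.parts, ((A.card : ℝ) / S.card) * Real.logb 2 ((S.card : ℝ) / A.card)

/-- The structural entropy `H(S)`: the minimum of the entropy over all respectful partitions. -/
noncomputable def structuralEntropy (S : Finset (CPoint R)) : ℝ :=
  sInf {h | ∃ P : Finpartition S, Respectful P ∧ h = partitionEntropy P}

/-- The infimum in the definition of the structural entropy is a minimum. -/
theorem structuralEntropy_isLeast (S : Finset (CPoint R)) :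
    IsLeast {h | ∃ P : Finpartition S, Respectful P ∧ h = partitionEntropy P}
      (structuralEntropy S) := by
  classical
  have hfin : {h | ∃ P : Finpartition S, Respectful P ∧ h = partitionEntropy P}.Finite := by
    refine (Set.finite_range (fun P : Finpartition S => partitionEntropy P)).subset ?_
    rintro h ⟨P, -, rfl⟩
    exact ⟨P, rfl⟩
  have hne : {h | ∃ P : Finpartition S, Respectful P ∧ h = partitionEntropy P}.Nonempty := by
    refine ⟨_, ⊥, ?_, rfl⟩
    intro A hA
    obtain ⟨a, -, rfl⟩ := Finpartition.mem_bot_iff.1 hA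
    exact Or.inl (Finset.card_singleton a)
  exact ⟨hne.csInf_mem hfin, fun h hh => csInf_le hfin.bddBelow hh⟩

end Geometry

/-! ## Running time

A computation returns a value together with the number of elementary steps it took. Each function
below performs a bounded number of elementary operations per call (construct or inspect a list
cell or a tuple, copy a value, add, subtract, compare,
halve or double a natural number) besides the comparisons
and the calls it makes; each call and each comparison of two coordinates is charged explicitly.
The parameter `fuel` only makes the recursions total; it is always at least the recursion depth
needed. -/

/-- A value together with the number of steps spent on computing it. -/
structure Timed (α : Type) where
  val : α
  time : ℕ

instance : Monad Timed where
  pure a := ⟨a, 0⟩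
  bind m f := ⟨(f m.val).val, m.time + (f m.val).time⟩

/-- One elementary step. -/
def tick : Timed Unit := ⟨(), 1⟩

section Lists

variable {α β : Type}

def lengthT : List α → Timed ℕ
  | [] => do
      tick
      return 0
  | _ :: l => do
      tick
      let n ← lengthT l
      return n + 1

def appendT : List α → List α → Timed (List α)
  | [], l' => do
      tick
      return l'
  | a :: l, l' => do
      tick
      let m ← appendT l l'
      return a :: m

/-- `revAppendT l l'` is the reverse of `l` followed by `l'`. -/
def revAppendT : List α → List α → Timed (List α)
  | [], l' => do
      tick
      return l'
  | a :: l, l' => do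
      tick
      revAppendT l (a :: l')

def splitAtT : ℕ → List α → Timed (List α × List α)
  | 0, l => do
      tick
      return ([], l)
  | _ + 1, [] => do
      tick
      return ([], [])
  | k + 1, a :: l => do
      tick
      let (l₁, l₂) ← splitAtT k l
      return (a :: l₁, l₂)

def nthT : ℕ → List α → Timed (Option α)
  | _, [] => do
      tick
      return none
  | 0, a :: _ => do
      tick
      return some a
  | k + 1, _ :: l => do
      tick
      nthT k l

def mapT (f : α → Timed β) : List α → Timed (List β)
  | [] => do
      tick
      return []
  | a :: l => do
      tick
      let b ← f a
      let m ← mapT f l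
      return b :: m

def flatMapT (f : α → Timed (List β)) : List α → Timed (List β)
  | [] => do
      tick
      return []
  | a :: l => do
      tick
      let b ← f a
      let m ← flatMapT f l
      appendT b m

/-- The members that satisfy the test, and those that do not. -/
def splitByT (test : α → Timed Bool) : List α → Timed (List α × List α)
  | [] => do
      tick
      return ([], [])
  | a :: l => do
      tick
      let b ← test a
      let (l₁, l₂) ← splitByT test l
      return if b then (a :: l₁, l₂) else (l₁, a :: l₂)

def findT (test : α → Timed Bool) : List α → Timed (Option α)
  | [] => do
      tick
      return none
  | a :: l => do
      tick
      let b ← test a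
      if b then return some a else findT test l

/-- Remove members from the front as long as they satisfy the test. -/
def popWhileT (test : α → Timed Bool) : List α → Timed (List α)
  | [] => do
      tick
      return []
  | a :: l => do
      tick
      let b ← test a
      if b then popWhileT test l else return a :: l

end Lists

section Sorting

variable {R : Type} [LinearOrder R] {α : Type}

/-- The comparison `u < v` of two coordinates. -/
def ltT (u v : R) : Timed Bool := do
  tick
  return decide (u < v)

def insertT (key : α → R) (a : α) : List α → Timed (List α)
  | [] => do
      tick
      return [a]
  | b :: l => do
      tick
      let lt ← ltT (key b) (key a)
      if lt then
        let m ← insertT key a l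
        return b :: m
      else
        return a :: b :: l

def insertionSortT (key : α → R) : List α → Timed (List α)
  | [] => do
      tick
      return []
  | a :: l => do
      tick
      let m ← insertionSortT key l
      insertT key a m

def mergeT (key : α → R) : List α → List α → Timed (List α)
  | [], l' => do
      tick
      return l'
  | a :: l, [] => do
      tick
      return a :: l
  | a :: l, b :: l' => do
      tick
      let lt ← ltT (key b) (key a)
      if lt then
        let m ← mergeT key (a :: l) l'
        return b :: m
      else
        let m ← mergeT key l (b :: l')
        return a :: m
  termination_by l l' => l.length + l'.length

def mergeSortT (key : α → R) : (fuel : ℕ) → List α → Timed (List α)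
  | 0, l => do
      tick
      return l
  | fuel + 1, l => do
      tick
      let n ← lengthT l
      if n ≤ 1 then
        return l
      else
        let (l₁, l₂) ← splitAtT (n / 2) l
        let m₁ ← mergeSortT key fuel l₁
        let m₂ ← mergeSortT key fuel l₂
        mergeT key m₁ m₂

/-- The medians of the consecutive groups of five, and one member of the last, incomplete group. -/
def mediansT (key : α → R) : List α → Timed (List α)
  | [] => do
      tick
      return []
  | a :: b :: c :: d :: e :: l => do
      tick
      let s ← insertionSortT key [a, b, c, d, e]
      let m ← nthT 2 s
      let ms ← mediansT key l
      match m with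
      | none => return ms
      | some m => return m :: ms
  | a :: _ => do
      tick
      return [a]

/-- The member of rank `k` (counted from `0`) with respect to `key`, by the linear-time median of
medians method. -/
def selectT (key : α → R) : (fuel : ℕ) → ℕ → List α → Timed (Option α)
  | 0, _, _ => do
      tick
      return none
  | fuel + 1, k, l => do
      tick
      let n ← lengthT l
      if n ≤ 100 then
        let s ← insertionSortT key l
        nthT k s
      else
        let ms ← mediansT key l
        let nm ← lengthT ms
        let pivot ← selectT key fuel (nm / 2) ms
        match pivot with
        | none => return none
        | some p =>
          let (lo, rest) ← splitByT (fun a => ltT (key a) (key p)) l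
          let (hi, _) ← splitByT (fun a => ltT (key p) (key a)) rest
          let nlo ← lengthT lo
          if k < nlo then
            selectT key fuel k lo
          else if k = nlo then
            return some p
          else
            selectT key fuel (k - nlo - 1) hi

end Sorting

section Partitioning

variable {R : Type} [LinearOrder R]

/-- The coordinate at which a level of a kd-tree splits. -/
def splitKey (vertical : Bool) (p : CPoint R) : R := if vertical then p.x else p.y

/-- The `2 ^ depth` cells of a kd-tree of the given depth, splitting at the median `x` coordinate
(`vertical = true`) and at the median `y` coordinate on alternating levels. -/
def kdPartitionT : (vertical : Bool) → (depth : ℕ) → List (CPoint R) →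
    Timed (List (List (CPoint R)))
  | _, 0, l => do
      tick
      return [l]
  | vertical, depth + 1, l => do
      tick
      let n ← lengthT l
      let m ← selectT (splitKey vertical) n ((n + 1) / 2) l
      let (lo, hi) ← match m with
        | none => pure (l, [])
        | some p => splitByT (fun a => ltT (splitKey vertical a) (splitKey vertical p)) l
      let c₁ ← kdPartitionT (!vertical) depth lo
      let c₂ ← kdPartitionT (!vertical) depth hi
      appendT c₁ c₂

def minT (u v : R) : Timed R := do
  let b ← ltT u v
  return if b then u else v

def maxT (u v : R) : Timed R := do
  let b ← ltT u v
  return if b then v else u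

/-- The smallest box containing a nonempty list of points, given as first point and remainder. -/
def boundingBoxT (p : CPoint R) : List (CPoint R) → Timed (Box R)
  | [] => do
      tick
      return ⟨p.x, p.x, p.y, p.y⟩
  | q :: l => do
      tick
      let B ← boundingBoxT p l
      let x₀ ← minT q.x B.xmin
      let x₁ ← maxT q.x B.xmax
      let y₀ ← minT q.y B.ymin
      let y₁ ← maxT q.y B.ymax
      return ⟨x₀, x₁, y₀, y₁⟩

end Partitioning

/-! ## Range-emptiness queries -/

/-- The position of a side of an orthogonal range; the side itself may belong to the range or
not. -/
structure Side (R : Type) where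
  pos : R
  closed : Bool

/-- An orthogonal range. Each of the four sides may be missing (unbounded range), and the query
may be restricted to the points of one colour. -/
structure Range (R : Type) where
  left : Option (Side R)
  right : Option (Side R)
  bottom : Option (Side R)
  top : Option (Side R)
  color : Option Color

section Ranges

variable {R : Type} [LinearOrder R]

/-- The coordinate `v` satisfies the lower bound given by a side. -/
def aboveSide (s : Option (Side R)) (v : R) : Bool :=
  match s with
  | none => true
  | some s => if s.closed then decide (s.pos ≤ v) else decide (s.pos < v)

/-- The coordinate `v` satisfies the upper bound given by a side. -/
def belowSide (s : Option (Side R)) (v : R) : Bool :=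
  match s with
  | none => true
  | some s => if s.closed then decide (v ≤ s.pos) else decide (v < s.pos)

def Range.contains (q : Range R) (p : CPoint R) : Bool :=
  aboveSide q.left p.x && belowSide q.right p.x && aboveSide q.bottom p.y && belowSide q.top p.y &&
  (match q.color with
   | none => true
   | some c => decide (p.color = c))

/-- The correct answer to the range-emptiness query `q` on `Q`. -/
def Range.isEmptyOn (q : Range R) (Q : List (CPoint R)) : Bool := Q.all fun p => !q.contains p

/-- At most four coordinate comparisons and one comparison of colours. -/
def containsT (q : Range R) (p : CPoint R) : Timed Bool := do
  tick
  tick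
  tick
  tick
  tick
  return q.contains p

def xPositions (q : Range R) : List R :=
  match q.left, q.right with
  | none, none => []
  | some s, none => [s.pos]
  | none, some t => [t.pos]
  | some s, some t => [s.pos, t.pos]

def yPositions (q : Range R) : List R :=
  match q.bottom, q.top with
  | none, none => []
  | some s, none => [s.pos]
  | none, some t => [t.pos]
  | some s, some t => [s.pos, t.pos]

def xPositionsT (q : Range R) : Timed (List R) := do
  tick
  return xPositions q

def yPositionsT (q : Range R) : Timed (List R) := do
  tick
  return yPositions q

/-- Split the points at the sorted values `ts` by binary search: one class for every value and
one for every gap between consecutive values. -/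
def bucketT (key : CPoint R → R) : (fuel : ℕ) → (ts : List R) → List (CPoint R) →
    Timed (List (List (CPoint R)))
  | 0, _, l => do
      tick
      return [l]
  | fuel + 1, ts, l => do
      tick
      let n ← lengthT ts
      let (ts₁, ts₂) ← splitAtT (n / 2) ts
      match ts₂ with
      | [] => return [l]
      | t :: ts₃ =>
        let (lt, ge) ← splitByT (fun p => ltT (key p) t) l
        let (gt, eq) ← splitByT (fun p => ltT t (key p)) ge
        let c₁ ← bucketT key fuel ts₁ lt
        let c₂ ← bucketT key fuel ts₃ gt
        appendT c₁ (eq :: c₂)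

def hasColorT (c : Color) (p : CPoint R) : Timed Bool := do
  tick
  return decide (p.color = c)

/-- One red and one blue point of a class, as far as they exist. -/
def representativesT (l : List (CPoint R)) : Timed (List (CPoint R)) := do
  tick
  let r ← findT (hasColorT Color.red) l
  let b ← findT (hasColorT Color.blue) l
  return r.toList ++ b.toList

def isEmptyOnT (q : Range R) (Q : List (CPoint R)) : Timed Bool := do
  tick
  let o ← findT (containsT q) Q
  return o.isNone

/-- The answers to a batch of range-emptiness queries on `Q`. The sides of the ranges cut the plane
into a grid; the points are located in the grid by binary search, and one point of each colour is
kept for each grid cell. -/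
def emptinessBatchT (Q : List (CPoint R)) (qs : List (Range R)) : Timed (List Bool) := do
  tick
  let xs ← flatMapT xPositionsT qs
  let xs ← insertionSortT id xs
  let ys ← flatMapT yPositionsT qs
  let ys ← insertionSortT id ys
  let nx ← lengthT xs
  let ny ← lengthT ys
  let slabs ← bucketT CPoint.x nx xs Q
  let cells ← flatMapT (bucketT CPoint.y ny ys) slabs
  let reps ← flatMapT representativesT cells
  mapT (fun q => isEmptyOnT q reps) qs

end Ranges

/-! ## Safety tests -/

/-- A procedure that returns a truth value after steps of its own and range-emptiness queries,
whose answers (`true` for an empty range) may determine how it continues. -/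
inductive SafetyTest (R : Type) where
  | result (b : Bool) : SafetyTest R
  | step (next : SafetyTest R) : SafetyTest R
  | query (q : Range R) (next : Bool → SafetyTest R) : SafetyTest R

/-- What the preprocessing of the input provides: a test for every current point set and box. -/
abbrev Tester (R : Type) := List (CPoint R) → Box R → SafetyTest R

namespace SafetyTest

variable {R : Type}

/-- The value returned if the queries are answered by `ans`. -/
def value (ans : Range R → Bool) : SafetyTest R → Bool
  | result b => b
  | step next => value ans next
  | query q next => value ans (next (ans q))

/-- The number of steps, not counting queries, if the queries are answered by `ans`. -/
def steps (ans : Range R → Bool) : SafetyTest R → ℕ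
  | result _ => 0
  | step next => steps ans next + 1
  | query q next => steps ans (next (ans q))

/-- The number of queries made if the queries are answered by `ans`. -/
def queries (ans : Range R → Bool) : SafetyTest R → ℕ
  | result _ => 0
  | step next => queries ans next
  | query q next => queries ans (next (ans q)) + 1

/-- Run a test, step by step, until it makes a query or returns. -/
def advanceT : SafetyTest R → Timed (SafetyTest R)
  | result b => do
      tick
      return result b
  | step next => do
      tick
      advanceT next
  | query q next => do
      tick
      return query q next

/-- The queries that the tests are waiting for. -/
def pendingT : List (SafetyTest R) → Timed (List (Range R))
  | [] => do
      tick
      return []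
  | query q _ :: l => do
      tick
      let qs ← pendingT l
      return q :: qs
  | _ :: l => do
      tick
      pendingT l

/-- Hand the answers of the pending queries to the tests that wait for them. -/
def resumeT : List (SafetyTest R) → List Bool → Timed (List (SafetyTest R))
  | [], _ => do
      tick
      return []
  | query _ next :: l, b :: bs => do
      tick
      let m ← resumeT l bs
      return next b :: m
  | t :: l, bs => do
      tick
      let m ← resumeT l bs
      return t :: m

/-- The verdict of a finished test. -/
def verdictT : SafetyTest R → Timed Bool
  | result b => do
      tick
      return b
  | _ => do
      tick
      return false

/-- Run the tests side by side on `Q`, with at most `k` queries each; the queries are answered in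
`k` batches. -/
def runAllT [LinearOrder R] (Q : List (CPoint R)) : (k : ℕ) → List (SafetyTest R) →
    Timed (List Bool)
  | 0, ts => do
      tick
      let ts ← mapT advanceT ts
      mapT verdictT ts
  | k + 1, ts => do
      tick
      let ts ← mapT advanceT ts
      let qs ← pendingT ts
      let bs ← emptinessBatchT Q qs
      let ts ← resumeT ts bs
      runAllT Q k ts

end SafetyTest

/-- The preprocessing assumption on an input `S` of `n` points: for every subset `Q` of `S` that
contains all points participating in `S`, and every box `B` that contains a point of `Q`, the test
decides whether `B` is safe for `Q` in at most `c * n ^ (1 - α)` steps and at most `k`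
range-emptiness queries on `Q`. -/
def Tester.Valid (T : Tester ℝ) (S : List (CPoint ℝ)) (α c : ℝ) (k : ℕ) : Prop :=
  ∀ Q : List (CPoint ℝ), Q.Nodup → Conforms Q.toFinset S.toFinset →
    ∀ B : Box ℝ, (∃ p ∈ Q, B.Contains p) →
      ((T Q B).value (fun q => q.isEmptyOn Q) = true ↔ B.Safe Q.toFinset) ∧
      ((T Q B).steps (fun q => q.isEmptyOn Q) : ℝ) ≤ c * (S.length : ℝ) ^ (1 - α) ∧
      (T Q B).queries (fun q => q.isEmptyOn Q) ≤ k

/-! ## Solving the reporting problem directly in `O(m log m)` time -/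

section Direct

variable {R : Type} [LinearOrder R]

/-- A point, whether it is already known to participate, and whether it lies in the left half. -/
structure Entry (R : Type) where
  pt : CPoint R
  found : Bool
  inLeft : Bool

/-- The comparison `u < v`, or `v < u` in the reflected order. -/
def ltFlipT (flip : Bool) (u v : R) : Timed Bool := if flip then ltT v u else ltT u v

/-- An element `q` of the staircase of target points, with the nearest red and the nearest blue
point among `q` and the elements behind it. -/
structure Stair (R : Type) where
  pt : CPoint R
  red : Option (CPoint R)
  blue : Option (CPoint R)

/-- The point that a source point of colour `c` can see first: the nearest point of the opposite
colour on the staircase. -/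
def nearestOpposite (c : Color) : List (Stair R) → Option (CPoint R)
  | [] => none
  | s :: _ => match c with
    | Color.red => s.blue
    | Color.blue => s.red

def pushStair (p : CPoint R) (l : List (Stair R)) : List (Stair R) :=
  match p.color, l with
  | Color.red, [] => [⟨p, some p, none⟩]
  | Color.blue, [] => [⟨p, none, some p⟩]
  | Color.red, s :: l => ⟨p, some p, s.blue⟩ :: s :: l
  | Color.blue, s :: l => ⟨p, s.red, some p⟩ :: s :: l

/-- Is the point `g` in front of the first point of `src`? -/
def unblockedT (flipY : Bool) (g : Option (CPoint R)) (src : List (CPoint R)) : Timed Bool := do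
  tick
  match g, src with
  | none, _ => return false
  | some _, [] => return true
  | some g, b :: _ => ltFlipT flipY g.y b.y

/-- Sweep over the points of both halves, from top to bottom (bottom to top if `flipY`). The
sources are the points of the left half (right half if `flipX`), the targets those of the other
half. A source is marked if it sees a target of the opposite colour on the side of it that has
already been swept. -/
def sweepT (flipX flipY : Bool) : (src : List (CPoint R)) → (tgt : List (Stair R)) →
    List (Entry R) → Timed (List (Entry R))
  | _, _, [] => do
      tick
      return []
  | src, tgt, e :: es => do
      tick
      if e.inLeft != flipX then
        let src ← popWhileT (fun b => ltFlipT flipX b.x e.pt.x) src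
        let hit ← unblockedT flipY (nearestOpposite e.pt.color tgt) src
        let rest ← sweepT flipX flipY (e.pt :: src) tgt es
        return ⟨e.pt, e.found || hit, e.inLeft⟩ :: rest
      else
        let tgt ← popWhileT (fun s => ltFlipT flipX e.pt.x s.pt.x) tgt
        let rest ← sweepT flipX flipY src (pushStair e.pt tgt) es
        return e :: rest

def setHalfT (inLeft : Bool) (e : Entry R) : Timed (Entry R) := do
  tick
  return ⟨e.pt, e.found, inLeft⟩

/-- Divide and conquer on a list sorted by `x`; the result is sorted by `y`. -/
def conquerT : (fuel : ℕ) → List (Entry R) → Timed (List (Entry R))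
  | 0, l => do
      tick
      return l
  | fuel + 1, l => do
      tick
      let n ← lengthT l
      if n ≤ 1 then
        return l
      else
        let (l₁, l₂) ← splitAtT (n / 2) l
        let m₁ ← conquerT fuel l₁
        let m₂ ← conquerT fuel l₂
        let m₁ ← mapT (setHalfT true) m₁
        let m₂ ← mapT (setHalfT false) m₂
        let m ← mergeT (fun e => e.pt.y) m₁ m₂
        let m ← sweepT false true [] [] m
        let m ← sweepT true true [] [] m
        let m ← revAppendT m []
        let m ← sweepT false false [] [] m
        let m ← sweepT true false [] [] m
        revAppendT m []

def toEntryT (p : CPoint R) : Timed (Entry R) := do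
  tick
  return ⟨p, false, false⟩

def reportEntryT (e : Entry R) : Timed (List (CPoint R)) := do
  tick
  return if e.found then [e.pt] else []

/-- Report all points which participate in `Q`. -/
def solveDirectlyT (Q : List (CPoint R)) : Timed (List (CPoint R)) := do
  tick
  let n ← lengthT Q
  let l ← mergeSortT CPoint.x n Q
  let es ← mapT toEntryT l
  let es ← conquerT n es
  flatMapT reportEntryT es

end Direct

/-! ## The algorithm -/

section Main

variable {R : Type} [LinearOrder R]

/-- The nonempty cells together with their bounding boxes. -/
def withBoxT (cell : List (CPoint R)) : Timed (List (List (CPoint R) × Box R)) := do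
  tick
  match cell with
  | [] => return []
  | p :: l =>
    let B ← boundingBoxT p l
    return [(p :: l, B)]

def startTestT (T : Tester R) (Q : List (CPoint R)) (cell : List (CPoint R) × Box R) :
    Timed (SafetyTest R) := do
  tick
  return T Q cell.2

/-- The points of the cells whose boxes are not safe. -/
def pruneT : List (List (CPoint R) × Box R) → List Bool → Timed (List (CPoint R))
  | cell :: cells, safe :: verdicts => do
      tick
      let Q ← pruneT cells verdicts
      if safe then return Q else appendT cell.1 Q
  | _, _ => do
      tick
      return []

/-- Iteration `j`: partition `Q` by a kd-tree into `2 ^ 2 ^ j` cells, test the bounding boxes of the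
cells for safety in `Q`, and prune the points of the safe cells. -/
def iterationT (T : Tester R) (k j : ℕ) (Q : List (CPoint R)) : Timed (List (CPoint R)) := do
  tick
  let cells ← kdPartitionT true (2 ^ j) Q
  let cells ← flatMapT withBoxT cells
  let tests ← mapT (startTestT T Q) cells
  let verdicts ← SafetyTest.runAllT Q k tests
  pruneT cells verdicts

/-- The iterations `j, j + 1, ..., j + count - 1`. -/
def iterateT (T : Tester R) (k : ℕ) : (count j : ℕ) → List (CPoint R) → Timed (List (CPoint R))
  | 0, _, Q => do
      tick
      return Q
  | count + 1, j, Q => do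
      tick
      let Q ← iterationT T k j Q
      iterateT T k count (j + 1) Q

/-- The number of integers `j` with `0 ≤ j ≤ ⌊log₂ (δ log₂ n)⌋`. It is determined once from `n` and
the constant `δ` (by doubling, in fewer steps than are charged for counting the `n` points). -/
noncomputable def iterationCount (δ : ℝ) (n : ℕ) : ℕ :=
  if δ * Real.logb 2 n < 1 then 0 else ⌊Real.logb 2 (δ * Real.logb 2 n)⌋₊ + 1

/-- The algorithm for reporting the participating points of `S`, with parameter `δ`, where the
safety of boxes is tested by `T` with at most `k` range-emptiness queries for each test. -/
noncomputable def reportParticipatingT (δ : ℝ) (T : Tester R) (k : ℕ) (S : List (CPoint R)) :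
    Timed (List (CPoint R)) := do
  tick
  let n ← lengthT S
  let Q ← iterateT T k (iterationCount δ n) 0 S
  solveDirectlyT Q

end Main

end RedBlue

/-! Correctness rests on one observation (`exists_sees_of_color_ne`): the box spanned by a red and a
blue point contains a red and a blue point that see each other. Indeed, a blocking point differs in
colour from one of the two corners and spans with it a box with fewer points inside. Hence points
that do not participate are irrelevant: removing them affects neither the participation of the
others (`Conforms.participates_iff`) nor the safety of a safe box (`Box.SafeColor.of_conforms`). A
point in a safe box does not participate, because every point of the other colour lies in a
quadrant, and a minimal point below it has the colour of the box and blocks the view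
(`Box.SafeColor.not_participates`). So the iterations remove irrelevant points only, and a
divide-and-conquer sweep (`conquerT_spec`) finds the participating points among the rest.

For the running time, iteration `j` with `r = 2 ^ 2 ^ j` cells costs `O(2 ^ j)` per remaining point
(a kd-tree of depth `2 ^ j`, and binary searches among `O(r)` range sides), plus `O(r ^ 3)` and the
`r * n ^ (1 - α)` own steps of the tests. As `r ≤ n ^ δ`, the last two terms add up to `O(n)` over
all iterations (`Tester.Valid.sum_iterationT_time_le`). The direct algorithm costs `O(log n)` per
point, and `log n` is at most `2 ^ N / δ` for the number `N` of iterations, so it is charged like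
one further iteration. It remains to bound the sum of `|Q_j| * 2 ^ j`, where `Q_j` is what is left
before iteration `j`.

Fix a partition attaining the entropy and a part with `s` points in a safe box `B`. A cell contained
in `B` has a safe bounding box and is pruned, so survivors of the part lie in cells that straddle a
side of `B`. A line meets only `O(√r)` cells, since the count doubles on every second level of the
tree only (`countP_straddles_le`), and a cell has about `n / r` points, so `O(n / √r)` points of the
part survive (`Tester.Valid.countP_iterationT_le`). As `r` is squared from one iteration to the
next, at most `min s (8 n / 2 ^ 2 ^ i)` of them are left before iteration `i + 2`. In the sum of `2
^ i * min s (8 n / 2 ^ 2 ^ i)` the terms with `2 ^ i` up to about `log (n / s)` are geometric and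
the later ones decay doubly exponentially, which gives `O(s (log (n / s) + 1))`
(`sum_two_pow_mul_min_le`). Summing over the parts produces `n` times the entropy plus `O(n)`
(`Tester.Valid.sum_remaining_le`). -/

namespace RedBlue

/-! ### Values and costs of timed computations -/

namespace Timed

variable {α β : Type}

@[simp] theorem val_bind (m : Timed α) (f : α → Timed β) : (m >>= f).val = (f m.val).val := rfl

@[simp] theorem time_bind (m : Timed α) (f : α → Timed β) :
    (m >>= f).time = m.time + (f m.val).time := rfl

@[simp] theorem val_pure (a : α) : (pure a : Timed α).val = a := rfl

@[simp] theorem time_pure (a : α) : (pure a : Timed α).time = 0 := rfl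

@[simp] theorem time_tick : tick.time = 1 := rfl

end Timed

/-! ### List operations -/

section Lists

variable {α β : Type}

@[simp] theorem lengthT_val (l : List α) : (lengthT l).val = l.length := by
  induction l with
  | nil => rfl
  | cons a l ih => simp [lengthT, ih]

@[simp] theorem lengthT_time (l : List α) : (lengthT l).time = l.length + 1 := by
  induction l with
  | nil => rfl
  | cons a l ih => simp [lengthT, ih]; omega

@[simp] theorem appendT_val (l l' : List α) : (appendT l l').val = l ++ l' := by
  induction l with
  | nil => rfl
  | cons a l ih => simp [appendT, ih]

@[simp] theorem appendT_time (l l' : List α) : (appendT l l').time = l.length + 1 := by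
  induction l with
  | nil => rfl
  | cons a l ih => simp [appendT, ih]; omega

@[simp] theorem revAppendT_val (l l' : List α) : (revAppendT l l').val = l.reverse ++ l' := by
  induction l generalizing l' with
  | nil => rfl
  | cons a l ih => simp [revAppendT, ih]

@[simp] theorem revAppendT_time (l l' : List α) : (revAppendT l l').time = l.length + 1 := by
  induction l generalizing l' with
  | nil => rfl
  | cons a l ih => simp [revAppendT, ih]; omega

@[simp] theorem splitAtT_val (k : ℕ) (l : List α) :
    (splitAtT k l).val = (l.take k, l.drop k) := by
  induction k generalizing l with
  | zero => cases l <;> simp [splitAtT]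
  | succ k ih => cases l <;> simp [splitAtT, ih]

theorem splitAtT_time_le (k : ℕ) (l : List α) : (splitAtT k l).time ≤ l.length + 1 := by
  induction k generalizing l with
  | zero => cases l <;> simp [splitAtT]
  | succ k ih =>
    cases l with
    | nil => simp [splitAtT]
    | cons a l =>
      have := ih l
      simp [splitAtT]
      omega

@[simp] theorem nthT_val (k : ℕ) (l : List α) : (nthT k l).val = l[k]? := by
  induction l generalizing k with
  | nil => simp [nthT]
  | cons a l ih => cases k <;> simp [nthT, ih]

theorem nthT_time_le (k : ℕ) (l : List α) : (nthT k l).time ≤ l.length + 1 := by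
  induction l generalizing k with
  | nil => simp [nthT]
  | cons a l ih =>
    cases k with
    | zero => simp [nthT]
    | succ k =>
      have := ih k
      simp [nthT]
      omega

@[simp] theorem mapT_val (f : α → Timed β) (l : List α) :
    (mapT f l).val = l.map fun a => (f a).val := by
  induction l with
  | nil => rfl
  | cons a l ih => simp [mapT, ih]

theorem mapT_time (f : α → Timed β) (l : List α) :
    (mapT f l).time = l.length + 1 + (l.map fun a => (f a).time).sum := by
  induction l with
  | nil => rfl
  | cons a l ih => simp [mapT, ih]; omega

@[simp] theorem flatMapT_val (f : α → Timed (List β)) (l : List α) :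
    (flatMapT f l).val = l.flatMap fun a => (f a).val := by
  induction l with
  | nil => rfl
  | cons a l ih => simp [flatMapT, ih]

theorem flatMapT_time (f : α → Timed (List β)) (l : List α) :
    (flatMapT f l).time = 2 * l.length + 1 + (l.map fun a => (f a).time).sum +
      (l.flatMap fun a => (f a).val).length := by
  induction l with
  | nil => rfl
  | cons a l ih => simp [flatMapT, ih]; omega

@[simp] theorem splitByT_val (test : α → Timed Bool) (l : List α) :
    (splitByT test l).val = (l.filter fun a => (test a).val, l.filter fun a => !(test a).val) := by
  induction l with
  | nil => rfl
  | cons a l ih =>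
    cases h : (test a).val <;> simp [splitByT, ih, h]

theorem splitByT_time (test : α → Timed Bool) (h : ∀ a, (test a).time = 1) (l : List α) :
    (splitByT test l).time = 2 * l.length + 1 := by
  induction l with
  | nil => rfl
  | cons a l ih =>
    simp [splitByT, ih, h]; omega

@[simp] theorem findT_val (test : α → Timed Bool) (l : List α) :
    (findT test l).val = l.find? fun a => (test a).val := by
  induction l with
  | nil => rfl
  | cons a l ih =>
    cases h : (test a).val <;> simp [findT, ih, h]

theorem findT_time_le (test : α → Timed Bool) (c : ℕ) (h : ∀ a, (test a).time ≤ c) (l : List α) :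
    (findT test l).time ≤ (c + 1) * l.length + 1 := by
  induction l with
  | nil => simp [findT]
  | cons a l ih =>
    have := h a
    cases h' : (test a).val <;> simp [findT, h'] <;> nlinarith

@[simp] theorem popWhileT_val (test : α → Timed Bool) (l : List α) :
    (popWhileT test l).val = l.dropWhile fun a => (test a).val := by
  induction l with
  | nil => rfl
  | cons a l ih =>
    cases h : (test a).val <;> simp [popWhileT, ih, h]

/-- Stated in amortised form: each removed member pays two steps for itself, so twice the stack
height serves as a potential in the analysis of the sweeps. -/
theorem popWhileT_time_le (test : α → Timed Bool) (h : ∀ a, (test a).time = 1) (l : List α) :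
    (popWhileT test l).time + 2 * (l.dropWhile fun a => (test a).val).length ≤
      2 * l.length + 2 := by
  induction l with
  | nil => simp [popWhileT]
  | cons a l ih =>
    cases h' : (test a).val <;> simp [popWhileT, h, h'] <;> omega

end Lists

/-! ### Insertion sort, merging and merge sort -/

section Sorting

variable {R : Type} [LinearOrder R] {α : Type}

@[simp] theorem ltT_val (u v : R) : (ltT u v).val = decide (u < v) := rfl

@[simp] theorem ltT_time (u v : R) : (ltT u v).time = 1 := rfl

theorem insertT_perm (key : α → R) (a : α) (l : List α) :
    (insertT key a l).val.Perm (a :: l) := by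
  induction l with
  | nil => simp [insertT]
  | cons b l ih =>
    by_cases h : key b < key a
    · simp only [insertT, Timed.val_bind, ltT_val, h, decide_true, if_true, Timed.val_pure]
      exact (ih.cons b).trans (List.Perm.swap a b l)
    · simp [insertT, h]

theorem insertT_sorted (key : α → R) (a : α) (l : List α)
    (hl : l.Pairwise fun x y => key x ≤ key y) :
    (insertT key a l).val.Pairwise fun x y => key x ≤ key y := by
  induction l with
  | nil => simp [insertT]
  | cons b l ih =>
    rw [List.pairwise_cons] at hl
    by_cases h : key b < key a
    · simp only [insertT, Timed.val_bind, ltT_val, h, decide_true, if_true, Timed.val_pure]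
      refine List.pairwise_cons.2 ⟨fun x hx => ?_, ih hl.2⟩
      rcases List.mem_cons.1 ((insertT_perm key a l).mem_iff.1 hx) with rfl | hx
      · exact h.le
      · exact hl.1 x hx
    · simp only [insertT, Timed.val_bind, ltT_val, h, decide_false]
      refine List.pairwise_cons.2 ⟨fun x hx => ?_, List.pairwise_cons.2 hl⟩
      rcases List.mem_cons.1 hx with rfl | hx
      · exact not_lt.1 h
      · exact (not_lt.1 h).trans (hl.1 x hx)

theorem insertT_time_le (key : α → R) (a : α) (l : List α) :
    (insertT key a l).time ≤ 2 * l.length + 1 := by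
  induction l with
  | nil => simp [insertT]
  | cons b l ih =>
    by_cases h : key b < key a <;> simp [insertT, h] <;> omega

theorem insertionSortT_perm (key : α → R) (l : List α) : (insertionSortT key l).val.Perm l := by
  induction l with
  | nil => simp [insertionSortT]
  | cons a l ih =>
    exact (insertT_perm key a _).trans (ih.cons a)

theorem insertionSortT_sorted (key : α → R) (l : List α) :
    (insertionSortT key l).val.Pairwise fun x y => key x ≤ key y := by
  induction l with
  | nil => simp [insertionSortT]
  | cons a l ih => exact insertT_sorted key a _ ih

/-- A quadratic bound suffices: only groups of five, lists of at most 100 members and the range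
sides of a batch are sorted this way. -/
theorem insertionSortT_time_le (key : α → R) (l : List α) :
    (insertionSortT key l).time ≤ (l.length + 1) ^ 2 := by
  induction l with
  | nil => simp [insertionSortT]
  | cons a l ih =>
    have h := insertT_time_le key a (insertionSortT key l).val
    rw [(insertionSortT_perm key l).length_eq] at h
    simp [insertionSortT]
    nlinarith

theorem mergeT_perm (key : α → R) (l l' : List α) : (mergeT key l l').val.Perm (l ++ l') := by
  fun_induction mergeT key l l' with
  | case1 l' => simp
  | case2 a l => simp
  | case3 a l b l' ih₁ ih₂ =>
    by_cases h : key b < key a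
    · simp only [Timed.val_bind, ltT_val, h, decide_true, if_true, Timed.val_pure]
      exact (ih₁.cons b).trans List.perm_middle.symm
    · simp only [Timed.val_bind, ltT_val, h, decide_false]
      exact ih₂.cons a

theorem mergeT_sorted (key : α → R) (l l' : List α)
    (hl : l.Pairwise fun x y => key x ≤ key y) (hl' : l'.Pairwise fun x y => key x ≤ key y) :
    (mergeT key l l').val.Pairwise fun x y => key x ≤ key y := by
  fun_induction mergeT key l l' with
  | case1 l' => simpa
  | case2 a l => exact hl
  | case3 a l b l' ih₁ ih₂ =>
    have hl₀ := List.pairwise_cons.1 hl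
    have hl₀' := List.pairwise_cons.1 hl'
    by_cases h : key b < key a
    · simp only [Timed.val_bind, ltT_val, h, decide_true, if_true, Timed.val_pure]
      refine List.pairwise_cons.2 ⟨fun x hx => ?_, ih₁ hl hl₀'.2⟩
      rcases List.mem_append.1 ((mergeT_perm key _ _).mem_iff.1 hx) with hx | hx
      · rcases List.mem_cons.1 hx with rfl | hx
        · exact h.le
        · exact h.le.trans (hl₀.1 x hx)
      · exact hl₀'.1 x hx
    · simp only [Timed.val_bind, ltT_val, h, decide_false]
      refine List.pairwise_cons.2 ⟨fun x hx => ?_, ih₂ hl₀.2 hl'⟩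
      rcases List.mem_append.1 ((mergeT_perm key _ _).mem_iff.1 hx) with hx | hx
      · exact hl₀.1 x hx
      · rcases List.mem_cons.1 hx with rfl | hx
        · exact not_lt.1 h
        · exact (not_lt.1 h).trans (hl₀'.1 x hx)

theorem mergeT_time_le (key : α → R) (l l' : List α) :
    (mergeT key l l').time ≤ 2 * (l.length + l'.length) + 1 := by
  fun_induction mergeT key l l' with
  | case1 l' => simp
  | case2 a l => simp
  | case3 a l b l' ih₁ ih₂ =>
    by_cases h : key b < key a <;> simp [h] at * <;> omega

theorem mergeSortT_perm (key : α → R) (fuel : ℕ) (l : List α) :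
    (mergeSortT key fuel l).val.Perm l := by
  induction fuel generalizing l with
  | zero => simp [mergeSortT]
  | succ fuel ih =>
    by_cases h : l.length ≤ 1
    · simp [mergeSortT, h]
    · simp only [mergeSortT, Timed.val_bind, lengthT_val, h, if_false, splitAtT_val]
      refine (mergeT_perm key _ _).trans (((ih _).append (ih _)).trans ?_)
      rw [List.take_append_drop]

theorem mergeSortT_sorted (key : α → R) (fuel : ℕ) (l : List α) (hf : l.length ≤ fuel) :
    (mergeSortT key fuel l).val.Pairwise fun x y => key x ≤ key y := by
  induction fuel generalizing l with
  | zero =>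
    obtain rfl : l = [] := List.length_eq_zero_iff.1 (Nat.le_zero.1 hf)
    simp [mergeSortT]
  | succ fuel ih =>
    by_cases h : l.length ≤ 1
    · simp only [mergeSortT, Timed.val_bind, lengthT_val, h, if_true, Timed.val_pure]
      match l, h with
      | [], _ => simp
      | [a], _ => simp
    · simp only [mergeSortT, Timed.val_bind, lengthT_val, h, if_false, splitAtT_val]
      exact mergeT_sorted key _ _ (ih _ (by simp; omega)) (ih _ (by simp; omega))

/-- The recurrence of divide-and-conquer algorithms with linear overhead. -/
theorem halving_recurrence {a b n : ℕ} (hab : 2 * b ≤ a) (hn : 2 ≤ n) :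
    a * (n / 2 * (Nat.clog 2 (n / 2) + 1)) + a * ((n - n / 2) * (Nat.clog 2 (n - n / 2) + 1)) +
      b * (n + 1) ≤ a * (n * (Nat.clog 2 n + 1)) := by
  have h : Nat.clog 2 n = Nat.clog 2 ((n + 1) / 2) + 1 := by
    simpa using Nat.clog_of_two_le (b := 2) (n := n) (by norm_num) hn
  have h₁ : Nat.clog 2 (n / 2) + 1 ≤ Nat.clog 2 n := by
    rw [h]; exact Nat.succ_le_succ (Nat.clog_mono_right 2 (by omega))
  have h₂ : Nat.clog 2 (n - n / 2) + 1 ≤ Nat.clog 2 n := by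
    rw [h]; exact Nat.succ_le_succ (Nat.clog_mono_right 2 (by omega))
  calc _ ≤ a * (n / 2 * Nat.clog 2 n) + a * ((n - n / 2) * Nat.clog 2 n) + a * n := by
        gcongr ?_ + ?_ + ?_
        · gcongr
        · gcongr
        · nlinarith
    _ = a * ((n / 2 + (n - n / 2)) * Nat.clog 2 n + n) := by ring
    _ = a * (n * (Nat.clog 2 n + 1)) := by
        rw [show n / 2 + (n - n / 2) = n by omega]; ring

theorem mergeSortT_time_le (key : α → R) (fuel : ℕ) (l : List α) :
    (mergeSortT key fuel l).time ≤ 20 * (l.length * (Nat.clog 2 l.length + 1)) + 3 := by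
  induction fuel generalizing l with
  | zero => simp [mergeSortT]
  | succ fuel ih =>
    by_cases h : l.length ≤ 1
    · simp [mergeSortT, h]; omega
    · have h₁ := ih (l.take (l.length / 2))
      have h₂ := ih (l.drop (l.length / 2))
      have h₃ := splitAtT_time_le (l.length / 2) l
      have h₄ := mergeT_time_le key (mergeSortT key fuel (l.take (l.length / 2))).val
        (mergeSortT key fuel (l.drop (l.length / 2))).val
      -- Counting, splitting and merging cost about `4 n` steps per level; `b = 10` also absorbs the
      -- additive constants of the two recursive calls.
      have h₅ := halving_recurrence (a := 20) (b := 10) (n := l.length) (by norm_num) (by omega)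
      simp only [(mergeSortT_perm key _ _).length_eq, List.length_take, List.length_drop,
        min_eq_left (Nat.div_le_self l.length 2)] at h₁ h₂ h₄
      simp only [mergeSortT, Timed.time_bind, Timed.time_tick, lengthT_val, lengthT_time, h,
        if_false, splitAtT_val]
      omega

end Sorting

/-! ### Visibility and the irrelevance of points that do not participate -/

section Visibility

variable {R : Type}

/-- No two points of the set share a coordinate. -/
def InGeneralPosition (S : Finset (CPoint R)) : Prop :=
  ∀ p ∈ S, ∀ q ∈ S, p.x = q.x ∨ p.y = q.y → p = q

theorem InGeneralPosition.mono {S S' : Finset (CPoint R)} (hS : InGeneralPosition S)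
    (h : S' ⊆ S) : InGeneralPosition S' :=
  fun p hp q hq => hS p (h hp) q (h hq)

theorem GeneralPosition.nodup {S : List (CPoint R)} (hS : GeneralPosition S) : S.Nodup :=
  List.Pairwise.imp (fun h h' => h.1 (by rw [h'])) hS

variable [LinearOrder R]

theorem GeneralPosition.toFinset {S : List (CPoint R)} (hS : GeneralPosition S) :
    InGeneralPosition S.toFinset := by
  intro p hp q hq h
  by_contra hne
  have hsymm : Std.Symm fun p q : CPoint R => p.x ≠ q.x ∧ p.y ≠ q.y :=
    ⟨fun _ _ h => ⟨h.1.symm, h.2.symm⟩⟩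
  have := List.Pairwise.forall hS (List.mem_toFinset.1 hp) (List.mem_toFinset.1 hq) hne
  tauto

/-- `s` lies in the interior of the box spanned by `p` and `q`. -/
def Between (p q s : CPoint R) : Prop :=
  min p.x q.x < s.x ∧ s.x < max p.x q.x ∧ min p.y q.y < s.y ∧ s.y < max p.y q.y

/-- `s` lies in the closed box spanned by `p` and `q`. -/
def InSpan (p q s : CPoint R) : Prop :=
  min p.x q.x ≤ s.x ∧ s.x ≤ max p.x q.x ∧ min p.y q.y ≤ s.y ∧ s.y ≤ max p.y q.y

theorem Between.inSpan {p q s : CPoint R} (h : Between p q s) : InSpan p q s :=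
  ⟨h.1.le, h.2.1.le, h.2.2.1.le, h.2.2.2.le⟩

theorem inSpan_left (p q : CPoint R) : InSpan p q p := by simp [InSpan]

theorem inSpan_right (p q : CPoint R) : InSpan p q q := by simp [InSpan]

theorem InSpan.bounds {p q s t : CPoint R} (hs : InSpan p q s) (ht : InSpan p q t) :
    min p.x q.x ≤ min s.x t.x ∧ max s.x t.x ≤ max p.x q.x ∧
    min p.y q.y ≤ min s.y t.y ∧ max s.y t.y ≤ max p.y q.y :=
  ⟨le_min hs.1 ht.1, max_le hs.2.1 ht.2.1, le_min hs.2.2.1 ht.2.2.1, max_le hs.2.2.2 ht.2.2.2⟩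

theorem InSpan.trans {p q s t u : CPoint R} (hs : InSpan p q s) (ht : InSpan p q t)
    (hu : InSpan s t u) : InSpan p q u := by
  obtain ⟨h₁, h₂, h₃, h₄⟩ := hs.bounds ht
  exact ⟨h₁.trans hu.1, hu.2.1.trans h₂, h₃.trans hu.2.2.1, hu.2.2.2.trans h₄⟩

theorem Between.mono {p q s t u : CPoint R} (hs : InSpan p q s) (ht : InSpan p q t)
    (hu : Between s t u) : Between p q u := by
  obtain ⟨h₁, h₂, h₃, h₄⟩ := hs.bounds ht
  exact ⟨h₁.trans_lt hu.1, hu.2.1.trans_le h₂, h₃.trans_lt hu.2.2.1, hu.2.2.2.trans_le h₄⟩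

theorem not_between_right (p q : CPoint R) : ¬ Between p q q := by
  rintro ⟨h₁, h₂, -, -⟩
  rcases le_total p.x q.x with h | h
  · exact absurd h₂ (by simp [h])
  · exact absurd h₁ (by simp [h])

theorem Sees.symm {S : Finset (CPoint R)} {p q : CPoint R} (h : Sees S p q) : Sees S q p := by
  intro s hs
  simpa only [min_comm, max_comm] using h s hs

/-- In the box spanned by two points of different colours, two points of different colours see each
other. -/
theorem exists_sees_of_color_ne (S : Finset (CPoint R)) {p q : CPoint R} (hp : p ∈ S) (hq : q ∈ S)
    (hc : p.color ≠ q.color) :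
    ∃ s ∈ S, ∃ t ∈ S, s.color ≠ t.color ∧ Sees S s t ∧ InSpan p q s ∧ InSpan p q t := by
  classical
  -- The induction is on the number of points strictly inside the spanned box.
  induction hn : (S.filter (Between p q)).card using Nat.strong_induction_on
    generalizing p q with
  | _ n ih =>
    subst hn
    by_cases h : Sees S p q
    · exact ⟨p, hp, q, hq, hc, h, inSpan_left p q, inSpan_right p q⟩
    · obtain ⟨u, hu, hb⟩ : ∃ u ∈ S, Between p q u := by
        simpa only [Sees, Between, not_forall, not_not, exists_prop] using h
      -- The blocker `u` replaces the corner of its own colour. The new box lies in the old one, and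
      -- `u`, now a corner, is no longer in its interior, so the count drops.
      have key : ∀ v : CPoint R, v ∈ S → InSpan p q v → v.color ≠ u.color →
          ∃ s ∈ S, ∃ t ∈ S, s.color ≠ t.color ∧ Sees S s t ∧ InSpan p q s ∧ InSpan p q t := by
        intro v hv hvs hcv
        have hlt : (S.filter (Between v u)).card < (S.filter (Between p q)).card := by
          refine Finset.card_lt_card (Finset.ssubset_iff_of_subset ?_ |>.2 ⟨u, ?_, ?_⟩)
          · intro w hw
            rw [Finset.mem_filter] at hw ⊢
            exact ⟨hw.1, Between.mono hvs hb.inSpan hw.2⟩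
          · exact Finset.mem_filter.2 ⟨hu, hb⟩
          · simp [not_between_right]
        obtain ⟨s, hs, t, ht, hst, hsee, h₁, h₂⟩ := ih _ hlt hv hu hcv rfl
        exact ⟨s, hs, t, ht, hst, hsee, hvs.trans hb.inSpan h₁, hvs.trans hb.inSpan h₂⟩
      by_cases hpu : p.color = u.color
      · exact key q hq (inSpan_right p q) (by rw [← hpu]; exact hc.symm)
      · exact key p hp (inSpan_left p q) hpu

theorem participates_of_sees {S : Finset (CPoint R)} {p q : CPoint R} (hp : p ∈ S) (hq : q ∈ S)
    (hc : p.color ≠ q.color) (h : Sees S p q) : Participates S p ∧ Participates S q :=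
  ⟨⟨hp, q, hq, hc.symm, h⟩, ⟨hq, p, hp, hc, h.symm⟩⟩

/-- A point of a set in general position in the closed but not in the open box spanned by two
points is one of them. -/
theorem InSpan.eq_or_eq {S : Finset (CPoint R)} (hS : InGeneralPosition S) {p q s : CPoint R}
    (hp : p ∈ S) (hq : q ∈ S) (hs : s ∈ S) (h : InSpan p q s) (h' : ¬ Between p q s) :
    s = p ∨ s = q := by
  by_contra hne
  rw [not_or] at hne
  have h₁ := mt (hS s hs p hp) hne.1
  have h₂ := mt (hS s hs q hq) hne.2
  rw [not_or] at h₁ h₂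
  apply h'
  refine ⟨lt_of_le_of_ne h.1 ?_, lt_of_le_of_ne h.2.1 ?_, lt_of_le_of_ne h.2.2.1 ?_,
    lt_of_le_of_ne h.2.2.2 ?_⟩
  · rcases min_choice p.x q.x with h | h <;> rw [h] <;> tauto
  · rcases max_choice p.x q.x with h | h <;> rw [h] <;> tauto
  · rcases min_choice p.y q.y with h | h <;> rw [h] <;> tauto
  · rcases max_choice p.y q.y with h | h <;> rw [h] <;> tauto

/-- Points that do not participate can be removed. -/
theorem Conforms.participates_iff {Q S : Finset (CPoint R)} (hS : InGeneralPosition S)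
    (h : Conforms Q S) (p : CPoint R) : Participates Q p ↔ Participates S p := by
  constructor
  · rintro ⟨hp, q, hq, hc, hsee⟩
    have hne : p ≠ q := fun e => hc (by rw [e])
    -- A pair that sees each other in `S` exists in the box of `p` and `q`. Both its points
    -- participate in `S`, hence survive in `Q`; as `p` sees `q` in `Q` they are not in the
    -- interior, so general position identifies them with the corners.
    obtain ⟨s, hs, t, ht, hst, hst', h₁, h₂⟩ := exists_sees_of_color_ne S (h.1 hp) (h.1 hq) hc.symm
    have hpart := participates_of_sees hs ht hst hst'
    have hs' := h₁.eq_or_eq hS (h.1 hp) (h.1 hq) hs (hsee s (h.2 s hpart.1))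
    have ht' := h₂.eq_or_eq hS (h.1 hp) (h.1 hq) ht (hsee t (h.2 t hpart.2))
    rcases hs' with rfl | rfl <;> rcases ht' with rfl | rfl
    · exact absurd rfl hst
    · exact hpart.1
    · exact hpart.2
    · exact absurd rfl hst
  · rintro ⟨hp, q, hq, hc, hsee⟩
    have hpart := participates_of_sees hp hq hc.symm hsee
    exact ⟨h.2 p hpart.1, q, h.2 q hpart.2, hc, fun s hs => hsee s (h.1 hs)⟩

theorem Conforms.refl (S : Finset (CPoint R)) : Conforms S S := ⟨subset_rfl, fun _ h => h.1⟩

theorem Conforms.trans {Q' Q S : Finset (CPoint R)} (hS : InGeneralPosition S)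
    (h : Conforms Q S) (h' : Conforms Q' Q) : Conforms Q' S :=
  ⟨h'.1.trans h.1, fun p hp => h'.2 p ((h.participates_iff hS p).2 hp)⟩

end Visibility

/-! ### Safe boxes and their stability -/

section Safety

variable {R : Type} [LinearOrder R]

theorem Box.Contains.inCross {B : Box R} {p : CPoint R} (h : B.Contains p) : B.InCross p :=
  Or.inl h.1

theorem Box.inCross_or_inQuadrant (B : Box R) (p : CPoint R) :
    B.InCross p ∨ ∃ east north, B.InQuadrant east north p := by
  by_cases h : B.InCross p
  · exact Or.inl h
  · right
    simp only [Box.InCross, not_or, not_and_or, not_le] at h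
    simp only [Box.InQuadrant]
    rcases h with ⟨h₁ | h₁, h₂ | h₂⟩
    · exact ⟨false, false, by simp [h₁, h₂]⟩
    · exact ⟨false, true, by simp [h₁, h₂]⟩
    · exact ⟨true, false, by simp [h₁, h₂]⟩
    · exact ⟨true, true, by simp [h₁, h₂]⟩

/-- Below every point there is a minimal one. -/
theorem exists_inMinimalSet {S : Finset (CPoint R)} (hS : InGeneralPosition S)
    (P : CPoint R → Prop) (e n : Bool) {q : CPoint R} (hq : q ∈ S) (hP : P q) :
    ∃ m, InMinimalSet e n {s | s ∈ S ∧ P s} m ∧ (m = q ∨ Dominates e n q m) := by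
  classical
  -- A point of extreme `x` among `q` and the points below it is minimal: anything below it would
  -- have the same `x`, which general position excludes.
  let A := S.filter fun s => P s ∧ (s = q ∨ Dominates e n q s)
  have hA : A.Nonempty := ⟨q, by simp [A, hq, hP]⟩
  obtain ⟨m, hm, hmin⟩ : ∃ m ∈ A, ∀ s ∈ A, if e then m.x ≤ s.x else s.x ≤ m.x := by
    cases e
    · simpa using A.exists_max_image CPoint.x hA
    · simpa using A.exists_min_image CPoint.x hA
  simp only [A, Finset.mem_filter] at hm hmin
  refine ⟨m, ⟨⟨hm.1, hm.2.1⟩, fun d hd hdom => ?_⟩, hm.2.2⟩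
  have hdq : d = q ∨ Dominates e n q d := by
    rcases hm.2.2 with rfl | hmq
    · exact Or.inr hdom
    · by_cases hdq : d = q
      · exact Or.inl hdq
      · refine Or.inr ⟨hdq, ?_, ?_⟩
        · have h₁ := hdom.2.1
          have h₂ := hmq.2.1
          cases e
          · exact le_trans (b := m.x) (by simpa using h₂) (by simpa using h₁)
          · exact le_trans (b := m.x) (by simpa using h₁) (by simpa using h₂)
        · have h₁ := hdom.2.2
          have h₂ := hmq.2.2
          cases n
          · exact le_trans (b := m.y) (by simpa using h₂) (by simpa using h₁)
          · exact le_trans (b := m.y) (by simpa using h₁) (by simpa using h₂)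
  have h₁ := hmin d ⟨hd.1, hd.2, hdq⟩
  have h₂ := hdom.2.1
  refine hdom.1 (hS d hd.1 m hm.1 (Or.inl ?_))
  cases e
  · exact le_antisymm (by simpa using h₁) (by simpa using h₂)
  · exact le_antisymm (by simpa using h₂) (by simpa using h₁)

/-- The points in a safe box do not participate. -/
theorem Box.SafeColor.not_participates {S : Finset (CPoint R)} (hS : InGeneralPosition S)
    {B : Box R} {c : Color} (hB : B.SafeColor S c) {p : CPoint R} (hp : B.Contains p) :
    ¬ Participates S p := by
  rintro ⟨hpS, q, hq, hc, hsee⟩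
  have hpc := hB.1 p hpS hp.inCross
  rcases B.inCross_or_inQuadrant q with hq' | ⟨e, n, hq'⟩
  · exact hc (by rw [hB.1 q hq hq', hpc])
  -- The minimal point `m` below `q` is the blocker. It lies strictly beyond `p`, which is in the
  -- box while `m` is in a quadrant, and strictly before `q` by general position.
  obtain ⟨m, hm, hmq⟩ := exists_inMinimalSet hS (B.InQuadrant e n) e n hq hq'
  have hmc := hB.2 e n m hm
  have hne : m ≠ q := by rintro rfl; exact hc (by rw [hmc, hpc])
  have hdom := hmq.resolve_left hne
  have hxy := mt (hS m hm.1.1 q hq) hne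
  rw [not_or] at hxy
  have hquad := hm.1.2
  obtain ⟨⟨h₁, h₂⟩, h₃, h₄⟩ := hp
  obtain ⟨g₁, g₂⟩ := hquad
  obtain ⟨-, d₁, d₂⟩ := hdom
  have hX : min p.x q.x < m.x ∧ m.x < max p.x q.x := by
    cases e
    · simp only [Bool.false_eq_true, if_false] at g₁ d₁
      exact ⟨min_lt_iff.2 (Or.inr (lt_of_le_of_ne d₁ (Ne.symm hxy.1))),
        lt_max_iff.2 (Or.inl (g₁.trans_le h₁))⟩
    · simp only [if_true] at g₁ d₁
      exact ⟨min_lt_iff.2 (Or.inl (h₂.trans_lt g₁)),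
        lt_max_iff.2 (Or.inr (lt_of_le_of_ne d₁ hxy.1))⟩
  have hY : min p.y q.y < m.y ∧ m.y < max p.y q.y := by
    cases n
    · simp only [Bool.false_eq_true, if_false] at g₂ d₂
      exact ⟨min_lt_iff.2 (Or.inr (lt_of_le_of_ne d₂ (Ne.symm hxy.2))),
        lt_max_iff.2 (Or.inl (g₂.trans_le h₃))⟩
    · simp only [if_true] at g₂ d₂
      exact ⟨min_lt_iff.2 (Or.inl (h₄.trans_lt g₂)),
        lt_max_iff.2 (Or.inr (lt_of_le_of_ne d₂ hxy.2))⟩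
  exact hsee m hm.1.1 ⟨hX.1, hX.2, hY.1, hY.2⟩

theorem Box.Safe.not_participates {S : Finset (CPoint R)} (hS : InGeneralPosition S)
    {B : Box R} (hB : B.Safe S) {p : CPoint R} (hp : B.Contains p) : ¬ Participates S p :=
  hB.elim (fun h => h.not_participates hS hp) (fun h => h.not_participates hS hp)

/-- Safety passes to smaller boxes. -/
theorem Box.SafeColor.of_subbox {S : Finset (CPoint R)} {B B' : Box R} {c : Color}
    (hB : B.SafeColor S c) (hx : B'.xmin ≤ B'.xmax) (hy : B'.ymin ≤ B'.ymax)
    (h₁ : B.xmin ≤ B'.xmin) (h₂ : B'.xmax ≤ B.xmax) (h₃ : B.ymin ≤ B'.ymin)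
    (h₄ : B'.ymax ≤ B.ymax) : B'.SafeColor S c := by
  refine ⟨fun p hp hcross => hB.1 p hp ?_, fun e n p hp => ?_⟩
  · exact hcross.imp (fun h => ⟨h₁.trans h.1, h.2.trans h₂⟩) fun h => ⟨h₃.trans h.1, h.2.trans h₄⟩
  -- Either the larger cross already fixes the colour, or the point is in the same quadrant of the
  -- larger box. That quadrant is contained in the one of the smaller box, so minimality is
  -- inherited.
  · by_cases hcross : B.InCross p
    · exact hB.1 p hp.1.1 hcross
    · have hsub : ∀ s, B.InQuadrant e n s → B'.InQuadrant e n s := by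
        rintro s ⟨hs₁, hs₂⟩
        refine ⟨?_, ?_⟩
        · cases e
          · exact lt_of_lt_of_le (by simpa using hs₁) h₁
          · exact lt_of_le_of_lt h₂ (by simpa using hs₁)
        · cases n
          · exact lt_of_lt_of_le (by simpa using hs₂) h₃
          · exact lt_of_le_of_lt h₄ (by simpa using hs₂)
      have hin : B.InQuadrant e n p := by
        obtain ⟨g₁, g₂⟩ := hp.1.2
        simp only [Box.InCross, not_or, not_and, not_le] at hcross
        refine ⟨?_, ?_⟩
        · cases e
          · simp only [Bool.false_eq_true, if_false] at g₁ ⊢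
            by_contra h
            exact absurd (hcross.1 (not_lt.1 h)) (not_lt.2 (g₁.le.trans (hx.trans h₂)))
          · simp only [if_true] at g₁ ⊢
            exact hcross.1 (h₁.trans (hx.trans g₁.le))
        · cases n
          · simp only [Bool.false_eq_true, if_false] at g₂ ⊢
            by_contra h
            exact absurd (hcross.2 (not_lt.1 h)) (not_lt.2 (g₂.le.trans (hy.trans h₄)))
          · simp only [if_true] at g₂ ⊢
            exact hcross.2 (h₃.trans (hy.trans g₂.le))
      exact hB.2 e n p ⟨⟨hp.1.1, hin⟩, fun q hq => hp.2 q ⟨hq.1, hsub q hq.2⟩⟩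

/-- A point of the box spanned by `p` and a point below `p` is `p` or below `p`. -/
theorem Dominates.of_inSpan {e n : Bool} {p m s : CPoint R} (h : Dominates e n p m)
    (hs : InSpan m p s) (hne : s ≠ p) : Dominates e n p s := by
  obtain ⟨-, d₁, d₂⟩ := h
  obtain ⟨s₁, s₂, s₃, s₄⟩ := hs
  refine ⟨hne, ?_, ?_⟩
  · cases e
    · simp only [Bool.false_eq_true, if_false] at d₁ ⊢
      rwa [min_eq_right d₁] at s₁
    · simp only [if_true] at d₁ ⊢
      rwa [max_eq_right d₁] at s₂
  · cases n
    · simp only [Bool.false_eq_true, if_false] at d₂ ⊢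
      rwa [min_eq_right d₂] at s₃
    · simp only [if_true] at d₂ ⊢
      rwa [max_eq_right d₂] at s₄

theorem Box.InQuadrant.of_inSpan {B : Box R} {e n : Bool} {p m s : CPoint R}
    (hp : B.InQuadrant e n p) (hm : B.InQuadrant e n m) (hs : InSpan m p s) :
    B.InQuadrant e n s := by
  obtain ⟨s₁, s₂, s₃, s₄⟩ := hs
  refine ⟨?_, ?_⟩
  · have h₁ := hp.1
    have h₂ := hm.1
    cases e
    · simp only [Bool.false_eq_true, if_false] at h₁ h₂ ⊢
      exact s₂.trans_lt (max_lt h₂ h₁)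
    · simp only [if_true] at h₁ h₂ ⊢
      exact (lt_min h₂ h₁).trans_le s₁
  · have h₁ := hp.2
    have h₂ := hm.2
    cases n
    · simp only [Bool.false_eq_true, if_false] at h₁ h₂ ⊢
      exact s₄.trans_lt (max_lt h₂ h₁)
    · simp only [if_true] at h₁ h₂ ⊢
      exact (lt_min h₂ h₁).trans_le s₃

/-- Safety is kept when points that do not participate are removed. -/
theorem Box.SafeColor.of_conforms {Q S : Finset (CPoint R)} (hS : InGeneralPosition S)
    (h : Conforms Q S) {B : Box R} {c : Color} (hB : B.SafeColor S c) : B.SafeColor Q c := by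
  refine ⟨fun p hp => hB.1 p (h.1 hp), fun e n p hp => ?_⟩
  by_contra hc
  have hpS := h.1 hp.1.1
  -- If `p` had the wrong colour, a minimal point `m` of `S` below it would have the right one.
  -- Between them two points of different colours see each other, hence both survive in `Q`;
  -- minimality of `p` in `Q` forces both to be `p`.
  obtain ⟨m, hm, hmp⟩ := exists_inMinimalSet hS (B.InQuadrant e n) e n hpS hp.1.2
  have hmc := hB.2 e n m hm
  have hne : m ≠ p := by rintro rfl; exact hc hmc
  have hdom := hmp.resolve_left hne
  obtain ⟨s, hs, t, ht, hst, hsee, h₁, h₂⟩ :=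
    exists_sees_of_color_ne S hm.1.1 hpS (by rw [hmc]; exact Ne.symm hc)
  have hpart := participates_of_sees hs ht hst hsee
  have key : ∀ u, Participates S u → InSpan m p u → u = p := by
    intro u hu hspan
    by_contra hup
    exact hp.2 u ⟨h.2 u hu, hp.1.2.of_inSpan hm.1.2 hspan⟩ (hdom.of_inSpan hspan hup)
  exact hst (by rw [key s hpart.1 h₁, key t hpart.2 h₂])

end Safety

/-! ### Linear-time selection by medians of medians -/

section Selection

variable {α : Type}

theorem nodup_map_of_subperm {β : Type} {key : α → β} {l l' : List α} (h : l.Subperm l')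
    (h' : (l'.map key).Nodup) : (l.map key).Nodup := by
  obtain ⟨m, hm, hs⟩ := h
  exact (hm.map key).nodup_iff.1 (h'.sublist (hs.map key))

variable {R : Type} [LinearOrder R]

theorem exists_eq_of_length_eq_five {s : List α} (h : s.length = 5) :
    ∃ a b c d e, s = [a, b, c, d, e] := by
  match s, h with
  | [a, b, c, d, e], _ => exact ⟨a, b, c, d, e, rfl⟩

/-- The median of five elements. -/
theorem median_of_five (key : α → R) (a b c d e : α) :
    ∃ m, (insertionSortT key [a, b, c, d, e]).val[2]? = some m ∧ m ∈ [a, b, c, d, e] ∧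
      (∀ v, key m ≤ v → 3 ≤ [a, b, c, d, e].countP fun z => decide (key z ≤ v)) ∧
      (∀ v, v ≤ key m → 3 ≤ [a, b, c, d, e].countP fun z => decide (v ≤ key z)) := by
  have hp := insertionSortT_perm key [a, b, c, d, e]
  have hs := insertionSortT_sorted key [a, b, c, d, e]
  obtain ⟨a', b', c', d', e', h⟩ := exists_eq_of_length_eq_five hp.length_eq
  rw [h] at hp hs ⊢
  simp only [List.pairwise_cons, List.mem_cons, List.not_mem_nil, or_false] at hs
  refine ⟨c', rfl, hp.mem_iff.1 (by simp), fun v hv => ?_, fun v hv => ?_⟩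
  · rw [← hp.countP_eq]
    have h₁ : key a' ≤ v := (hs.1 c' (by simp)).trans hv
    have h₂ : key b' ≤ v := (hs.2.1 c' (by simp)).trans hv
    simp [List.countP_cons, h₁, h₂, hv]
  · rw [← hp.countP_eq]
    have h₁ : v ≤ key d' := hv.trans (hs.2.2.1 d' (by simp))
    have h₂ : v ≤ key e' := hv.trans (hs.2.2.1 e' (by simp))
    simp [List.countP_cons, h₁, h₂, hv, add_assoc]

/-- A group of five whose median is at most `v` has three members at most `v`. The last, incomplete
group contributes one member, which stands only for itself; this is the slack 2. A full group takes
at most 36 + 6 + 1 steps, which is below 9 for each of its members. -/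
theorem mediansT_spec (key : α → R) (l : List α) :
    (mediansT key l).val.length = (l.length + 4) / 5 ∧
    (mediansT key l).val.Subperm l ∧
    (∀ v, 3 * (mediansT key l).val.countP (fun z => decide (key z ≤ v)) ≤
      l.countP (fun z => decide (key z ≤ v)) + 2) ∧
    (∀ v, 3 * (mediansT key l).val.countP (fun z => decide (v ≤ key z)) ≤
      l.countP (fun z => decide (v ≤ key z)) + 2) ∧
    (mediansT key l).time ≤ 9 * l.length + 1 := by
  fun_induction mediansT key l with
  | case1 => simp
  | case2 a b c d e l ih =>
    obtain ⟨ih₁, ih₂, ih₃, ih₄, ih₅⟩ := ih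
    obtain ⟨m, hm, hmem, hle, hge⟩ := median_of_five key a b c d e
    have ht₁ := insertionSortT_time_le key [a, b, c, d, e]
    have ht₂ := nthT_time_le 2 (insertionSortT key [a, b, c, d, e]).val
    rw [(insertionSortT_perm key [a, b, c, d, e]).length_eq] at ht₂
    simp only [Timed.val_bind, nthT_val, hm, Timed.val_pure, Timed.time_bind, Timed.time_pure,
      Timed.time_tick]
    have hl : ∀ p : α → Bool, (a :: b :: c :: d :: e :: l).countP p =
        [a, b, c, d, e].countP p + l.countP p := fun p => by
      rw [← List.countP_append]; rfl
    refine ⟨?_, ?_, fun v => ?_, fun v => ?_, ?_⟩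
    · simp [ih₁]; omega
    · have h : (m :: (mediansT key l).val).Subperm ([a, b, c, d, e] ++ l) :=
        List.Subperm.append (l₁ := [m]) (List.singleton_subperm_iff.2 hmem) ih₂
      exact h
    · have := ih₃ v
      have := hle v
      rw [hl, List.countP_cons]
      by_cases h : key m ≤ v <;> simp [h] at * <;> omega
    · have := ih₄ v
      have := hge v
      rw [hl, List.countP_cons]
      by_cases h : v ≤ key m <;> simp [h] at * <;> omega
    · simp at ht₁ ht₂ ⊢
      omega
  | case3 a l h =>
    have hlen : l.length ≤ 3 := by
      by_contra hlen
      match l, hlen with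
      | b :: c :: d :: e :: l, _ => exact h b c d e l rfl
      | [], h => simp at h
      | [_], h => simp at h
      | [_, _], h => simp at h
      | [_, _, _], h => simp at h
    refine ⟨by simp; omega, by simp, fun v => ?_, fun v => ?_, by simp⟩
    · simp only [Timed.val_bind, Timed.val_pure, List.countP_cons, List.countP_nil]
      split <;> omega
    · simp only [Timed.val_bind, Timed.val_pure, List.countP_cons, List.countP_nil]
      split <;> omega

theorem countP_key_eq (key : α → R) {l : List α} (h : (l.map key).Nodup) {p : α} (hp : p ∈ l) :
    l.countP (fun a => decide (key a = key p)) = 1 := by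
  have := List.count_eq_one_of_mem h (List.mem_map_of_mem (f := key) hp)
  rw [List.count, List.countP_map] at this
  rw [← this]
  exact List.countP_congr (by simp)

theorem countP_lt_add_countP_le (key : α → R) (l : List α) (v : R) :
    l.countP (fun a => decide (key a < v)) + l.countP (fun a => decide (v ≤ key a)) =
      l.length := by
  rw [List.length_eq_countP_add_countP (fun a => decide (key a < v)) (l := l)]
  congr 2
  ext a
  simp

theorem countP_le_add_countP_lt (key : α → R) (l : List α) (v : R) :
    l.countP (fun a => decide (key a ≤ v)) + l.countP (fun a => decide (v < key a)) =
      l.length := by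
  rw [List.length_eq_countP_add_countP (fun a => decide (key a ≤ v)) (l := l)]
  congr 2
  ext a
  simp

theorem countP_le_eq (key : α → R) {l : List α} (h : (l.map key).Nodup) {p : α} (hp : p ∈ l) :
    l.countP (fun a => decide (key a ≤ key p)) =
      l.countP (fun a => decide (key a < key p)) + 1 := by
  have h₁ := List.countP_filter (p := fun a => decide (key a < key p))
    (q := fun a => decide (key a ≤ key p)) (l := l)
  have h₂ := List.countP_filter (p := fun a => !decide (key a < key p))
    (q := fun a => decide (key a ≤ key p)) (l := l)
  have h₃ := List.length_eq_countP_add_countP (fun a => decide (key a < key p))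
    (l := l.filter fun a => decide (key a ≤ key p))
  rw [← List.countP_eq_length_filter] at h₃
  rw [h₃, ← countP_key_eq key h hp]
  congr 1
  · rw [h₁]
    refine List.countP_congr fun a _ => ?_
    simp only [Bool.and_eq_true, decide_eq_true_eq]
    exact ⟨fun h => h.1, fun h => ⟨h, h.le⟩⟩
  · rw [List.countP_filter]
    refine List.countP_congr fun a _ => ?_
    simp only [Bool.and_eq_true, decide_eq_true_eq, not_lt]
    exact ⟨fun h => le_antisymm h.2 h.1, fun h => ⟨h.ge, h.le⟩⟩

/-- The pivot of the median-of-medians method splits well. -/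
theorem pivot_splits (key : α → R) {l : List α} (hl : (l.map key).Nodup) {p : α}
    (hp : p ∈ (mediansT key l).val)
    (hc : (mediansT key l).val.countP (fun a => decide (key a < key p)) =
      (mediansT key l).val.length / 2) :
    10 * l.countP (fun a => decide (key a < key p)) ≤ 7 * l.length + 20 ∧
    10 * l.countP (fun a => decide (key p < key a)) ≤ 7 * l.length + 20 := by
  obtain ⟨h₁, h₂, h₃, h₄, -⟩ := mediansT_spec key l
  have h₃ := h₃ (key p)
  have h₄ := h₄ (key p)
  have e₁ := countP_le_eq key (nodup_map_of_subperm h₂ hl) hp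
  have e₂ := countP_lt_add_countP_le key (mediansT key l).val (key p)
  have e₃ := countP_lt_add_countP_le key l (key p)
  have e₄ := countP_le_add_countP_lt key l (key p)
  -- About half of the `n / 5` medians lie on either side of the pivot, and each of them brings
  -- three members of `l`: some `3 n / 10` members are excluded on each side.
  omega

/-- With distinct keys a member is determined by its rank, the number of strictly smaller keys; in
this form the rank passes to the two sublists by counting. -/
theorem selectT_val (key : α → R) (fuel k : ℕ) (l : List α) (hl : (l.map key).Nodup)
    (hf : l.length ≤ fuel) (hk : k < l.length) :
    ∃ m ∈ l, (selectT key fuel k l).val = some m ∧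
      l.countP (fun a => decide (key a < key m)) = k := by
  induction fuel generalizing k l with
  | zero => omega
  | succ fuel ih =>
    by_cases hn : l.length ≤ 100
    · have hp := insertionSortT_perm key l
      have hs := insertionSortT_sorted key l
      set s := (insertionSortT key l).val with hs_def
      have hk' : k < s.length := by rw [hp.length_eq]; exact hk
      refine ⟨s[k], hp.mem_iff.1 (List.getElem_mem hk'), ?_, ?_⟩
      · simp [selectT, hn, ← hs_def, hk']
      · rw [← hp.countP_eq]
        have hnd : (s.map key).Nodup := (hp.map key).nodup_iff.2 hl
        have hlt : s.Pairwise fun x y => key x < key y := by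
          have := List.pairwise_map.1 hnd
          exact (hs.and this).imp fun h => lt_of_le_of_ne h.1 h.2
        have hget := List.pairwise_iff_getElem.1 hlt
        have h₁ : (s.take k).countP (fun a => decide (key a < key s[k])) = k := by
          rw [List.countP_eq_length.2, List.length_take, min_eq_left hk'.le]
          intro a ha
          obtain ⟨i, hi, rfl⟩ := List.mem_take_iff_getElem.1 ha
          simpa using hget i k (by omega) hk' (by omega)
        have h₂ : (s.drop k).countP (fun a => decide (key a < key s[k])) = 0 := by
          rw [List.countP_eq_zero]
          intro a ha
          obtain ⟨i, hi, rfl⟩ := List.mem_drop_iff_getElem.1 ha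
          simp only [decide_eq_true_eq, not_lt]
          rcases Nat.eq_zero_or_pos i with rfl | hi'
          · simp
          · exact (hget k (k + i) hk' (by omega) (by omega)).le
        have h₃ := List.countP_append (p := fun a => decide (key a < key s[k])) (l₁ := s.take k)
          (l₂ := s.drop k)
        rw [List.take_append_drop, h₁, h₂] at h₃
        exact h₃
    · obtain ⟨m₁, m₂, -, -, -⟩ := mediansT_spec key l
      obtain ⟨p, hp, hpv, hpc⟩ := ih ((mediansT key l).val.length / 2) (mediansT key l).val
        (nodup_map_of_subperm m₂ hl) (by omega) (by omega)
      have hpl : p ∈ l := m₂.subset hp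
      have hsplit := pivot_splits key hl hp hpc
      simp only [selectT, Timed.val_bind, lengthT_val, hn, if_false, hpv, splitByT_val, ltT_val]
      have hlo : (l.filter fun a => decide (key a < key p)).length =
        l.countP fun a => decide (key a < key p) := List.countP_eq_length_filter.symm
      have hhi : (l.filter fun a => !decide (key a < key p)).filter
          (fun a => decide (key p < key a)) = l.filter fun a => decide (key p < key a) := by
        rw [List.filter_filter]
        refine List.filter_congr fun a _ => ?_
        by_cases h : key p < key a
        · simp [h, h.le]
        · simp [h]
      have hhi' : (l.filter fun a => decide (key p < key a)).length =
        l.countP fun a => decide (key p < key a) := List.countP_eq_length_filter.symm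
      rw [hhi]
      by_cases hk₁ : k < (l.filter fun a => decide (key a < key p)).length
      · rw [if_pos hk₁]
        obtain ⟨m, hm, hmv, hmc⟩ := ih k (l.filter fun a => decide (key a < key p))
          (hl.sublist (List.filter_sublist.map key)) (by omega) hk₁
        have hm' := List.mem_filter.1 hm
        refine ⟨m, hm'.1, hmv, ?_⟩
        rw [← hmc, List.countP_filter]
        refine List.countP_congr fun a _ => ?_
        simp only [Bool.and_eq_true, decide_eq_true_eq] at hm' ⊢
        exact ⟨fun h => ⟨h, h.trans hm'.2⟩, fun h => h.1⟩
      · rw [if_neg hk₁]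
        by_cases hk₂ : k = (l.filter fun a => decide (key a < key p)).length
        · rw [if_pos hk₂]
          exact ⟨p, hpl, rfl, by rw [hk₂, hlo]⟩
        · rw [if_neg hk₂]
          have e₁ := countP_le_add_countP_lt key l (key p)
          have e₂ := countP_le_eq key hl hpl
          obtain ⟨m, hm, hmv, hmc⟩ := ih (k - (l.filter fun a => decide (key a < key p)).length - 1)
            (l.filter fun a => decide (key p < key a))
            (hl.sublist (List.filter_sublist.map key)) (by omega) (by omega)
          have hm' := List.mem_filter.1 hm
          simp only [decide_eq_true_eq] at hm'
          refine ⟨m, hm'.1, hmv, ?_⟩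
          -- The keys below `m` are those up to the pivot, numbering `nlo + 1`, and those of the
          -- upper list below `m`. This is why the recursive rank is `k - nlo - 1`.
          have e₃ := List.length_eq_countP_add_countP (fun a => decide (key a ≤ key p))
            (l := l.filter fun a => decide (key a < key m))
          rw [← List.countP_eq_length_filter, List.countP_filter, List.countP_filter] at e₃
          have e₄ : (l.countP fun a => decide (key a ≤ key p) && decide (key a < key m)) =
              l.countP fun a => decide (key a ≤ key p) := by
            refine List.countP_congr fun a _ => ?_
            simp only [Bool.and_eq_true, decide_eq_true_eq]
            exact ⟨fun h => h.1, fun h => ⟨h, h.trans_lt hm'.2⟩⟩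
          rw [List.countP_filter] at hmc
          have e₅ : (l.countP fun a => decide (¬ decide (key a ≤ key p) = true) &&
              decide (key a < key m)) =
              l.countP fun a => decide (key a < key m) && decide (key p < key a) := by
            refine List.countP_congr fun a _ => ?_
            simp [and_comm]
          omega

/-- The recursive calls handle about `n / 5` and at most `7 n / 10 + 2` members, together a fraction
`9 / 10`. Beyond 100 members the saved tenth of `500 n` pays for the linear work and the rounding;
up to 100 members quadratic sorting is within the bound. -/
theorem selectT_time_le (key : α → R) (fuel k : ℕ) (l : List α) (hl : (l.map key).Nodup)
    (hf : l.length ≤ fuel) : (selectT key fuel k l).time ≤ 500 * l.length + 5 := by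
  induction fuel generalizing k l with
  | zero => simp [selectT]
  | succ fuel ih =>
    by_cases hn : l.length ≤ 100
    · have h₁ := insertionSortT_time_le key l
      have h₂ := nthT_time_le k (insertionSortT key l).val
      rw [(insertionSortT_perm key l).length_eq] at h₂
      simp only [selectT, Timed.time_bind, Timed.time_tick, lengthT_val, hn, if_true, lengthT_time]
      nlinarith
    · obtain ⟨m₁, m₂, -, -, m₅⟩ := mediansT_spec key l
      have hms := nodup_map_of_subperm m₂ hl
      obtain ⟨p, hp, hpv, hpc⟩ := selectT_val key fuel ((mediansT key l).val.length / 2)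
        (mediansT key l).val hms (by omega) (by omega)
      have hsplit := pivot_splits key hl hp hpc
      have hpt := ih ((mediansT key l).val.length / 2) (mediansT key l).val hms (by omega)
      have hlo : (l.filter fun a => decide (key a < key p)).length =
        l.countP fun a => decide (key a < key p) := List.countP_eq_length_filter.symm
      have hrest := List.length_filter_le (fun a => !decide (key a < key p)) l
      have hhi : ((l.filter fun a => !decide (key a < key p)).filter
          (fun a => decide (key p < key a))).length ≤ l.countP fun a => decide (key p < key a) := by
        rw [List.countP_eq_length_filter]
        exact (List.filter_sublist.filter _).length_le
      have ihlo := ih k (l.filter fun a => decide (key a < key p))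
        (hl.sublist (List.filter_sublist.map key)) (by omega)
      have ihhi := ih (k - (l.filter fun a => decide (key a < key p)).length - 1)
        ((l.filter fun a => !decide (key a < key p)).filter (fun a => decide (key p < key a)))
        (hl.sublist ((List.filter_sublist.trans List.filter_sublist).map key)) (by omega)
      simp only [selectT, Timed.time_bind, Timed.time_tick, lengthT_val, lengthT_time, hn,
        if_false, hpv, splitByT_val, ltT_val, splitByT_time _ (fun a => ltT_time _ _)]
      by_cases hk₁ : k < (l.filter fun a => decide (key a < key p)).length
      · rw [if_pos hk₁]
        omega
      · rw [if_neg hk₁]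
        by_cases hk₂ : k = (l.filter fun a => decide (key a < key p)).length
        · rw [if_pos hk₂]
          simp only [Timed.time_pure]
          omega
        · rw [if_neg hk₂]
          omega

end Selection

/-! ### The kd-tree: balance, cost and the cells met by a line -/

section KdTree

variable {R : Type}

theorem GeneralPosition.nodup_map_splitKey {l : List (CPoint R)} (h : GeneralPosition l)
    (v : Bool) : (l.map (splitKey v)).Nodup := by
  refine List.pairwise_map.2 (h.imp fun {p q} hpq => ?_)
  cases v
  · exact hpq.2
  · exact hpq.1

variable [LinearOrder R]

/-- One level of a kd-tree. -/
theorem kdPartitionT_succ (v : Bool) (d : ℕ) {l : List (CPoint R)} (hl : GeneralPosition l) :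
    ∃ lo hi : List (CPoint R), (lo ++ hi).Perm l ∧ lo.Sublist l ∧ hi.Sublist l ∧
      lo.length = (l.length + 1) / 2 ∧ (∀ a ∈ lo, ∀ b ∈ hi, splitKey v a < splitKey v b) ∧
      (kdPartitionT v (d + 1) l).val =
        (kdPartitionT (!v) d lo).val ++ (kdPartitionT (!v) d hi).val ∧
      (kdPartitionT v (d + 1) l).time ≤ 503 * l.length + 9 +
        (kdPartitionT (!v) d lo).time + (kdPartitionT (!v) d hi).time +
        (kdPartitionT (!v) d lo).val.length := by
  have hnd := hl.nodup_map_splitKey v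
  have htime := selectT_time_le (splitKey v) l.length ((l.length + 1) / 2) l hnd le_rfl
  by_cases hn : l.length ≤ 1
  · refine ⟨l, [], by simp, by simp, by simp, by omega, by simp, ?_⟩
    -- With at most one point the rank `(n + 1) / 2` is out of range, so selection fails and the
    -- whole list becomes the lower half.
    have hnone : (selectT (splitKey v) l.length ((l.length + 1) / 2) l).val = none := by
      match l, hn with
      | [], _ => rfl
      | [a], _ => simp [selectT, insertionSortT, insertT]
    simp only [kdPartitionT, Timed.val_bind, lengthT_val, hnone, Timed.val_pure, appendT_val,
      Timed.time_bind, Timed.time_tick, lengthT_time, Timed.time_pure, appendT_time]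
    exact ⟨trivial, by omega⟩
  · obtain ⟨p, hp, hpv, hpc⟩ := selectT_val (splitKey v) l.length ((l.length + 1) / 2) l hnd le_rfl
      (by omega)
    refine ⟨l.filter fun a => decide (splitKey v a < splitKey v p),
      l.filter fun a => !decide (splitKey v a < splitKey v p), List.filter_append_perm _ l,
      List.filter_sublist, List.filter_sublist, ?_, ?_, ?_⟩
    · rw [← List.countP_eq_length_filter, hpc]
    · intro a ha b hb
      simp only [List.mem_filter, decide_eq_true_eq, Bool.not_eq_true', decide_eq_false_iff_not,
        not_lt] at ha hb
      exact ha.2.trans_le hb.2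
    · simp only [kdPartitionT, Timed.val_bind, lengthT_val, hpv, splitByT_val, ltT_val,
        appendT_val, Timed.time_bind, Timed.time_tick, lengthT_time, appendT_time,
        splitByT_time _ (fun a => ltT_time _ _)]
      exact ⟨trivial, by omega⟩

theorem kdPartitionT_flatten_perm (v : Bool) (d : ℕ) {l : List (CPoint R)}
    (hl : GeneralPosition l) : (kdPartitionT v d l).val.flatten.Perm l := by
  induction d generalizing v l with
  | zero => simp [kdPartitionT]
  | succ d ih =>
    obtain ⟨lo, hi, hp, hlo, hhi, -, -, hval, -⟩ := kdPartitionT_succ v d hl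
    rw [hval, List.flatten_append]
    exact ((ih _ (hl.sublist hlo)).append (ih _ (hl.sublist hhi))).trans hp

theorem kdPartitionT_length (v : Bool) (d : ℕ) {l : List (CPoint R)}
    (hl : GeneralPosition l) : (kdPartitionT v d l).val.length = 2 ^ d := by
  induction d generalizing v l with
  | zero => simp [kdPartitionT]
  | succ d ih =>
    obtain ⟨lo, hi, hp, hlo, hhi, -, -, hval, -⟩ := kdPartitionT_succ v d hl
    rw [hval, List.length_append, ih _ (hl.sublist hlo), ih _ (hl.sublist hhi)]
    ring

/-- The bound says that a cell has at most `⌈n / 2 ^ d⌉` points, multiplied out so that it passes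
through the rounded halvings without division. -/
theorem kdPartitionT_cell_length_le (v : Bool) (d : ℕ) {l : List (CPoint R)}
    (hl : GeneralPosition l) : ∀ cell ∈ (kdPartitionT v d l).val,
      2 ^ d * cell.length + 1 ≤ l.length + 2 ^ d := by
  induction d generalizing v l with
  | zero => simp [kdPartitionT]
  | succ d ih =>
    obtain ⟨lo, hi, hp, hlo, hhi, hlen, -, hval, -⟩ := kdPartitionT_succ v d hl
    have hlen' := hp.length_eq
    rw [List.length_append] at hlen'
    rw [hval]
    intro cell hcell
    rw [pow_succ]
    rcases List.mem_append.1 hcell with h | h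
    · have := ih _ (hl.sublist hlo) cell h
      have e : 2 ^ d * 2 * cell.length = 2 * (2 ^ d * cell.length) := by ring
      omega
    · have := ih _ (hl.sublist hhi) cell h
      have e : 2 ^ d * 2 * cell.length = 2 * (2 ^ d * cell.length) := by ring
      omega

/-- Each level is linear in the total number of points. The term `4 ^ d` absorbs the constants of
the nodes and the concatenation of the `2 ^ d` cells, and is harmless since `2 ^ d` stays below a
small power of `n`. -/
theorem kdPartitionT_time_le (v : Bool) (d : ℕ) {l : List (CPoint R)}
    (hl : GeneralPosition l) :
    (kdPartitionT v d l).time ≤ 503 * (l.length * d) + 10 * 4 ^ d := by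
  induction d generalizing v l with
  | zero => simp [kdPartitionT]
  | succ d ih =>
    obtain ⟨lo, hi, hp, hlo, hhi, hlen, -, hval, ht⟩ := kdPartitionT_succ v d hl
    have hlen' := hp.length_eq
    rw [List.length_append] at hlen'
    have h₁ := ih (!v) (hl.sublist hlo)
    have h₂ := ih (!v) (hl.sublist hhi)
    rw [kdPartitionT_length _ _ (hl.sublist hlo)] at ht
    have h₃ : 2 ^ d ≤ 4 ^ d := Nat.pow_le_pow_left (by norm_num) d
    have h₄ : 1 ≤ 2 ^ d := Nat.one_le_two_pow
    have e : l.length * (d + 1) = lo.length * d + hi.length * d + l.length := by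
      rw [← hlen']; ring
    rw [e, pow_succ]
    omega

/-- `P` is a half-plane that is bounded from above in the coordinate `splitKey w`. -/
def IsCut (w : Bool) (P : CPoint R → Prop) : Prop :=
  ∀ p q, splitKey w q ≤ splitKey w p → P p → P q

/-- Some points of the cell satisfy `P` and some do not. -/
def Straddles (P : CPoint R → Prop) (cell : List (CPoint R)) : Prop :=
  (∃ p ∈ cell, P p) ∧ ∃ q ∈ cell, ¬ P q

open Classical in
theorem countP_straddles_eq_zero (P : CPoint R → Prop) (v : Bool) (d : ℕ) {l : List (CPoint R)}
    (hl : GeneralPosition l) (h : ¬ Straddles P l) :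
    (kdPartitionT v d l).val.countP (fun cell => decide (Straddles P cell)) = 0 := by
  rw [List.countP_eq_zero]
  intro cell hcell
  rw [decide_eq_true_eq]
  have hsub : ∀ p ∈ cell, p ∈ l := fun p hp =>
    (kdPartitionT_flatten_perm v d hl).mem_iff.1 (List.mem_flatten.2 ⟨cell, hcell, hp⟩)
  rintro ⟨⟨p, hp, hP⟩, q, hq, hQ⟩
  exact h ⟨⟨p, hsub p hp, hP⟩, q, hsub q hq, hQ⟩

open Classical in
/-- A vertical or horizontal line meets few cells of a kd-tree. -/
theorem countP_straddles_le {w : Bool} {P : CPoint R → Prop} (hP : IsCut w P) (v : Bool) (d : ℕ)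
    {l : List (CPoint R)} (hl : GeneralPosition l) :
    (kdPartitionT v d l).val.countP (fun cell => decide (Straddles P cell)) ≤
      2 ^ ((d + if v = w then 0 else 1) / 2) := by
  induction d generalizing v l with
  | zero =>
    refine List.countP_le_length.trans ?_
    rw [kdPartitionT_length v 0 hl]
    exact Nat.one_le_two_pow
  | succ d ih =>
    obtain ⟨lo, hi, hp, hlo, hhi, -, hlt, hval, -⟩ := kdPartitionT_succ v d hl
    have h₁ := ih (!v) (hl.sublist hlo)
    have h₂ := ih (!v) (hl.sublist hhi)
    rw [hval, List.countP_append]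
    -- A split in the direction of the cut separates the halves, so only one of them can straddle
    -- it; a split in the other direction may leave both straddling. The count thus doubles on
    -- alternate levels only.
    by_cases hvw : v = w
    · subst hvw
      have hne : ¬ ((!v) = v) := by cases v <;> simp
      simp only [hne, if_false, if_true] at h₁ h₂ ⊢
      by_cases hs : Straddles P hi
      · have hs' : ¬ Straddles P lo := by
          rintro ⟨-, q, hq, hQ⟩
          obtain ⟨⟨p, hp, hP'⟩, -⟩ := hs
          exact hQ (hP p q (hlt q hq p hp).le hP')
        rw [countP_straddles_eq_zero P _ d (hl.sublist hlo) hs']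
        simpa using h₂
      · rw [countP_straddles_eq_zero P _ d (hl.sublist hhi) hs]
        simpa using h₁
    · have he : (!v) = w := by cases v <;> cases w <;> simp_all
      simp only [he, hvw, if_false, if_true] at h₁ h₂ ⊢
      have : (d + 1 + 1) / 2 = (d + 0) / 2 + 1 := by omega
      rw [this, pow_succ]
      omega

end KdTree

/-! ### Bounding boxes -/

section BoundingBox

variable {R : Type} [LinearOrder R]

@[simp] theorem minT_val (u v : R) : (minT u v).val = min u v := by
  by_cases h : u < v
  · simp [minT, h, h.le]
  · simp [minT, h, not_lt.1 h]

@[simp] theorem maxT_val (u v : R) : (maxT u v).val = max u v := by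
  by_cases h : u < v
  · simp [maxT, h, h.le]
  · simp [maxT, h, not_lt.1 h]

@[simp] theorem minT_time (u v : R) : (minT u v).time = 1 := rfl

@[simp] theorem maxT_time (u v : R) : (maxT u v).time = 1 := rfl

theorem boundingBoxT_time (p : CPoint R) (l : List (CPoint R)) :
    (boundingBoxT p l).time = 5 * l.length + 1 := by
  induction l with
  | nil => rfl
  | cons q l ih => simp [boundingBoxT, ih]; omega

theorem boundingBoxT_contains (p : CPoint R) (l : List (CPoint R)) :
    ∀ q ∈ p :: l, (boundingBoxT p l).val.Contains q := by
  induction l with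
  | nil => simp [boundingBoxT, Box.Contains]
  | cons a l ih =>
    have key : ∀ q, (boundingBoxT p l).val.Contains q →
        (boundingBoxT p (a :: l)).val.Contains q := by
      rintro q ⟨⟨h₁, h₂⟩, h₃, h₄⟩
      simp [boundingBoxT, Box.Contains, h₁, h₂, h₃, h₄]
    intro q hq
    rcases List.mem_cons.1 hq with rfl | hq
    · exact key _ (ih _ (by simp))
    · rcases List.mem_cons.1 hq with rfl | hq
      · simp [boundingBoxT, Box.Contains]
      · exact key _ (ih _ (by simp [hq]))

/-- The sides of the bounding box are coordinates of points. -/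
theorem boundingBoxT_sides (p : CPoint R) (l : List (CPoint R)) :
    (∃ q ∈ p :: l, (boundingBoxT p l).val.xmin = q.x) ∧
    (∃ q ∈ p :: l, (boundingBoxT p l).val.xmax = q.x) ∧
    (∃ q ∈ p :: l, (boundingBoxT p l).val.ymin = q.y) ∧
    (∃ q ∈ p :: l, (boundingBoxT p l).val.ymax = q.y) := by
  induction l with
  | nil => simp [boundingBoxT]
  | cons a l ih =>
    obtain ⟨⟨q₁, m₁, h₁⟩, ⟨q₂, m₂, h₂⟩, ⟨q₃, m₃, h₃⟩, ⟨q₄, m₄, h₄⟩⟩ := ih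
    have hsub : ∀ q ∈ p :: l, q ∈ p :: a :: l := by
      intro q hq
      rcases List.mem_cons.1 hq with rfl | hq <;> simp [*]
    simp only [boundingBoxT, Timed.val_bind, minT_val, maxT_val, Timed.val_pure]
    refine ⟨?_, ?_, ?_, ?_⟩
    · rcases min_choice a.x (boundingBoxT p l).val.xmin with h | h
      · exact ⟨a, by simp, h⟩
      · exact ⟨q₁, hsub _ m₁, h.trans h₁⟩
    · rcases max_choice a.x (boundingBoxT p l).val.xmax with h | h
      · exact ⟨a, by simp, h⟩
      · exact ⟨q₂, hsub _ m₂, h.trans h₂⟩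
    · rcases min_choice a.y (boundingBoxT p l).val.ymin with h | h
      · exact ⟨a, by simp, h⟩
      · exact ⟨q₃, hsub _ m₃, h.trans h₃⟩
    · rcases max_choice a.y (boundingBoxT p l).val.ymax with h | h
      · exact ⟨a, by simp, h⟩
      · exact ⟨q₄, hsub _ m₄, h.trans h₄⟩

end BoundingBox

/-! ### Distributing points among sorted positions -/

section Buckets

variable {R : Type} [LinearOrder R]

/-- One level of the recursion of `bucketT`. -/
theorem bucketT_succ (key : CPoint R → R) (fuel : ℕ) {ts : List R} (hts : ts ≠ [])
    (l : List (CPoint R)) :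
    ∃ (ts₁ ts₂ : List R) (t : R), ts = ts₁ ++ t :: ts₂ ∧ ts₁.length = ts.length / 2 ∧
      (bucketT key (fuel + 1) ts l).val =
        (bucketT key fuel ts₁ (l.filter fun p => decide (key p < t))).val ++
        (l.filter fun p => decide (key p = t)) ::
        (bucketT key fuel ts₂ (l.filter fun p => decide (t < key p))).val ∧
      (bucketT key (fuel + 1) ts l).time ≤ 4 * l.length + 2 * ts.length + 6 +
        (bucketT key fuel ts₁ (l.filter fun p => decide (key p < t))).val.length +
        (bucketT key fuel ts₁ (l.filter fun p => decide (key p < t))).time +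
        (bucketT key fuel ts₂ (l.filter fun p => decide (t < key p))).time := by
  have hpos : 0 < ts.length := List.length_pos_iff.2 hts
  have hsplit := List.take_append_drop (ts.length / 2) ts
  rcases hd : ts.drop (ts.length / 2) with _ | ⟨t, ts₃⟩
  · have := congrArg List.length hd
    simp at this
    omega
  · rw [hd] at hsplit
    have hge : (l.filter fun p => !decide (key p < t)).filter (fun p => decide (t < key p)) =
        l.filter fun p => decide (t < key p) := by
      rw [List.filter_filter]
      refine List.filter_congr fun a _ => ?_
      by_cases h : t < key a
      · simp [h, h.le]
      · simp [h]
    have heq : (l.filter fun p => !decide (key p < t)).filter (fun p => !decide (t < key p)) =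
        l.filter fun p => decide (key p = t) := by
      rw [List.filter_filter]
      refine List.filter_congr fun a _ => ?_
      rcases lt_trichotomy (key a) t with h | h | h
      · simp [h, h.ne]
      · simp [h]
      · simp [h, h.ne']
    have h₁ := splitAtT_time_le (ts.length / 2) ts
    have h₂ := List.length_filter_le (fun p => !decide (key p < t)) l
    refine ⟨_, _, t, hsplit.symm, by simp; omega, ?_, ?_⟩
    · simp only [bucketT, Timed.val_bind, lengthT_val, splitAtT_val, hd, splitByT_val, ltT_val,
        appendT_val, hge, heq]
    · simp only [bucketT, lengthT_val, splitAtT_val, hd, splitByT_val, ltT_val,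
        hge, heq, Timed.time_bind, Timed.time_tick, lengthT_time, appendT_time,
        splitByT_time _ (fun a => ltT_time _ _)]
      omega

theorem bucketT_nil (key : CPoint R → R) (fuel : ℕ) (l : List (CPoint R)) :
    (bucketT key fuel [] l).val = [l] ∧ (bucketT key fuel [] l).time ≤ 3 := by
  cases fuel <;> simp [bucketT, splitAtT]

theorem filter_trichotomy_perm (key : CPoint R → R) (t : R) (l : List (CPoint R)) :
    ((l.filter fun p => decide (key p < t)) ++ ((l.filter fun p => decide (key p = t)) ++
      l.filter fun p => decide (t < key p))).Perm l := by
  have h₁ := List.filter_append_perm (fun p => decide (key p < t)) l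
  have h₂ := List.filter_append_perm (fun p => decide (key p = t))
    (l.filter fun p => !decide (key p < t))
  refine (List.Perm.append_left _ ?_).trans h₁
  refine List.Perm.trans (List.Perm.of_eq ?_) h₂
  rw [List.filter_filter, List.filter_filter]
  congr 1 <;> refine List.filter_congr fun a _ => ?_
  · rcases lt_trichotomy (key a) t with h | h | h
    · simp [h.ne]
    · simp [h]
    · simp [h.ne']
  · rcases lt_trichotomy (key a) t with h | h | h
    · simp [h, h.le]
    · simp [h]
    · simp [h, h.le, h.ne']

theorem bucketT_flatten_perm (key : CPoint R → R) (fuel : ℕ) (ts : List R)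
    (l : List (CPoint R)) : (bucketT key fuel ts l).val.flatten.Perm l := by
  induction fuel generalizing ts l with
  | zero => simp [bucketT]
  | succ fuel ih =>
    by_cases hts : ts = []
    · subst hts
      simp [bucketT_nil]
    · obtain ⟨ts₁, ts₂, t, -, -, hval, -⟩ := bucketT_succ key fuel hts l
      rw [hval, List.flatten_append, List.flatten_cons]
      exact ((ih _ _).append ((ih _ _).append_left _)).trans (filter_trichotomy_perm key t l)

theorem bucketT_length_le (key : CPoint R → R) (fuel : ℕ) (ts : List R)
    (l : List (CPoint R)) : (bucketT key fuel ts l).val.length ≤ 2 * ts.length + 1 := by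
  induction fuel generalizing ts l with
  | zero => simp [bucketT]
  | succ fuel ih =>
    by_cases hts : ts = []
    · subst hts
      simp [bucketT_nil]
    · obtain ⟨ts₁, ts₂, t, hsplit, -, hval, -⟩ := bucketT_succ key fuel hts l
      have h₁ := ih ts₁ (l.filter fun p => decide (key p < t))
      have h₂ := ih ts₂ (l.filter fun p => decide (t < key p))
      have h₃ := congrArg List.length hsplit
      rw [List.length_append, List.length_cons] at h₃
      rw [hval, List.length_append, List.length_cons]
      omega

/-- `u` and `v` compare in the same way with `t`. -/
def SameSide (t u v : R) : Prop := (u < t ↔ v < t) ∧ (t < u ↔ t < v)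

/-- Sortedness makes the positions on the far side of the current one irrelevant to a class, by
transitivity. The fuel condition excludes that the recursion stops early and leaves a class unsplit.
-/
theorem bucketT_sameSide (key : CPoint R → R) (fuel : ℕ) (ts : List R) (l : List (CPoint R))
    (hs : ts.Pairwise (· ≤ ·)) (hf : ts.length ≤ fuel) :
    ∀ cell ∈ (bucketT key fuel ts l).val, ∀ p ∈ cell, ∀ q ∈ cell, ∀ t ∈ ts,
      SameSide t (key p) (key q) := by
  induction fuel generalizing ts l with
  | zero =>
    obtain rfl : ts = [] := List.length_eq_zero_iff.1 (Nat.le_zero.1 hf)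
    simp
  | succ fuel ih =>
    by_cases hts : ts = []
    · simp [hts]
    · obtain ⟨ts₁, ts₂, t, hsplit, hlen, hval, -⟩ := bucketT_succ key fuel hts l
      have hlen' := congrArg List.length hsplit
      rw [List.length_append, List.length_cons] at hlen'
      rw [hsplit, List.pairwise_append, List.pairwise_cons] at hs
      obtain ⟨hs₁, ⟨hs₂, hs₃⟩, hs₄⟩ := hs
      have ih₁ := ih ts₁ (l.filter fun p => decide (key p < t)) hs₁ (by omega)
      have ih₂ := ih ts₂ (l.filter fun p => decide (t < key p)) hs₃ (by omega)
      have sub₁ : ∀ cell ∈ (bucketT key fuel ts₁ (l.filter fun p => decide (key p < t))).val,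
          ∀ p ∈ cell, key p < t := by
        intro cell hcell p hp
        have := (bucketT_flatten_perm key fuel ts₁ _).mem_iff.1
          (List.mem_flatten.2 ⟨cell, hcell, hp⟩)
        simpa using (List.mem_filter.1 this).2
      have sub₂ : ∀ cell ∈ (bucketT key fuel ts₂ (l.filter fun p => decide (t < key p))).val,
          ∀ p ∈ cell, t < key p := by
        intro cell hcell p hp
        have := (bucketT_flatten_perm key fuel ts₂ _).mem_iff.1
          (List.mem_flatten.2 ⟨cell, hcell, hp⟩)
        simpa using (List.mem_filter.1 this).2
      have below : ∀ s u v : R, u < s → v < s → SameSide s u v := fun s u v hu hv =>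
        ⟨by simp [hu, hv], by simp [not_lt.2 hu.le, not_lt.2 hv.le]⟩
      have above : ∀ s u v : R, s < u → s < v → SameSide s u v := fun s u v hu hv =>
        ⟨by simp [not_lt.2 hu.le, not_lt.2 hv.le], by simp [hu, hv]⟩
      rw [hval]
      intro cell hcell p hp q hq s hs
      rw [hsplit] at hs
      rcases List.mem_append.1 hcell with hcell | hcell
      · have hp' := sub₁ cell hcell p hp
        have hq' := sub₁ cell hcell q hq
        rcases List.mem_append.1 hs with hs | hs
        · exact ih₁ cell hcell p hp q hq s hs
        · rcases List.mem_cons.1 hs with rfl | hs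
          · exact below _ _ _ hp' hq'
          · exact below _ _ _ (hp'.trans_le (hs₂ s hs)) (hq'.trans_le (hs₂ s hs))
      · rcases List.mem_cons.1 hcell with rfl | hcell
        · simp only [List.mem_filter, decide_eq_true_eq] at hp hq
          rw [hp.2, hq.2]
          exact ⟨Iff.rfl, Iff.rfl⟩
        · have hp' := sub₂ cell hcell p hp
          have hq' := sub₂ cell hcell q hq
          rcases List.mem_append.1 hs with hs | hs
          · have := hs₄ s hs t (by simp)
            exact above _ _ _ (this.trans_lt hp') (this.trans_lt hq')
          · rcases List.mem_cons.1 hs with rfl | hs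
            · exact above _ _ _ hp' hq'
            · exact ih₂ cell hcell p hp q hq s hs

/-- Each point descends through a binary search over the `t + 1` gaps, at a constant cost per level.
The work on the lists of positions and classes is only bounded quadratically, which is affordable as
there are few positions. -/
theorem bucketT_time_le (key : CPoint R → R) (fuel : ℕ) (ts : List R) (l : List (CPoint R)) :
    (bucketT key fuel ts l).time ≤
      4 * (l.length * Nat.clog 2 (ts.length + 1)) + 7 * (ts.length + 1) ^ 2 := by
  induction fuel generalizing ts l with
  | zero =>
    have : 1 ≤ (ts.length + 1) ^ 2 := Nat.one_le_pow _ _ (by omega)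
    simp only [bucketT, Timed.time_bind, Timed.time_tick, Timed.time_pure]
    omega
  | succ fuel ih =>
    by_cases hts : ts = []
    · subst hts
      have := (bucketT_nil key (fuel + 1) l).2
      simp
      omega
    · obtain ⟨ts₁, ts₂, t, hsplit, hlen, -, htime⟩ := bucketT_succ key fuel hts l
      have hlen' := congrArg List.length hsplit
      rw [List.length_append, List.length_cons] at hlen'
      have hpos : 0 < ts.length := List.length_pos_iff.2 hts
      have h₁ := ih ts₁ (l.filter fun p => decide (key p < t))
      have h₂ := ih ts₂ (l.filter fun p => decide (t < key p))
      have h₃ := bucketT_length_le key fuel ts₁ (l.filter fun p => decide (key p < t))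
      have h₄ := (filter_trichotomy_perm key t l).length_eq
      rw [List.length_append, List.length_append] at h₄
      have hc : Nat.clog 2 (ts.length + 1) = Nat.clog 2 (ts.length / 2 + 1) + 1 := by
        rw [Nat.clog_of_two_le (by norm_num) (by omega)]
        congr 2
        omega
      have hc₂ : Nat.clog 2 (ts₂.length + 1) ≤ Nat.clog 2 (ts.length / 2 + 1) :=
        Nat.clog_mono_right 2 (by omega)
      rw [hlen] at h₁
      set D := Nat.clog 2 (ts.length / 2 + 1)
      set a := (l.filter fun p => decide (key p < t)).length
      set b := (l.filter fun p => decide (t < key p)).length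
      have e₁ : b * Nat.clog 2 (ts₂.length + 1) ≤ b * D := Nat.mul_le_mul_left _ hc₂
      have e₂ : a * D + b * D + l.length ≤ l.length * (D + 1) := by nlinarith
      have e₃ : ts.length + 1 = (ts.length / 2 + 1) + (ts₂.length + 1) := by omega
      have e₄ : (ts.length + 1) ≤ 2 * ((ts.length / 2 + 1) * (ts₂.length + 1)) := by nlinarith
      -- The mixed term of the square, at least `ts.length + 1` by `e₄`, pays for the overhead of
      -- this node.
      have e₅ : (ts.length + 1) ^ 2 = (ts.length / 2 + 1) ^ 2 + (ts₂.length + 1) ^ 2 +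
          2 * ((ts.length / 2 + 1) * (ts₂.length + 1)) := by
        conv_lhs => rw [e₃]
        ring
      rw [hc, e₅]
      omega

end Buckets

/-! ### Batches of range-emptiness queries -/

section Batches

variable {R : Type}

theorem mem_xPositions {q : Range R} {t : R} :
    t ∈ xPositions q ↔ (∃ s ∈ q.left, s.pos = t) ∨ ∃ s ∈ q.right, s.pos = t := by
  unfold xPositions
  cases q.left <;> cases q.right <;> simp [eq_comm]

theorem mem_yPositions {q : Range R} {t : R} :
    t ∈ yPositions q ↔ (∃ s ∈ q.bottom, s.pos = t) ∨ ∃ s ∈ q.top, s.pos = t := by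
  unfold yPositions
  cases q.bottom <;> cases q.top <;> simp [eq_comm]

theorem length_xPositions_le (q : Range R) : (xPositions q).length ≤ 2 := by
  unfold xPositions
  cases q.left <;> cases q.right <;> simp

theorem length_yPositions_le (q : Range R) : (yPositions q).length ≤ 2 := by
  unfold yPositions
  cases q.bottom <;> cases q.top <;> simp

theorem mem_of_mem_representativesT {l : List (CPoint R)} {p : CPoint R}
    (h : p ∈ (representativesT l).val) : p ∈ l := by
  simp only [representativesT, Timed.val_bind, findT_val, Timed.val_pure, List.mem_append,
    Option.mem_toList] at h
  exact h.elim (fun h => List.mem_of_find?_eq_some h) fun h => List.mem_of_find?_eq_some h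

theorem exists_mem_representativesT {l : List (CPoint R)} {p : CPoint R} (hp : p ∈ l) :
    ∃ p' ∈ (representativesT l).val, p'.color = p.color := by
  have key : ∀ c, p.color = c → ∃ p', l.find? (fun a => decide (a.color = c)) = some p' ∧
      p'.color = c := by
    intro c hc
    obtain ⟨p', hp'⟩ := Option.isSome_iff_exists.1
      (List.find?_isSome.2 ⟨p, hp, by simpa using hc⟩ :
        (l.find? fun a => decide (a.color = c)).isSome)
    exact ⟨p', hp', by simpa using List.find?_some hp'⟩
  simp only [representativesT, Timed.val_bind, findT_val, Timed.val_pure, List.mem_append,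
    Option.mem_toList, hasColorT]
  cases hc : p.color with
  | red =>
    obtain ⟨p', h₁, h₂⟩ := key _ hc
    exact ⟨p', Or.inl h₁, h₂⟩
  | blue =>
    obtain ⟨p', h₁, h₂⟩ := key _ hc
    exact ⟨p', Or.inr h₁, h₂⟩

theorem length_representativesT_le (l : List (CPoint R)) :
    (representativesT l).val.length ≤ 2 := by
  simp only [representativesT, Timed.val_bind, findT_val, Timed.val_pure, List.length_append]
  have : ∀ o : Option (CPoint R), o.toList.length ≤ 1 := by intro o; cases o <;> simp
  have h₁ := this (l.find? fun a => (hasColorT Color.red a).val)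
  have h₂ := this (l.find? fun a => (hasColorT Color.blue a).val)
  omega

theorem representativesT_time_le (l : List (CPoint R)) :
    (representativesT l).time ≤ 4 * l.length + 3 := by
  have h₁ := findT_time_le (hasColorT (R := R) Color.red) 1 (fun a => le_rfl) l
  have h₂ := findT_time_le (hasColorT (R := R) Color.blue) 1 (fun a => le_rfl) l
  simp only [representativesT, Timed.time_bind, Timed.time_tick, Timed.time_pure]
  omega

variable [LinearOrder R]

theorem aboveSide_congr {s : Option (Side R)} {u v : R}
    (h : ∀ t ∈ s, SameSide t.pos u v) : aboveSide s u = aboveSide s v := by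
  cases s with
  | none => rfl
  | some s =>
    obtain ⟨h₁, h₂⟩ := h s rfl
    have h₃ : s.pos ≤ u ↔ s.pos ≤ v := by rw [← not_lt, ← not_lt, h₁]
    simp only [aboveSide, h₂, h₃]

theorem belowSide_congr {s : Option (Side R)} {u v : R}
    (h : ∀ t ∈ s, SameSide t.pos u v) : belowSide s u = belowSide s v := by
  cases s with
  | none => rfl
  | some s =>
    obtain ⟨h₁, h₂⟩ := h s rfl
    have h₃ : u ≤ s.pos ↔ v ≤ s.pos := by rw [← not_lt, ← not_lt, h₂]
    simp only [belowSide, h₁, h₃]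

/-- Membership depends only on the colour and on comparisons with the sides, so one point per colour
and grid cell can represent all others. -/
theorem Range.contains_congr {q : Range R} {p p' : CPoint R} (hc : p.color = p'.color)
    (hx : ∀ t ∈ xPositions q, SameSide t p.x p'.x) (hy : ∀ t ∈ yPositions q, SameSide t p.y p'.y) :
    q.contains p = q.contains p' := by
  unfold Range.contains
  rw [aboveSide_congr (v := p'.x) fun t ht => hx _ (mem_xPositions.2 (Or.inl ⟨t, ht, rfl⟩)),
    belowSide_congr (v := p'.x) fun t ht => hx _ (mem_xPositions.2 (Or.inr ⟨t, ht, rfl⟩)),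
    aboveSide_congr (v := p'.y) fun t ht => hy _ (mem_yPositions.2 (Or.inl ⟨t, ht, rfl⟩)),
    belowSide_congr (v := p'.y) fun t ht => hy _ (mem_yPositions.2 (Or.inr ⟨t, ht, rfl⟩)), hc]

theorem isEmptyOnT_val (q : Range R) (Q : List (CPoint R)) :
    (isEmptyOnT q Q).val = q.isEmptyOn Q := by
  simp only [isEmptyOnT, Timed.val_bind, findT_val, Timed.val_pure, Range.isEmptyOn]
  rw [Bool.eq_iff_iff]
  simp [containsT]

theorem isEmptyOnT_time_le (q : Range R) (Q : List (CPoint R)) :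
    (isEmptyOnT q Q).time ≤ 6 * Q.length + 2 := by
  have := findT_time_le (containsT q) 5 (fun a => le_rfl) Q
  simp only [isEmptyOnT, Timed.time_bind, Timed.time_tick, Timed.time_pure]
  omega

theorem emptinessBatchT_val (Q : List (CPoint R)) (qs : List (Range R)) :
    (emptinessBatchT Q qs).val = qs.map fun q => q.isEmptyOn Q := by
  simp only [emptinessBatchT, Timed.val_bind, flatMapT_val, lengthT_val, mapT_val, isEmptyOnT_val]
  refine List.map_congr_left fun q hq => ?_
  set X := (insertionSortT id (qs.flatMap fun a => (xPositionsT a).val)).val with hX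
  set Y := (insertionSortT id (qs.flatMap fun a => (yPositionsT a).val)).val with hY
  have hXs : X.Pairwise (· ≤ ·) := insertionSortT_sorted id _
  have hYs : Y.Pairwise (· ≤ ·) := insertionSortT_sorted id _
  have hXm : ∀ t ∈ xPositions q, t ∈ X := fun t ht =>
    (insertionSortT_perm id _).mem_iff.2 (List.mem_flatMap.2 ⟨q, hq, ht⟩)
  have hYm : ∀ t ∈ yPositions q, t ∈ Y := fun t ht =>
    (insertionSortT_perm id _).mem_iff.2 (List.mem_flatMap.2 ⟨q, hq, ht⟩)
  have memX : ∀ slab ∈ (bucketT CPoint.x X.length X Q).val, ∀ p ∈ slab, p ∈ Q :=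
    fun slab hslab p hp => (bucketT_flatten_perm _ _ _ _).mem_iff.1
      (List.mem_flatten.2 ⟨slab, hslab, hp⟩)
  rw [Bool.eq_iff_iff, Range.isEmptyOn, Range.isEmptyOn, List.all_eq_true, List.all_eq_true]
  constructor
  -- A point of `Q` found by the query would have a representative of its colour in its grid cell,
  -- which the query finds as well; conversely, representatives are points of `Q`.
  · intro h p hp
    obtain ⟨slab, hslab, hps⟩ := List.mem_flatten.1
      ((bucketT_flatten_perm CPoint.x X.length X Q).mem_iff.2 hp)
    obtain ⟨cell, hcell, hpc⟩ := List.mem_flatten.1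
      ((bucketT_flatten_perm CPoint.y Y.length Y slab).mem_iff.2 hps)
    obtain ⟨p', hp', hcol⟩ := exists_mem_representativesT hpc
    have hp'c := mem_of_mem_representativesT hp'
    have hp's : p' ∈ slab := (bucketT_flatten_perm CPoint.y Y.length Y slab).mem_iff.1
      (List.mem_flatten.2 ⟨cell, hcell, hp'c⟩)
    rw [Range.contains_congr (p' := p') hcol.symm
      (fun t ht => bucketT_sameSide CPoint.x X.length X Q hXs le_rfl slab hslab p hps p' hp's t
        (hXm t ht))
      (fun t ht => bucketT_sameSide CPoint.y Y.length Y slab hYs le_rfl cell hcell p hpc p' hp'c t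
        (hYm t ht))]
    exact h p' (List.mem_flatMap.2 ⟨cell, List.mem_flatMap.2 ⟨slab, hslab, hcell⟩, hp'⟩)
  · intro h p hp
    obtain ⟨cell, hcell, hp⟩ := List.mem_flatMap.1 hp
    obtain ⟨slab, hslab, hcell⟩ := List.mem_flatMap.1 hcell
    refine h p (memX slab hslab p ?_)
    exact (bucketT_flatten_perm CPoint.y Y.length Y slab).mem_iff.1
      (List.mem_flatten.2 ⟨cell, hcell, mem_of_mem_representativesT hp⟩)

theorem sum_map_le_of_le {α : Type} (l : List α) (f g : α → ℕ) (h : ∀ a ∈ l, f a ≤ g a) :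
    (l.map f).sum ≤ (l.map g).sum := List.sum_le_sum h

theorem sum_map_add_const {α : Type} (l : List α) (f : α → ℕ) (a b : ℕ) :
    (l.map fun x => a * f x + b).sum = a * (l.map f).sum + b * l.length := by
  induction l with
  | nil => simp
  | cons x l ih => simp [ih]; ring

theorem length_flatMap_le {α β : Type} (l : List α) (f : α → List β) (b : ℕ)
    (h : ∀ a ∈ l, (f a).length ≤ b) : (l.flatMap f).length ≤ b * l.length := by
  rw [List.length_flatMap]
  have := sum_map_le_of_le l (fun a => (f a).length) (fun a => 0 * 0 + b) (by simpa using h)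
  rwa [sum_map_add_const l (fun _ => 0) 0 b, zero_mul, zero_add] at this

theorem sum_map_length_flatMap {α β : Type} (l : List α) (f : α → List (List β)) (g : α → ℕ)
    (h : ∀ a ∈ l, ((f a).map List.length).sum = g a) :
    ((l.flatMap f).map List.length).sum = (l.map g).sum := by
  induction l with
  | nil => simp
  | cons a l ih =>
    rw [List.flatMap_cons, List.map_append, List.sum_append, h a (by simp),
      ih fun b hb => h b (by simp [hb]), List.map_cons, List.sum_cons]

/-- Locating a point takes two bucketings, one for each coordinate, hence `8 * clog`. The grid has
`O(r ^ 2)` cells with at most two representatives each, and each of the `r` queries scans them all,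
hence `r ^ 3`. -/
theorem emptinessBatchT_time_le (Q : List (CPoint R)) (qs : List (Range R)) (r : ℕ)
    (hr : qs.length ≤ r) :
    (emptinessBatchT Q qs).time ≤
      Q.length * (8 * Nat.clog 2 (2 * r + 1) + 4) + 1000 * (r + 1) ^ 3 := by
  have hxs : (qs.flatMap fun a => (xPositionsT a).val).length ≤ 2 * r :=
    (length_flatMap_le qs _ 2 fun q _ => length_xPositions_le q).trans (by omega)
  have hys : (qs.flatMap fun a => (yPositionsT a).val).length ≤ 2 * r :=
    (length_flatMap_le qs _ 2 fun q _ => length_yPositions_le q).trans (by omega)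
  have hxt := flatMapT_time xPositionsT qs
  have hyt := flatMapT_time yPositionsT qs
  have hone : ∀ f : Range R → Timed (List R), (∀ q, (f q).time = 1) →
      (qs.map fun a => (f a).time).sum = qs.length := by
    intro f hf
    simp [hf]
  rw [hone _ fun _ => rfl] at hxt hyt
  have hxi := insertionSortT_time_le id (qs.flatMap fun a => (xPositionsT a).val)
  have hyi := insertionSortT_time_le id (qs.flatMap fun a => (yPositionsT a).val)
  have hXl := (insertionSortT_perm id (qs.flatMap fun a => (xPositionsT a).val)).length_eq
  have hYl := (insertionSortT_perm id (qs.flatMap fun a => (yPositionsT a).val)).length_eq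
  simp only [emptinessBatchT, Timed.time_bind, Timed.time_tick, flatMapT_val, lengthT_val,
    lengthT_time]
  set X := (insertionSortT id (qs.flatMap fun a => (xPositionsT a).val)).val with hX
  set Y := (insertionSortT id (qs.flatMap fun a => (yPositionsT a).val)).val with hY
  rw [← hXl] at hxs hxi hxt
  rw [← hYl] at hys hyi hyt
  set D := Nat.clog 2 (2 * r + 1) with hD
  have hbucket : ∀ (key : CPoint R → R) (ts : List R) (l : List (CPoint R)), ts.length ≤ 2 * r →
      (bucketT key ts.length ts l).time ≤ 4 * D * l.length + 28 * (r + 1) ^ 2 := by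
    intro key ts l h
    refine (bucketT_time_le key ts.length ts l).trans ?_
    have h₁ : Nat.clog 2 (ts.length + 1) ≤ D := Nat.clog_mono_right 2 (by omega)
    have h₂ : l.length * Nat.clog 2 (ts.length + 1) ≤ l.length * D := Nat.mul_le_mul_left _ h₁
    have h₃ : (ts.length + 1) ^ 2 ≤ (2 * (r + 1)) ^ 2 := Nat.pow_le_pow_left (by omega) 2
    nlinarith
  have hslab := hbucket CPoint.x X Q hxs
  have hnslab := bucketT_length_le CPoint.x X.length X Q
  have hsumslab : ((bucketT CPoint.x X.length X Q).val.map List.length).sum = Q.length := by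
    rw [← List.length_flatten, (bucketT_flatten_perm _ _ _ _).length_eq]
  set slabs := (bucketT CPoint.x X.length X Q).val
  have hcellt := flatMapT_time (bucketT CPoint.y Y.length Y) slabs
  have hcells := sum_map_le_of_le slabs _ _ fun slab _ => hbucket CPoint.y Y slab hys
  rw [sum_map_add_const slabs List.length, hsumslab] at hcells
  have hncell : (slabs.flatMap fun a => (bucketT CPoint.y Y.length Y a).val).length ≤
      (4 * r + 1) * slabs.length :=
    length_flatMap_le slabs _ _ fun a _ => (bucketT_length_le _ _ _ _).trans (by omega)
  have hsumcell : ((slabs.flatMap fun a => (bucketT CPoint.y Y.length Y a).val).map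
      List.length).sum = Q.length := by
    rw [sum_map_length_flatMap slabs _ List.length, hsumslab]
    intro slab _
    rw [← List.length_flatten, (bucketT_flatten_perm _ _ _ _).length_eq]
  set cells := slabs.flatMap fun a => (bucketT CPoint.y Y.length Y a).val
  have hrept := flatMapT_time representativesT cells
  have hreps := sum_map_le_of_le cells _ _ fun cell _ => representativesT_time_le cell
  rw [sum_map_add_const cells List.length, hsumcell] at hreps
  have hnrep : (cells.flatMap fun a => (representativesT a).val).length ≤ 2 * cells.length :=
    length_flatMap_le cells _ _ fun a _ => length_representativesT_le a
  set reps := cells.flatMap fun a => (representativesT a).val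
  have hmap := mapT_time (fun q => isEmptyOnT q reps) qs
  have hmaps := sum_map_le_of_le qs (fun q => (isEmptyOnT q reps).time)
    (fun _ => 0 * 0 + (6 * reps.length + 2)) fun q _ => by simpa using isEmptyOnT_time_le q reps
  rw [sum_map_add_const qs (fun _ => 0)] at hmaps
  have b₁ : slabs.length ≤ 4 * (r + 1) := by omega
  have b₂ : cells.length ≤ 16 * (r + 1) ^ 2 := by
    calc cells.length ≤ (4 * r + 1) * slabs.length := hncell
      _ ≤ (4 * (r + 1)) * (4 * (r + 1)) := Nat.mul_le_mul (by omega) b₁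
      _ = 16 * (r + 1) ^ 2 := by ring
  have b₃ : (6 * reps.length + 2) * qs.length ≤ 194 * (r + 1) ^ 3 := by
    calc (6 * reps.length + 2) * qs.length ≤ (194 * (r + 1) ^ 2) * (r + 1) :=
          Nat.mul_le_mul (by
            have : 1 ≤ (r + 1) ^ 2 := Nat.one_le_pow _ _ (by omega)
            omega) (by omega)
      _ = 194 * (r + 1) ^ 3 := by ring
  have b₄ : 28 * (r + 1) ^ 2 * slabs.length ≤ 112 * (r + 1) ^ 3 := by
    calc 28 * (r + 1) ^ 2 * slabs.length ≤ 28 * (r + 1) ^ 2 * (4 * (r + 1)) :=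
          Nat.mul_le_mul_left _ b₁
      _ = 112 * (r + 1) ^ 3 := by ring
  have b₅ : (r + 1) ^ 2 ≤ (r + 1) ^ 3 := Nat.pow_le_pow_right (by omega) (by norm_num)
  have b₆ : r + 1 ≤ (r + 1) ^ 2 := Nat.le_self_pow (by norm_num) _
  have b₇ : (X.length + 1) ^ 2 ≤ 4 * (r + 1) ^ 2 :=
    (Nat.pow_le_pow_left (by omega) 2 : _ ≤ (2 * (r + 1)) ^ 2).trans (by ring_nf; rfl)
  have b₈ : (Y.length + 1) ^ 2 ≤ 4 * (r + 1) ^ 2 :=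
    (Nat.pow_le_pow_left (by omega) 2 : _ ≤ (2 * (r + 1)) ^ 2).trans (by ring_nf; rfl)
  have b₉ : Q.length * (8 * D + 4) = 4 * D * Q.length + 4 * D * Q.length + 4 * Q.length := by ring
  omega

end Batches

/-! ### Running the safety tests in lockstep -/

namespace SafetyTest

variable {R : Type}

/-- Hand over the answer to a test that waits for one. -/
def resume (ans : Range R → Bool) : SafetyTest R → SafetyTest R
  | query q next => next (ans q)
  | t => t

theorem advanceT_spec (ans : Range R → Bool) (t : SafetyTest R) :
    (advanceT t).val.value ans = t.value ans ∧ (advanceT t).val.queries ans = t.queries ans ∧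
    (advanceT t).time + (advanceT t).val.steps ans = t.steps ans + 1 ∧
    ∀ t', (advanceT t).val ≠ step t' := by
  induction t with
  | result b => simp [advanceT, steps]
  | step next ih =>
    obtain ⟨h₁, h₂, h₃, h₄⟩ := ih
    simp only [advanceT, Timed.val_bind, Timed.time_bind, Timed.time_tick, value, queries, steps]
    exact ⟨h₁, h₂, by omega, h₄⟩
  | query q next ih => simp [advanceT]; omega

/-- The steps still to be made act as a potential: a round spends exactly what it takes off, plus
one. Truncated subtraction covers finished tests, which make no query and keep the count 0. -/
theorem resume_advanceT (ans : Range R → Bool) (t : SafetyTest R) :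
    (resume ans (advanceT t).val).value ans = t.value ans ∧
    (resume ans (advanceT t).val).queries ans = t.queries ans - 1 ∧
    (advanceT t).time + (resume ans (advanceT t).val).steps ans = t.steps ans + 1 := by
  obtain ⟨h₁, h₂, h₃, h₄⟩ := advanceT_spec ans t
  cases h : (advanceT t).val with
  | result b =>
    rw [h] at h₁ h₂ h₃
    simp only [resume]
    exact ⟨h₁, by rw [← h₂]; rfl, h₃⟩
  | step t' => exact absurd h (h₄ t')
  | query q next =>
    rw [h] at h₁ h₂ h₃
    simp only [resume]
    exact ⟨h₁, by rw [← h₂]; rfl, h₃⟩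

theorem verdictT_advanceT (ans : Range R → Bool) (t : SafetyTest R) (h : t.queries ans = 0) :
    (verdictT (advanceT t).val).val = t.value ans := by
  obtain ⟨h₁, h₂, -, h₄⟩ := advanceT_spec ans t
  cases h' : (advanceT t).val with
  | result b => rw [← h₁, h']; rfl
  | step t' => exact absurd h' (h₄ t')
  | query q next =>
    rw [h', h] at h₂
    simp [queries] at h₂

theorem verdictT_time (t : SafetyTest R) : (verdictT t).time = 1 := by
  cases t <;> rfl

theorem pendingT_length_le (ts : List (SafetyTest R)) :
    (pendingT ts).val.length ≤ ts.length := by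
  induction ts with
  | nil => simp [pendingT]
  | cons t ts ih => cases t <;> simp [pendingT] <;> omega

theorem pendingT_time (ts : List (SafetyTest R)) : (pendingT ts).time = ts.length + 1 := by
  induction ts with
  | nil => simp [pendingT]
  | cons t ts ih => cases t <;> simp [pendingT, ih] <;> omega

/-- Collecting queries and handing out answers traverse the tests in the same order and skip the
same finished ones, so each answer reaches its query. -/
theorem resumeT_pendingT (ans : Range R → Bool) (ts : List (SafetyTest R)) :
    (resumeT ts ((pendingT ts).val.map ans)).val = ts.map (resume ans) := by
  induction ts with
  | nil => simp [resumeT]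
  | cons t ts ih => cases t <;> simp [pendingT, resumeT, resume, ih]

theorem resumeT_time (ts : List (SafetyTest R)) (bs : List Bool) :
    (resumeT ts bs).time = ts.length + 1 := by
  induction ts generalizing bs with
  | nil => simp [resumeT]
  | cons t ts ih => cases t <;> cases bs <;> simp [resumeT, ih] <;> omega

variable [LinearOrder R]

theorem runAllT_val (Q : List (CPoint R)) (k : ℕ) (ts : List (SafetyTest R))
    (h : ∀ t ∈ ts, t.queries (fun q => q.isEmptyOn Q) ≤ k) :
    (runAllT Q k ts).val = ts.map (value fun q => q.isEmptyOn Q) := by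
  induction k generalizing ts with
  | zero =>
    simp only [runAllT, Timed.val_bind, mapT_val, List.map_map]
    exact List.map_congr_left fun t ht => verdictT_advanceT _ t (Nat.le_zero.1 (h t ht))
  | succ k ih =>
    simp only [runAllT, Timed.val_bind, mapT_val, emptinessBatchT_val]
    rw [resumeT_pendingT, List.map_map, ih, List.map_map]
    · exact List.map_congr_left fun t _ => (resume_advanceT _ t).1
    · intro t ht
      obtain ⟨t, ht', rfl⟩ := List.mem_map.1 ht
      have := h t ht'
      rw [Function.comp_apply, (resume_advanceT _ t).2.1]
      omega

/-- The own steps of the tests are counted once, not once per round, since every round resumes where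
the previous one stopped; only the batches are paid for in each round. -/
theorem runAllT_time_le (Q : List (CPoint R)) (k : ℕ) (ts : List (SafetyTest R)) (r : ℕ)
    (hr : ts.length ≤ r) :
    (runAllT Q k ts).time ≤ (ts.map (steps fun q => q.isEmptyOn Q)).sum +
      (k + 1) * (Q.length * (8 * Nat.clog 2 (2 * r + 1) + 4) + 1004 * (r + 1) ^ 3) := by
  have hr₃ : r + 1 ≤ (r + 1) ^ 3 := Nat.le_self_pow (by norm_num) _
  induction k generalizing ts with
  | zero =>
    simp only [runAllT, Timed.time_bind, Timed.time_tick, mapT_val, mapT_time, List.length_map,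
      verdictT_time, List.map_map]
    have h₁ : (ts.map fun t => (advanceT t).time).sum ≤
        (ts.map fun t => 1 * steps (fun q => q.isEmptyOn Q) t + 1).sum :=
      sum_map_le_of_le _ _ _ fun t _ => by
        have := (advanceT_spec (fun q => q.isEmptyOn Q) t).2.2.1
        omega
    rw [sum_map_add_const] at h₁
    have h₂ : (ts.map ((fun _ => 1) ∘ fun t => (advanceT t).val)).sum = ts.length := by
      simp [Function.comp_def]
    omega
  | succ k ih =>
    have hb := emptinessBatchT_time_le Q (pendingT (ts.map fun t => (advanceT t).val)).val r
      ((pendingT_length_le _).trans (by simpa using hr))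
    have ih' := ih (ts.map (resume (fun q => q.isEmptyOn Q) ∘ fun t => (advanceT t).val))
      (by simpa using hr)
    simp only [runAllT, Timed.time_bind, Timed.time_tick, mapT_val, mapT_time,
      pendingT_time, resumeT_time, emptinessBatchT_val, List.length_map]
    rw [resumeT_pendingT, List.map_map]
    rw [List.map_map] at ih'
    have h₁ : (ts.map fun t => (advanceT t).time).sum +
        (ts.map (steps (fun q => q.isEmptyOn Q) ∘ (resume (fun q => q.isEmptyOn Q) ∘
          fun t => (advanceT t).val))).sum =
        (ts.map (steps fun q => q.isEmptyOn Q)).sum + ts.length := by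
      clear ih' hb hr
      induction ts with
      | nil => simp
      | cons t ts ih =>
        have := (resume_advanceT (fun q => q.isEmptyOn Q) t).2.2
        simp only [List.map_cons, List.sum_cons, List.length_cons, Function.comp_apply] at ih ⊢
        omega
    rw [add_mul (k + 1) 1, one_mul]
    omega

end SafetyTest

/-! ### Reflected orders, to treat the four directions alike -/

section FlippedOrder

variable {R : Type} [LinearOrder R]

/-- The strict order of `R`, or its reverse. -/
def FlipLT (flip : Bool) (u v : R) : Prop := if flip then v < u else u < v

instance (flip : Bool) (u v : R) : Decidable (FlipLT flip u v) := by
  unfold FlipLT; infer_instance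

@[simp] theorem ltFlipT_val (flip : Bool) (u v : R) :
    (ltFlipT flip u v).val = decide (FlipLT flip u v) := by
  cases flip <;> simp [ltFlipT, FlipLT]

@[simp] theorem ltFlipT_time (flip : Bool) (u v : R) : (ltFlipT flip u v).time = 1 := by
  cases flip <;> rfl

theorem FlipLT.trans {flip : Bool} {u v w : R} (h : FlipLT flip u v) (h' : FlipLT flip v w) :
    FlipLT flip u w := by
  cases flip
  · exact lt_trans (α := R) h h'
  · exact lt_trans (α := R) h' h

theorem FlipLT.irrefl {flip : Bool} {u : R} : ¬ FlipLT flip u u := by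
  cases flip <;> simp [FlipLT]

theorem FlipLT.asymm {flip : Bool} {u v : R} (h : FlipLT flip u v) : ¬ FlipLT flip v u :=
  fun h' => FlipLT.irrefl (h.trans h')

theorem FlipLT.lt_or_gt {flip : Bool} {u v : R} (h : u ≠ v) :
    FlipLT flip u v ∨ FlipLT flip v u := by
  cases flip
  · exact lt_or_gt_of_ne h
  · exact (lt_or_gt_of_ne h).symm

theorem FlipLT.of_not {flip : Bool} {u v : R} (h : u ≠ v) (h' : ¬ FlipLT flip u v) :
    FlipLT flip v u :=
  (FlipLT.lt_or_gt h).resolve_left h'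

theorem sees_iff_of_flipLT {fX fY : Bool} {S : Finset (CPoint R)} {p q : CPoint R}
    (hx : FlipLT fX p.x q.x) (hy : FlipLT fY p.y q.y) :
    Sees S p q ↔ ∀ s ∈ S, ¬ (FlipLT fX p.x s.x ∧ FlipLT fX s.x q.x ∧
      FlipLT fY p.y s.y ∧ FlipLT fY s.y q.y) := by
  unfold Sees
  refine forall₂_congr fun s _ => not_congr ?_
  cases fX <;> cases fY <;> simp only [FlipLT, Bool.false_eq_true, if_false, if_true] at * <;>
    simp only [min_eq_left hx.le, min_eq_right hx.le, max_eq_left hx.le, max_eq_right hx.le,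
      min_eq_left hy.le, min_eq_right hy.le, max_eq_left hy.le, max_eq_right hy.le] <;> tauto

end FlippedOrder

/-! ### Staircases with cached nearest points -/

section Stairs

variable {R : Type}

/-- The stored nearest red and blue points are correct. -/
def WellMarked : List (Stair R) → Prop
  | [] => True
  | s :: l =>
    s.red = ((s :: l).map Stair.pt).find? (fun p => decide (p.color = Color.red)) ∧
    s.blue = ((s :: l).map Stair.pt).find? (fun p => decide (p.color = Color.blue)) ∧
    WellMarked l

theorem WellMarked.dropWhile {l : List (Stair R)} (h : WellMarked l) (f : Stair R → Bool) :
    WellMarked (l.dropWhile f) := by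
  induction l with
  | nil => exact h
  | cons s l ih =>
    rw [List.dropWhile_cons]
    split
    · exact ih h.2.2
    · exact h

theorem pushStair_pt (p : CPoint R) (l : List (Stair R)) :
    (pushStair p l).map Stair.pt = p :: l.map Stair.pt := by
  unfold pushStair
  split <;> rfl

theorem WellMarked.pushStair {l : List (Stair R)} (h : WellMarked l) (p : CPoint R) :
    WellMarked (pushStair p l) := by
  rcases l with _ | ⟨s, l⟩
  · cases hc : p.color <;> simp [RedBlue.pushStair, hc, WellMarked]
  · obtain ⟨h₁, h₂, h₃⟩ := h
    cases hc : p.color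
    · simp only [RedBlue.pushStair, hc, WellMarked, List.map_cons]
      refine ⟨by simp [hc], ?_, h₁, h₂, h₃⟩
      rw [List.find?_cons_of_neg (by simp [hc]), h₂, List.map_cons]
    · simp only [RedBlue.pushStair, hc, WellMarked, List.map_cons]
      refine ⟨?_, by simp [hc], h₁, h₂, h₃⟩
      rw [List.find?_cons_of_neg (by simp [hc]), h₁, List.map_cons]

/-- The cached entries give in constant time what a scan of the staircase would give; a scan at each
source would spoil the linear time of a sweep. -/
theorem nearestOpposite_eq {l : List (Stair R)} (h : WellMarked l) (c : Color) :
    nearestOpposite c l = (l.map Stair.pt).find? fun p => decide (p.color ≠ c) := by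
  have hblue : ∀ d : Color, decide (d ≠ Color.red) = decide (d = Color.blue) := by
    intro d; cases d <;> rfl
  have hred : ∀ d : Color, decide (d ≠ Color.blue) = decide (d = Color.red) := by
    intro d; cases d <;> rfl
  rcases l with _ | ⟨s, l⟩
  · rfl
  · cases c
    · simp only [nearestOpposite, hblue]
      exact h.2.1
    · simp only [nearestOpposite, hred]
      exact h.1

theorem length_pushStair (p : CPoint R) (l : List (Stair R)) :
    (pushStair p l).length = l.length + 1 := by
  simpa using congrArg List.length (pushStair_pt p l)

/-- The entries of `A` are the points of `S₁` (left half) and of `S₂` (right half). -/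
structure IsSplit (A : List (Entry R)) (S₁ S₂ : Finset (CPoint R)) : Prop where
  mem_left : ∀ p, p ∈ S₁ ↔ ∃ e ∈ A, e.inLeft = true ∧ e.pt = p
  mem_right : ∀ p, p ∈ S₂ ↔ ∃ e ∈ A, e.inLeft = false ∧ e.pt = p

/-- The targets of a sweep. -/
def targets (fX : Bool) (S₁ S₂ : Finset (CPoint R)) : Finset (CPoint R) := if fX then S₁ else S₂

theorem IsSplit.mem_targets {A : List (Entry R)} {S₁ S₂ : Finset (CPoint R)} (h : IsSplit A S₁ S₂)
    (fX : Bool) (p : CPoint R) : p ∈ targets fX S₁ S₂ ↔ ∃ e ∈ A, e.inLeft = fX ∧ e.pt = p := by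
  cases fX
  · exact h.mem_right p
  · exact h.mem_left p

end Stairs

/-! ### The sweep across the dividing line -/

section Sweep

variable {R : Type} [LinearOrder R]

/-- The stack `src` stands for the swept source points `Ds`, most recent first. -/
def SourceStack (fX : Bool) (src Ds : List (CPoint R)) : Prop :=
  ∀ v : R, src.find? (fun b => !decide (FlipLT fX b.x v)) =
    Ds.find? fun b => !decide (FlipLT fX b.x v)

theorem find?_dropWhile_of_imp {α : Type} {f g : α → Bool} (l : List α)
    (h : ∀ a, f a = true → g a = false) : (l.dropWhile f).find? g = l.find? g := by
  induction l with
  | nil => rfl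
  | cons a l ih =>
    cases hf : f a
    · simp [hf]
    · simp [hf, ih, h a hf]

theorem head?_dropWhile_eq_find? {α : Type} (f : α → Bool) (l : List α) :
    (l.dropWhile f).head? = l.find? fun a => !f a := by
  induction l with
  | nil => rfl
  | cons a l ih => cases hf : f a <;> simp [hf, ih]

/-- Popped points are never needed again: whenever a query coordinate `v` is beyond the new point,
it is beyond the popped ones too, and otherwise the new point is the more recent answer. -/
theorem SourceStack.push {fX : Bool} {src Ds : List (CPoint R)} (h : SourceStack fX src Ds)
    (p : CPoint R) :
    SourceStack fX (p :: src.dropWhile fun b => decide (FlipLT fX b.x p.x)) (p :: Ds) := by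
  intro v
  by_cases hp : FlipLT fX p.x v
  · rw [List.find?_cons_of_neg (by simpa using hp), List.find?_cons_of_neg (by simpa using hp),
      find?_dropWhile_of_imp, h v]
    intro b hb
    simpa using FlipLT.trans (by simpa using hb) hp
  · rw [List.find?_cons_of_pos (by simpa using hp), List.find?_cons_of_pos (by simpa using hp)]

/-- The stack `tgt` is the staircase of the swept target points `Dt`, most recent first. -/
structure TargetStack (fX fY : Bool) (tgt : List (Stair R)) (Dt : List (CPoint R)) : Prop where
  wellMarked : WellMarked tgt
  decreasing : (tgt.map Stair.pt).Pairwise fun a b => FlipLT fX b.x a.x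
  sublist : (tgt.map Stair.pt).Sublist Dt
  mem_iff : ∀ g, g ∈ tgt.map Stair.pt ↔
    g ∈ Dt ∧ ∀ h ∈ Dt, FlipLT fY h.y g.y → ¬ FlipLT fX h.x g.x

/-- For a test that stays false once it fails, removal from the front is the same as filtering. -/
theorem mem_dropWhile_iff {α : Type} {f : α → Bool} {l : List α}
    (h : l.Pairwise fun a b => f a = false → f b = false) (a : α) :
    a ∈ l.dropWhile f ↔ a ∈ l ∧ f a = false := by
  induction l with
  | nil => simp
  | cons b l ih =>
    rw [List.pairwise_cons] at h
    cases hf : f b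
    · rw [List.dropWhile_cons_of_neg (by simp [hf])]
      refine ⟨fun ha => ⟨ha, ?_⟩, fun ha => ha.1⟩
      rcases List.mem_cons.1 ha with rfl | ha
      · exact hf
      · exact h.1 a ha hf
    · rw [List.dropWhile_cons_of_pos hf, ih h.2, List.mem_cons]
      constructor
      · exact fun ha => ⟨Or.inr ha.1, ha.2⟩
      · rintro ⟨rfl | ha, ha'⟩
        · rw [hf] at ha'; cases ha'
        · exact ⟨ha, ha'⟩

/-- The new target hides exactly the older ones beyond it in `x`. As the stack is monotone in `x`
these are at its top, so popping removes them and nothing else. -/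
theorem TargetStack.push {fX fY : Bool} {tgt : List (Stair R)} {Dt : List (CPoint R)}
    (h : TargetStack fX fY tgt Dt) {p : CPoint R} (hx : ∀ g ∈ Dt, g.x ≠ p.x)
    (hy : ∀ g ∈ Dt, FlipLT fY p.y g.y) :
    TargetStack fX fY
      (pushStair p (tgt.dropWhile fun s => decide (FlipLT fX p.x s.pt.x))) (p :: Dt) := by
  have hmap : (tgt.dropWhile fun s => decide (FlipLT fX p.x s.pt.x)).map Stair.pt =
      (tgt.map Stair.pt).dropWhile fun q => decide (FlipLT fX p.x q.x) := by
    rw [List.dropWhile_map]; rfl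
  have hmem : ∀ g, g ∈ (tgt.map Stair.pt).dropWhile (fun q => decide (FlipLT fX p.x q.x)) ↔
      g ∈ tgt.map Stair.pt ∧ ¬ FlipLT fX p.x g.x := by
    intro g
    rw [mem_dropWhile_iff]
    · simp
    · refine h.decreasing.imp fun {a b} hab ha => ?_
      simp only [decide_eq_false_iff_not] at ha ⊢
      exact fun hb => ha (hb.trans hab)
  have hsub := (List.dropWhile_sublist (fun q => decide (FlipLT fX p.x q.x))
    (l := tgt.map Stair.pt))
  refine ⟨(h.wellMarked.dropWhile _).pushStair p, ?_, ?_, ?_⟩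
  · rw [pushStair_pt, hmap, List.pairwise_cons]
    refine ⟨fun b hb => ?_, h.decreasing.sublist hsub⟩
    obtain ⟨hb₁, hb₂⟩ := (hmem b).1 hb
    exact FlipLT.of_not (hx b (h.sublist.subset hb₁)).symm hb₂
  · rw [pushStair_pt, hmap]
    exact (hsub.trans h.sublist).cons_cons p
  · intro g
    rw [pushStair_pt, hmap, List.mem_cons, hmem, h.mem_iff]
    constructor
    · rintro (rfl | ⟨⟨hg, hg'⟩, hpg⟩)
      · refine ⟨by simp, fun h' hh' hlater => ?_⟩
        rcases List.mem_cons.1 hh' with rfl | hh'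
        · exact absurd hlater FlipLT.irrefl
        · exact absurd hlater (hy h' hh').asymm
      · refine ⟨by simp [hg], fun h' hh' hlater => ?_⟩
        rcases List.mem_cons.1 hh' with rfl | hh'
        · exact hpg
        · exact hg' h' hh' hlater
    · rintro ⟨hg, hg'⟩
      rcases List.mem_cons.1 hg with rfl | hg
      · exact Or.inl rfl
      · exact Or.inr ⟨⟨hg, fun h' hh' => hg' h' (by simp [hh'])⟩, hg' p (by simp) (hy g hg)⟩

theorem unblockedT_val (fY : Bool) (g : Option (CPoint R)) (src : List (CPoint R)) :
    (unblockedT fY g src).val = true ↔ ∃ g' ∈ g, ∀ b ∈ src.head?, FlipLT fY g'.y b.y := by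
  rcases g with _ | g <;> rcases src with _ | ⟨b, src⟩ <;> simp [unblockedT]

theorem unblockedT_time_le (fY : Bool) (g : Option (CPoint R)) (src : List (CPoint R)) :
    (unblockedT fY g src).time ≤ 2 := by
  rcases g with _ | g <;> rcases src with _ | ⟨b, src⟩ <;> simp [unblockedT]

/-- The first hit of a search is at least as recent as the others. -/
theorem find?_most_recent {fY : Bool} {l : List (CPoint R)}
    (hl : l.Pairwise fun a b => FlipLT fY a.y b.y) {f : CPoint R → Bool} {a b : CPoint R}
    (ha : l.find? f = some a) (hb : b ∈ l) (hfb : f b = true) : b = a ∨ FlipLT fY a.y b.y := by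
  induction l with
  | nil => simp at hb
  | cons c l ih =>
    rw [List.pairwise_cons] at hl
    cases hc : f c
    · rw [List.find?_cons_of_neg (by simp [hc])] at ha
      rcases List.mem_cons.1 hb with rfl | hb
      · rw [hc] at hfb; cases hfb
      · exact ih hl.2 ha hb
    · rw [List.find?_cons_of_pos hc] at ha
      cases ha
      rcases List.mem_cons.1 hb with rfl | hb
      · exact Or.inl rfl
      · exact Or.inr (hl.1 b hb)

/-- One comparison decides: among the visible targets of the opposite colour the most recent has the
best chance, and among the sources not behind `p` in `x` the most recent is the strictest obstacle.
-/
theorem unblockedT_stacks {fX fY : Bool} {src Ds Dt : List (CPoint R)} {tgt : List (Stair R)}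
    (hsrc : SourceStack fX src Ds) (htgt : TargetStack fX fY tgt Dt)
    (hDs : Ds.Pairwise fun a b => FlipLT fY a.y b.y)
    (hDt : Dt.Pairwise fun a b => FlipLT fY a.y b.y) (p : CPoint R) :
    (unblockedT fY (nearestOpposite p.color tgt)
      (src.dropWhile fun b => decide (FlipLT fX b.x p.x))).val = true ↔
    ∃ g ∈ Dt, g.color ≠ p.color ∧ (∀ h ∈ Dt, FlipLT fY h.y g.y → ¬ FlipLT fX h.x g.x) ∧
      ∀ b ∈ Ds, ¬ FlipLT fX b.x p.x → FlipLT fY g.y b.y := by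
  rw [unblockedT_val, nearestOpposite_eq htgt.wellMarked, head?_dropWhile_eq_find?, hsrc p.x]
  constructor
  · rintro ⟨g, hg, hb⟩
    have hmem := (htgt.mem_iff g).1 (List.mem_of_find?_eq_some hg)
    refine ⟨g, hmem.1, by simpa using List.find?_some hg, hmem.2, fun b hbD hbx => ?_⟩
    obtain ⟨b₀, hb₀⟩ := Option.isSome_iff_exists.1
      (List.find?_isSome.2 ⟨b, hbD, by simpa using hbx⟩ :
      (Ds.find? fun b => !decide (FlipLT fX b.x p.x)).isSome)
    have hgb := hb b₀ hb₀
    rcases find?_most_recent hDs hb₀ hbD (by simpa using hbx) with rfl | h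
    · exact hgb
    · exact hgb.trans h
  · rintro ⟨g, hg, hc, hvis, hb⟩
    have hgt := (htgt.mem_iff g).2 ⟨hg, hvis⟩
    obtain ⟨g₀, hg₀⟩ := Option.isSome_iff_exists.1
      (List.find?_isSome.2 ⟨g, hgt, by simpa using hc⟩ :
      ((tgt.map Stair.pt).find? fun q => decide (q.color ≠ p.color)).isSome)
    refine ⟨g₀, hg₀, fun b hb₀ => ?_⟩
    have hgb := hb b (List.mem_of_find?_eq_some hb₀) (by simpa using List.find?_some hb₀)
    rcases find?_most_recent (hDt.sublist htgt.sublist) hg₀ hgt (by simpa using hc) with rfl | h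
    · exact hgb
    · exact h.trans hgb

/-- `p` sees a point of `T` of the opposite colour in the direction given by `fY`. -/
def SeesOpposite (fY : Bool) (T U : Finset (CPoint R)) (p : CPoint R) : Prop :=
  ∃ g ∈ T, g.color ≠ p.color ∧ FlipLT fY p.y g.y ∧ Sees U p g

open Classical in
/-- What a sweep does to an entry. -/
noncomputable def mark (fX fY : Bool) (S₁ S₂ : Finset (CPoint R)) (e : Entry R) : Entry R :=
  ⟨e.pt, e.found || (e.inLeft != fX && decide (SeesOpposite fY (targets fX S₁ S₂) (S₁ ∪ S₂) e.pt)),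
    e.inLeft⟩

def sourcePoints (fX : Bool) (D : List (Entry R)) : List (CPoint R) :=
  (D.filter fun e => e.inLeft != fX).map Entry.pt

def targetPoints (fX : Bool) (D : List (Entry R)) : List (CPoint R) :=
  (D.filter fun e => e.inLeft == fX).map Entry.pt

theorem IsSplit.mem_union {A : List (Entry R)} {S₁ S₂ : Finset (CPoint R)} (h : IsSplit A S₁ S₂)
    (p : CPoint R) : p ∈ S₁ ∪ S₂ ↔ ∃ e ∈ A, e.pt = p := by
  rw [Finset.mem_union, h.mem_left, h.mem_right]
  constructor
  · rintro (⟨e, he, -, rfl⟩ | ⟨e, he, -, rfl⟩) <;> exact ⟨e, he, rfl⟩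
  · rintro ⟨e, he, rfl⟩
    cases hl : e.inLeft
    · exact Or.inr ⟨e, he, hl, rfl⟩
    · exact Or.inl ⟨e, he, hl, rfl⟩

theorem IsSplit.flipLT {A : List (Entry R)} {S₁ S₂ : Finset (CPoint R)} (h : IsSplit A S₁ S₂)
    (hsep : ∀ p ∈ S₁, ∀ q ∈ S₂, p.x < q.x) {fX : Bool} {a b : Entry R} (ha : a ∈ A) (hb : b ∈ A)
    (ha' : a.inLeft ≠ fX) (hb' : b.inLeft = fX) : FlipLT fX a.pt.x b.pt.x := by
  subst hb'
  cases hl : b.inLeft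
  · rw [hl, ne_eq, Bool.not_eq_false] at ha'
    exact hsep _ ((h.mem_left _).2 ⟨a, ha, ha', rfl⟩) _ ((h.mem_right _).2 ⟨b, hb, hl, rfl⟩)
  · rw [hl, ne_eq, Bool.not_eq_true] at ha'
    exact hsep _ ((h.mem_left _).2 ⟨b, hb, hl, rfl⟩) _ ((h.mem_right _).2 ⟨a, ha, ha', rfl⟩)

/-- The condition tested by the sweep at the entry `e`, after the entries `D`, is visibility. -/
theorem seesOpposite_iff {fX fY : Bool} {A D es : List (Entry R)} {e : Entry R}
    {S₁ S₂ : Finset (CPoint R)} (hA : A = D.reverse ++ e :: es)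
    (hsort : A.Pairwise fun a b => FlipLT fY b.pt.y a.pt.y) (hsplit : IsSplit A S₁ S₂)
    (hS : InGeneralPosition (S₁ ∪ S₂)) (hsep : ∀ p ∈ S₁, ∀ q ∈ S₂, p.x < q.x)
    (he : e.inLeft ≠ fX) :
    SeesOpposite fY (targets fX S₁ S₂) (S₁ ∪ S₂) e.pt ↔
    ∃ g ∈ targetPoints fX D, g.color ≠ e.pt.color ∧
      (∀ h ∈ targetPoints fX D, FlipLT fY h.y g.y → ¬ FlipLT fX h.x g.x) ∧
      ∀ b ∈ sourcePoints fX D, ¬ FlipLT fX b.x e.pt.x → FlipLT fY g.y b.y := by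
  have heA : e ∈ A := by simp [hA]
  have hDA : ∀ a ∈ D, a ∈ A := fun a ha => by simp [hA, ha]
  have hlater : ∀ a ∈ A, FlipLT fY e.pt.y a.pt.y → a ∈ D := by
    intro a ha hlt
    rw [hA] at ha hsort
    rcases List.mem_append.1 ha with ha | ha
    · exact List.mem_reverse.1 ha
    · rcases List.mem_cons.1 ha with rfl | ha
      · exact absurd hlt FlipLT.irrefl
      · have := (List.pairwise_cons.1 (List.pairwise_append.1 hsort).2.1).1 a ha
        exact absurd hlt this.asymm
  have hlater' : ∀ a ∈ D, FlipLT fY e.pt.y a.pt.y := by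
    intro a ha
    rw [hA] at hsort
    exact (List.pairwise_append.1 hsort).2.2 a (List.mem_reverse.2 ha) e (by simp)
  have hmem : ∀ a ∈ A, a.pt ∈ S₁ ∪ S₂ := fun a ha => (hsplit.mem_union _).2 ⟨a, ha, rfl⟩
  simp only [targetPoints, sourcePoints, List.mem_map, List.mem_filter, beq_iff_eq, bne_iff_ne]
  constructor
  · rintro ⟨g, hg, hc, hy, hsees⟩
    obtain ⟨g, hgA, hgl, rfl⟩ := (hsplit.mem_targets fX g).1 hg
    have hx := hsplit.flipLT hsep heA hgA he hgl
    rw [sees_iff_of_flipLT hx hy] at hsees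
    refine ⟨g.pt, ⟨g, ⟨hlater g hgA hy, hgl⟩, rfl⟩, hc, ?_, ?_⟩
    · rintro _ ⟨h, ⟨hh, hhl⟩, rfl⟩ hhg hhx
      exact hsees h.pt (hmem h (hDA h hh)) ⟨hsplit.flipLT hsep heA (hDA h hh) he hhl, hhx,
        hlater' h hh, hhg⟩
    · rintro _ ⟨b, ⟨hb, hbl⟩, rfl⟩ hbx
      have hbA := hDA b hb
      have hbg := hsplit.flipLT hsep hbA hgA hbl hgl
      by_contra hgb
      have hne : b.pt.x ≠ e.pt.x := by
        intro h
        have := hS _ (hmem b hbA) _ (hmem e heA) (Or.inl h)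
        have h' := hlater' b hb
        rw [this] at h'
        exact FlipLT.irrefl h'
      have hne' : g.pt.y ≠ b.pt.y := by
        intro h
        have := hS _ (hmem g hgA) _ (hmem b hbA) (Or.inr h)
        rw [this] at hbg
        exact FlipLT.irrefl hbg
      exact hsees b.pt (hmem b hbA) ⟨FlipLT.of_not hne hbx, hbg, hlater' b hb,
        FlipLT.of_not hne' hgb⟩
  · rintro ⟨_, ⟨g, ⟨hg, hgl⟩, rfl⟩, hc, hvis, hblock⟩
    have hgA := hDA g hg
    have hx := hsplit.flipLT hsep heA hgA he hgl
    have hy := hlater' g hg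
    refine ⟨g.pt, (hsplit.mem_targets fX _).2 ⟨g, hgA, hgl, rfl⟩, hc, hy, ?_⟩
    rw [sees_iff_of_flipLT hx hy]
    rintro s hs ⟨h₁, h₂, h₃, h₄⟩
    obtain ⟨s, hsA, rfl⟩ := (hsplit.mem_union s).1 hs
    have hsD := hlater s hsA h₃
    -- A blocker among the targets would hide `g` on the staircase; a blocker among the sources
    -- would have to lie beyond `g` in `y`.
    by_cases hsl : s.inLeft = fX
    · exact hvis s.pt ⟨s, ⟨hsD, hsl⟩, rfl⟩ h₄ h₂
    · exact (hblock s.pt ⟨s, ⟨hsD, hsl⟩, rfl⟩ h₁.asymm).asymm h₄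

/-- The invariant of the sweep: `D` lists the swept entries, most recent first, and the two stacks
represent its sources and targets. -/
theorem sweepT_val_aux {fX fY : Bool} {A : List (Entry R)} {S₁ S₂ : Finset (CPoint R)}
    (hsort : A.Pairwise fun a b => FlipLT fY b.pt.y a.pt.y) (hsplit : IsSplit A S₁ S₂)
    (hS : InGeneralPosition (S₁ ∪ S₂)) (hsep : ∀ p ∈ S₁, ∀ q ∈ S₂, p.x < q.x)
    (es D : List (Entry R)) (src : List (CPoint R)) (tgt : List (Stair R))
    (hA : A = D.reverse ++ es) (hsrc : SourceStack fX src (sourcePoints fX D))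
    (htgt : TargetStack fX fY tgt (targetPoints fX D)) :
    (sweepT fX fY src tgt es).val = es.map (mark fX fY S₁ S₂) := by
  induction es generalizing D src tgt with
  | nil => simp [sweepT]
  | cons e es ih =>
    have hA' : A = (e :: D).reverse ++ es := by simp [hA]
    have hD : D.Pairwise fun a b => FlipLT fY a.pt.y b.pt.y := by
      rw [hA] at hsort
      exact List.pairwise_reverse.1 (List.pairwise_append.1 hsort).1
    have heD : ∀ a ∈ D, FlipLT fY e.pt.y a.pt.y := by
      rw [hA] at hsort
      exact fun a ha => (List.pairwise_append.1 hsort).2.2 a (List.mem_reverse.2 ha) e (by simp)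
    by_cases he : e.inLeft = fX
    · have ht : targetPoints fX (e :: D) = e.pt :: targetPoints fX D := by
        simp [targetPoints, he]
      have hs : sourcePoints fX (e :: D) = sourcePoints fX D := by simp [sourcePoints, he]
      have hrest := ih (e :: D) src
        (pushStair e.pt (tgt.dropWhile fun s => decide (FlipLT fX e.pt.x s.pt.x))) hA'
        (by rw [hs]; exact hsrc)
        (by
          rw [ht]
          refine htgt.push (fun g hg h => ?_) fun g hg => ?_
          · obtain ⟨a, ha, rfl⟩ := List.mem_map.1 hg
            have haD := (List.mem_filter.1 ha).1
            have := hS _ ((hsplit.mem_union _).2 ⟨a, by simp [hA, haD], rfl⟩) _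
              ((hsplit.mem_union _).2 ⟨e, by simp [hA], rfl⟩) (Or.inl h)
            have h' := heD a haD
            rw [this] at h'
            exact FlipLT.irrefl h'
          · obtain ⟨a, ha, rfl⟩ := List.mem_map.1 hg
            exact heD a (List.mem_filter.1 ha).1)
      have hmark : mark fX fY S₁ S₂ e = e := by subst he; simp [mark]
      rw [List.map_cons, hmark, ← hrest]
      simp [sweepT, he]
    · have ht : targetPoints fX (e :: D) = targetPoints fX D := by
        simp [targetPoints, he]
      have hs : sourcePoints fX (e :: D) = e.pt :: sourcePoints fX D := by
        simp [sourcePoints, he]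
      have hrest := ih (e :: D) (e.pt :: src.dropWhile fun b => decide (FlipLT fX b.x e.pt.x)) tgt
        hA' (by rw [hs]; exact hsrc.push e.pt) (by rw [ht]; exact htgt)
      have hhit := unblockedT_stacks hsrc htgt
        (List.pairwise_map.2 (hD.sublist List.filter_sublist))
        (List.pairwise_map.2 (hD.sublist List.filter_sublist)) e.pt
      rw [← seesOpposite_iff hA hsort hsplit hS hsep he] at hhit
      rw [List.map_cons, ← hrest]
      have hb : (e.inLeft != fX) = true := by simpa using he
      simp only [sweepT, hb, if_true, Timed.val_bind, popWhileT_val, ltFlipT_val, Timed.val_pure,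
        mark, Bool.true_and]
      congr 3
      rw [Bool.eq_iff_iff, hhit]
      simp

theorem sweepT_val {fX fY : Bool} {A : List (Entry R)} {S₁ S₂ : Finset (CPoint R)}
    (hsort : A.Pairwise fun a b => FlipLT fY b.pt.y a.pt.y) (hsplit : IsSplit A S₁ S₂)
    (hS : InGeneralPosition (S₁ ∪ S₂)) (hsep : ∀ p ∈ S₁, ∀ q ∈ S₂, p.x < q.x) :
    (sweepT fX fY [] [] A).val = A.map (mark fX fY S₁ S₂) :=
  sweepT_val_aux hsort hsplit hS hsep A [] [] [] (by simp) (fun v => rfl)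
    ⟨trivial, by simp, by simp [targetPoints], by simp [targetPoints]⟩

/-- Amortised with two units per stacked point. An entry costs at most 5 beyond what its pops
release, and pushes one point worth 2. -/
theorem sweepT_time_le (fX fY : Bool) (src : List (CPoint R)) (tgt : List (Stair R))
    (es : List (Entry R)) :
    (sweepT fX fY src tgt es).time ≤ 7 * es.length + 2 * src.length + 2 * tgt.length + 1 := by
  induction es generalizing src tgt with
  | nil => simp [sweepT]
  | cons e es ih =>
    by_cases he : e.inLeft = fX
    · have hb : (e.inLeft != fX) = false := by simpa using he
      have h₁ := popWhileT_time_le (fun s : Stair R => ltFlipT fX e.pt.x s.pt.x)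
        (fun s => ltFlipT_time _ _ _) tgt
      have h₂ := ih src
        (pushStair e.pt (tgt.dropWhile fun s => (ltFlipT fX e.pt.x s.pt.x).val))
      rw [length_pushStair] at h₂
      simp only [sweepT, hb, Bool.false_eq_true, if_false, Timed.time_bind, Timed.time_tick,
        popWhileT_val, Timed.time_pure, List.length_cons]
      omega
    · have hb : (e.inLeft != fX) = true := by simpa using he
      have h₁ := popWhileT_time_le (fun b : CPoint R => ltFlipT fX b.x e.pt.x)
        (fun s => ltFlipT_time _ _ _) src
      have h₂ := ih (e.pt :: src.dropWhile fun b => (ltFlipT fX b.x e.pt.x).val) tgt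
      have h₃ := unblockedT_time_le fY (nearestOpposite e.pt.color tgt)
        (src.dropWhile fun b => (ltFlipT fX b.x e.pt.x).val)
      rw [List.length_cons] at h₂
      simp only [sweepT, hb, if_true, Timed.time_bind, Timed.time_tick,
        popWhileT_val, Timed.time_pure, List.length_cons]
      omega

end Sweep

/-! ### Correctness and cost of the direct algorithm -/

section Direct

variable {R : Type}

theorem IsSplit.congr {A A' : List (Entry R)} {S₁ S₂ : Finset (CPoint R)} (h : IsSplit A S₁ S₂)
    (f : Entry R → Entry R) (hf : ∀ e, (f e).pt = e.pt ∧ (f e).inLeft = e.inLeft)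
    (hA : ∀ e, e ∈ A' ↔ ∃ a ∈ A, f a = e) : IsSplit A' S₁ S₂ := by
  have key : ∀ b p, (∃ e ∈ A', e.inLeft = b ∧ e.pt = p) ↔ ∃ e ∈ A, e.inLeft = b ∧ e.pt = p := by
    intro b p
    constructor
    · rintro ⟨e, he, h₁, h₂⟩
      obtain ⟨a, ha, rfl⟩ := (hA e).1 he
      exact ⟨a, ha, (hf a).2.symm.trans h₁, (hf a).1.symm.trans h₂⟩
    · rintro ⟨a, ha, h₁, h₂⟩
      exact ⟨f a, (hA _).2 ⟨a, ha, rfl⟩, (hf a).2.trans h₁, (hf a).1.trans h₂⟩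
  exact ⟨fun p => (h.mem_left p).trans (key _ _).symm,
    fun p => (h.mem_right p).trans (key _ _).symm⟩

theorem IsSplit.reverse {A : List (Entry R)} {S₁ S₂ : Finset (CPoint R)} (h : IsSplit A S₁ S₂) :
    IsSplit A.reverse S₁ S₂ :=
  h.congr id (fun _ => ⟨rfl, rfl⟩) (by simp)

variable [LinearOrder R]

theorem IsSplit.map_mark {A : List (Entry R)} {S₁ S₂ : Finset (CPoint R)} (h : IsSplit A S₁ S₂)
    (fX fY : Bool) : IsSplit (A.map (mark fX fY S₁ S₂)) S₁ S₂ :=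
  h.congr (mark fX fY S₁ S₂) (fun _ => ⟨rfl, rfl⟩) (by simp)

/-- The two upward sweeps followed by the two downward sweeps. -/
noncomputable def markAll (S₁ S₂ : Finset (CPoint R)) (e : Entry R) : Entry R :=
  mark true false S₁ S₂ (mark false false S₁ S₂ (mark true true S₁ S₂ (mark false true S₁ S₂ e)))

theorem sweeps_val {m : List (Entry R)} {S₁ S₂ : Finset (CPoint R)}
    (hsort : m.Pairwise fun a b => a.pt.y < b.pt.y) (hsplit : IsSplit m S₁ S₂)
    (hS : InGeneralPosition (S₁ ∪ S₂)) (hsep : ∀ p ∈ S₁, ∀ q ∈ S₂, p.x < q.x) :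
    (sweepT true false [] [] (sweepT false false [] [] (sweepT true true [] []
      (sweepT false true [] [] m).val).val.reverse).val).val.reverse = m.map (markAll S₁ S₂) := by
  rw [sweepT_val (fY := true) (by simpa [FlipLT] using hsort) hsplit hS hsep]
  have hsort₁ : (m.map (mark false true S₁ S₂)).Pairwise fun a b => a.pt.y < b.pt.y :=
    List.pairwise_map.2 hsort
  rw [sweepT_val (fY := true) (by simpa [FlipLT] using hsort₁) (hsplit.map_mark _ _) hS hsep]
  have hsort₂ : ((m.map (mark false true S₁ S₂)).map (mark true true S₁ S₂)).reverse.Pairwise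
      fun a b => b.pt.y < a.pt.y := List.pairwise_reverse.2 (List.pairwise_map.2 hsort₁)
  have hsplit₂ := ((hsplit.map_mark false true).map_mark true true).reverse
  rw [sweepT_val (fY := false) (by simpa [FlipLT] using hsort₂) hsplit₂ hS hsep]
  have hsort₃ := List.pairwise_map (f := mark false false S₁ S₂)
    (R := fun a b : Entry R => b.pt.y < a.pt.y) |>.2 hsort₂
  rw [sweepT_val (fY := false) (by simpa only [FlipLT, Bool.false_eq_true, if_false] using hsort₃)
    (hsplit₂.map_mark _ _) hS hsep]
  simp [List.map_reverse, markAll, Function.comp_def]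

/-- Boxes spanned by two points of the left half lie to the left of all points of the right half, so
visibility within a half is unaffected by the other half. -/
theorem participates_union_left {S₁ S₂ : Finset (CPoint R)}
    (hsep : ∀ p ∈ S₁, ∀ q ∈ S₂, p.x < q.x) {p : CPoint R} (hp : p ∈ S₁) :
    Participates (S₁ ∪ S₂) p ↔ Participates S₁ p ∨
      ∃ g ∈ S₂, g.color ≠ p.color ∧ Sees (S₁ ∪ S₂) p g := by
  have hsees : ∀ q ∈ S₁, Sees (S₁ ∪ S₂) p q ↔ Sees S₁ p q := by
    intro q hq
    refine ⟨fun h s hs => h s (Finset.mem_union_left _ hs), fun h s hs => ?_⟩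
    rcases Finset.mem_union.1 hs with hs | hs
    · exact h s hs
    · rintro ⟨-, h₂, -⟩
      exact absurd h₂ (not_lt.2 (max_le (hsep p hp s hs).le (hsep q hq s hs).le))
  constructor
  · rintro ⟨-, q, hq, hc, hs⟩
    rcases Finset.mem_union.1 hq with hq | hq
    · exact Or.inl ⟨hp, q, hq, hc, (hsees q hq).1 hs⟩
    · exact Or.inr ⟨q, hq, hc, hs⟩
  · rintro (⟨-, q, hq, hc, hs⟩ | ⟨q, hq, hc, hs⟩)
    · exact ⟨Finset.mem_union_left _ hp, q, Finset.mem_union_left _ hq, hc, (hsees q hq).2 hs⟩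
    · exact ⟨Finset.mem_union_left _ hp, q, Finset.mem_union_right _ hq, hc, hs⟩

theorem participates_union_right {S₁ S₂ : Finset (CPoint R)}
    (hsep : ∀ p ∈ S₁, ∀ q ∈ S₂, p.x < q.x) {p : CPoint R} (hp : p ∈ S₂) :
    Participates (S₁ ∪ S₂) p ↔ Participates S₂ p ∨
      ∃ g ∈ S₁, g.color ≠ p.color ∧ Sees (S₁ ∪ S₂) p g := by
  have hsees : ∀ q ∈ S₂, Sees (S₁ ∪ S₂) p q ↔ Sees S₂ p q := by
    intro q hq
    refine ⟨fun h s hs => h s (Finset.mem_union_right _ hs), fun h s hs => ?_⟩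
    rcases Finset.mem_union.1 hs with hs | hs
    · rintro ⟨h₁, -⟩
      exact absurd h₁ (not_lt.2 (le_min (hsep s hs p hp).le (hsep s hs q hq).le))
    · exact h s hs
  constructor
  · rintro ⟨-, q, hq, hc, hs⟩
    rcases Finset.mem_union.1 hq with hq | hq
    · exact Or.inr ⟨q, hq, hc, hs⟩
    · exact Or.inl ⟨hp, q, hq, hc, (hsees q hq).1 hs⟩
  · rintro (⟨-, q, hq, hc, hs⟩ | ⟨q, hq, hc, hs⟩)
    · exact ⟨Finset.mem_union_right _ hp, q, Finset.mem_union_right _ hq, hc, (hsees q hq).2 hs⟩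
    · exact ⟨Finset.mem_union_right _ hp, q, Finset.mem_union_left _ hq, hc, hs⟩

theorem seesOpposite_or {T U : Finset (CPoint R)} {p : CPoint R} (hT : ∀ g ∈ T, p.y ≠ g.y) :
    (SeesOpposite true T U p ∨ SeesOpposite false T U p) ↔
      ∃ g ∈ T, g.color ≠ p.color ∧ Sees U p g := by
  constructor
  · rintro (⟨g, hg, hc, -, hs⟩ | ⟨g, hg, hc, -, hs⟩) <;> exact ⟨g, hg, hc, hs⟩
  · rintro ⟨g, hg, hc, hs⟩
    rcases lt_or_gt_of_ne (hT g hg) with h | h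
    · exact Or.inr ⟨g, hg, hc, by simpa [FlipLT] using h, hs⟩
    · exact Or.inl ⟨g, hg, hc, by simpa [FlipLT] using h, hs⟩

theorem mark_found (fX fY : Bool) (S₁ S₂ : Finset (CPoint R)) (e : Entry R) :
    (mark fX fY S₁ S₂ e).found = true ↔ e.found = true ∨
      (e.inLeft ≠ fX ∧ SeesOpposite fY (targets fX S₁ S₂) (S₁ ∪ S₂) e.pt) := by
  simp [mark]

/-- Each entry is a source in exactly two of the four sweeps, one upward and one downward. Together
they detect any point of the opposite colour seen across the dividing line; recursion has settled
the own half. -/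
theorem markAll_found {S₁ S₂ : Finset (CPoint R)} (hS : InGeneralPosition (S₁ ∪ S₂))
    (hsep : ∀ p ∈ S₁, ∀ q ∈ S₂, p.x < q.x) {e : Entry R}
    (hl : e.inLeft = true → e.pt ∈ S₁ ∧ (e.found = true ↔ Participates S₁ e.pt))
    (hr : e.inLeft = false → e.pt ∈ S₂ ∧ (e.found = true ↔ Participates S₂ e.pt)) :
    (markAll S₁ S₂ e).found = true ↔ Participates (S₁ ∪ S₂) e.pt := by
  have hne : ∀ p ∈ S₁, ∀ q ∈ S₂, p.y ≠ q.y := by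
    intro p hp q hq h
    have := hS p (Finset.mem_union_left _ hp) q (Finset.mem_union_right _ hq) (Or.inr h)
    exact (hsep p hp q hq).ne (by rw [this])
  cases he : e.inLeft
  · obtain ⟨hp, hf⟩ := hr he
    rw [participates_union_right hsep hp, ← hf,
      ← seesOpposite_or (fun g hg => (hne g hg _ hp).symm)]
    simp only [markAll, mark_found]
    simp [mark, he, targets, or_assoc]
  · obtain ⟨hp, hf⟩ := hl he
    rw [participates_union_left hsep hp, ← hf, ← seesOpposite_or (fun g hg => hne _ hp g hg)]
    simp only [markAll, mark_found]
    simp [mark, he, targets, or_assoc]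

theorem not_participates_of_length_le_one {l : List (CPoint R)} (h : l.length ≤ 1)
    (p : CPoint R) : ¬ Participates l.toFinset p := by
  rintro ⟨hp, q, hq, hc, -⟩
  match l, h with
  | [], _ => simp at hp
  | [a], _ =>
    simp at hp hq
    exact hc (by rw [hp, hq])

theorem sorted_and_found_iff_of_length_le_one {l : List (Entry R)} (hn : l.length ≤ 1)
    (hfound : ∀ e ∈ l, e.found = false) : (l.Pairwise fun a b => a.pt.y < b.pt.y) ∧
      ∀ e ∈ l, e.found = true ↔ Participates (l.map Entry.pt).toFinset e.pt := by
  refine ⟨?_, fun e he => ?_⟩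
  · match l, hn with
    | [], _ => simp
    | [a], _ => simp
  · simp [hfound e he, not_participates_of_length_le_one (l := l.map Entry.pt) (by simpa using hn)]

theorem conquerT_spec (fuel : ℕ) (l : List (Entry R)) (hf : l.length ≤ fuel)
    (hgp : GeneralPosition (l.map Entry.pt)) (hx : l.Pairwise fun a b => a.pt.x < b.pt.x)
    (hfound : ∀ e ∈ l, e.found = false) :
    ((conquerT fuel l).val.map Entry.pt).Perm (l.map Entry.pt) ∧
    ((conquerT fuel l).val.Pairwise fun a b => a.pt.y < b.pt.y) ∧
    ∀ e ∈ (conquerT fuel l).val,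
      e.found = true ↔ Participates (l.map Entry.pt).toFinset e.pt := by
  induction fuel generalizing l with
  | zero =>
    simp only [conquerT, Timed.val_bind, Timed.val_pure]
    exact ⟨List.Perm.refl _, sorted_and_found_iff_of_length_le_one (by omega) hfound⟩
  | succ fuel ih =>
    by_cases hn : l.length ≤ 1
    · simp only [conquerT, Timed.val_bind, lengthT_val, hn, if_true, Timed.val_pure]
      exact ⟨List.Perm.refl _, sorted_and_found_iff_of_length_le_one hn hfound⟩
    · set l₁ := l.take (l.length / 2) with hl₁
      set l₂ := l.drop (l.length / 2) with hl₂
      have hl : l₁ ++ l₂ = l := List.take_append_drop _ _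
      have hsub₁ : l₁.Sublist l := List.take_sublist _ _
      have hsub₂ : l₂.Sublist l := List.drop_sublist _ _
      obtain ⟨p₁, y₁, f₁⟩ := ih l₁ (by simp [hl₁]; omega)
        (List.Pairwise.sublist (hsub₁.map Entry.pt) hgp) (hx.sublist hsub₁)
        (fun e he => hfound e (hsub₁.subset he))
      obtain ⟨p₂, y₂, f₂⟩ := ih l₂ (by simp [hl₂]; omega)
        (List.Pairwise.sublist (hsub₂.map Entry.pt) hgp) (hx.sublist hsub₂)
        (fun e he => hfound e (hsub₂.subset he))
      set S₁ := (l₁.map Entry.pt).toFinset with hS₁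
      set S₂ := (l₂.map Entry.pt).toFinset with hS₂
      have hS : S₁ ∪ S₂ = (l.map Entry.pt).toFinset := by
        rw [← hl, List.map_append, List.toFinset_append]
      have hSgp : InGeneralPosition (S₁ ∪ S₂) := by rw [hS]; exact hgp.toFinset
      have hsep : ∀ p ∈ S₁, ∀ q ∈ S₂, p.x < q.x := by
        intro p hp q hq
        simp only [hS₁, hS₂, List.mem_toFinset, List.mem_map] at hp hq
        obtain ⟨a, ha, rfl⟩ := hp
        obtain ⟨b, hb, rfl⟩ := hq
        rw [← hl] at hx
        exact (List.pairwise_append.1 hx).2.2 a ha b hb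
      set m₁ := (conquerT fuel l₁).val.map fun e => (⟨e.pt, e.found, true⟩ : Entry R) with hm₁
      set m₂ := (conquerT fuel l₂).val.map fun e => (⟨e.pt, e.found, false⟩ : Entry R) with hm₂
      have hm₁p : m₁.map Entry.pt = (conquerT fuel l₁).val.map Entry.pt := by simp [hm₁]
      have hm₂p : m₂.map Entry.pt = (conquerT fuel l₂).val.map Entry.pt := by simp [hm₂]
      set m := (mergeT (fun e : Entry R => e.pt.y) m₁ m₂).val with hm
      have hmperm : m.Perm (m₁ ++ m₂) := mergeT_perm _ _ _
      have hmpt : (m.map Entry.pt).Perm (l.map Entry.pt) := by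
        refine (hmperm.map _).trans ?_
        rw [List.map_append, ← hl, List.map_append, hm₁p, hm₂p]
        exact p₁.append p₂
      have hmsort : m.Pairwise fun a b => a.pt.y < b.pt.y := by
        have h₁ : m.Pairwise fun a b => a.pt.y ≤ b.pt.y := by
          refine mergeT_sorted (fun e : Entry R => e.pt.y) m₁ m₂ ?_ ?_
          · exact List.pairwise_map.2 (y₁.imp fun h => h.le)
          · exact List.pairwise_map.2 (y₂.imp fun h => h.le)
        have h₂ : GeneralPosition (m.map Entry.pt) :=
          (hmpt.pairwise_iff fun {a b} h => ⟨h.1.symm, h.2.symm⟩).2 hgp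
        exact (h₁.and (List.pairwise_map.1 h₂)).imp fun h => lt_of_le_of_ne h.1 h.2.2
      have hmem₁ : ∀ e ∈ m₁, e.inLeft = true ∧ e.pt ∈ S₁ ∧
          (e.found = true ↔ Participates S₁ e.pt) := by
        intro e he
        obtain ⟨a, ha, rfl⟩ := List.mem_map.1 he
        refine ⟨rfl, ?_, f₁ a ha⟩
        rw [hS₁, List.mem_toFinset]
        exact (p₁.mem_iff (a := a.pt)).1 (List.mem_map_of_mem ha)
      have hmem₂ : ∀ e ∈ m₂, e.inLeft = false ∧ e.pt ∈ S₂ ∧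
          (e.found = true ↔ Participates S₂ e.pt) := by
        intro e he
        obtain ⟨a, ha, rfl⟩ := List.mem_map.1 he
        refine ⟨rfl, ?_, f₂ a ha⟩
        rw [hS₂, List.mem_toFinset]
        exact (p₂.mem_iff (a := a.pt)).1 (List.mem_map_of_mem ha)
      have hsplit : IsSplit m S₁ S₂ := by
        constructor
        · intro p
          rw [hS₁, List.mem_toFinset, ← p₁.mem_iff, ← hm₁p, List.mem_map]
          constructor
          · rintro ⟨e, he, rfl⟩
            exact ⟨e, hmperm.mem_iff.2 (List.mem_append_left _ he), (hmem₁ e he).1, rfl⟩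
          · rintro ⟨e, he, hle, rfl⟩
            rcases List.mem_append.1 (hmperm.mem_iff.1 he) with he | he
            · exact ⟨e, he, rfl⟩
            · rw [(hmem₂ e he).1] at hle; cases hle
        · intro p
          rw [hS₂, List.mem_toFinset, ← p₂.mem_iff, ← hm₂p, List.mem_map]
          constructor
          · rintro ⟨e, he, rfl⟩
            exact ⟨e, hmperm.mem_iff.2 (List.mem_append_right _ he), (hmem₂ e he).1, rfl⟩
          · rintro ⟨e, he, hle, rfl⟩
            rcases List.mem_append.1 (hmperm.mem_iff.1 he) with he | he
            · rw [(hmem₁ e he).1] at hle; cases hle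
            · exact ⟨e, he, rfl⟩
      have hval : (conquerT (fuel + 1) l).val = m.map (markAll S₁ S₂) := by
        rw [← sweeps_val hmsort hsplit hSgp hsep]
        simp only [conquerT, Timed.val_bind, lengthT_val, hn, if_false, splitAtT_val, mapT_val,
          setHalfT, Timed.val_pure, revAppendT_val, List.append_nil]
        rfl
      rw [hval]
      refine ⟨?_, List.pairwise_map.2 hmsort, ?_⟩
      · rw [List.map_map]
        exact hmpt
      · intro e he
        obtain ⟨a, ha, rfl⟩ := List.mem_map.1 he
        rw [← hS]
        have ha' := List.mem_append.1 (hmperm.mem_iff.1 ha)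
        refine markAll_found hSgp hsep (fun h => ?_) (fun h => ?_)
        · rcases ha' with ha' | ha'
          · exact (hmem₁ a ha').2
          · rw [(hmem₂ a ha').1] at h; cases h
        · rcases ha' with ha' | ha'
          · rw [(hmem₁ a ha').1] at h; cases h
          · exact (hmem₂ a ha').2

theorem sweepT_length (fX fY : Bool) (src : List (CPoint R)) (tgt : List (Stair R))
    (es : List (Entry R)) : (sweepT fX fY src tgt es).val.length = es.length := by
  induction es generalizing src tgt with
  | nil => simp [sweepT]
  | cons e es ih =>
    by_cases he : (e.inLeft != fX) = true
    · simp only [sweepT, he, if_true, Timed.val_bind, Timed.val_pure, List.length_cons, ih]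
    · simp only [sweepT, he, Timed.val_bind]
      simpa using ih _ _

theorem conquerT_length (fuel : ℕ) (l : List (Entry R)) :
    (conquerT fuel l).val.length = l.length := by
  induction fuel generalizing l with
  | zero => simp [conquerT]
  | succ fuel ih =>
    by_cases hn : l.length ≤ 1
    · simp [conquerT, hn]
    · simp only [conquerT, Timed.val_bind, lengthT_val, hn, if_false, splitAtT_val, mapT_val,
        revAppendT_val, List.append_nil, List.length_reverse, sweepT_length,
        (mergeT_perm _ _ _).length_eq, List.length_append, List.length_map, ih]
      rw [← List.length_append, List.take_append_drop]

theorem conquerT_time_le (fuel : ℕ) (l : List (Entry R)) :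
    (conquerT fuel l).time ≤ 160 * (l.length * (Nat.clog 2 l.length + 1)) + 3 := by
  induction fuel generalizing l with
  | zero => simp [conquerT]
  | succ fuel ih =>
    by_cases hn : l.length ≤ 1
    · simp [conquerT, hn]; omega
    · have h₁ := ih (l.take (l.length / 2))
      have h₂ := ih (l.drop (l.length / 2))
      have h₃ := splitAtT_time_le (l.length / 2) l
      -- The four sweeps at 7 steps per entry dominate the work of a level, which is about `36 n`;
      -- 80 leaves room for the constants.
      have h₄ := halving_recurrence (a := 160) (b := 80) (n := l.length) (by norm_num) (by omega)
      simp only [List.length_take, List.length_drop,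
        min_eq_left (Nat.div_le_self l.length 2)] at h₁ h₂
      have hset : ∀ (b : Bool) (m : List (Entry R)),
          (m.map fun e => (setHalfT b e).time).sum = m.length := by
        intro b m
        simp [setHalfT]
      have hl₁ : (conquerT fuel (l.take (l.length / 2))).val.length = l.length / 2 := by
        rw [conquerT_length, List.length_take, min_eq_left (Nat.div_le_self l.length 2)]
      have hl₂ : (conquerT fuel (l.drop (l.length / 2))).val.length = l.length - l.length / 2 := by
        rw [conquerT_length, List.length_drop]
      simp only [conquerT, Timed.time_bind, Timed.time_tick, lengthT_val, lengthT_time, hn,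
        if_false, splitAtT_val, mapT_val, mapT_time, hset, revAppendT_val, revAppendT_time,
        List.append_nil]
      set m₁ := (conquerT fuel (l.take (l.length / 2))).val.map fun e => (setHalfT true e).val
        with hm₁
      set m₂ := (conquerT fuel (l.drop (l.length / 2))).val.map fun e => (setHalfT false e).val
        with hm₂
      have hm₁l : m₁.length = l.length / 2 := by rw [hm₁, List.length_map, hl₁]
      have hm₂l : m₂.length = l.length - l.length / 2 := by rw [hm₂, List.length_map, hl₂]
      have hmt := mergeT_time_le (fun e : Entry R => e.pt.y) m₁ m₂
      have hml := (mergeT_perm (fun e : Entry R => e.pt.y) m₁ m₂).length_eq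
      rw [List.length_append] at hml
      set m := (mergeT (fun e : Entry R => e.pt.y) m₁ m₂).val
      have s₁ := sweepT_time_le false true [] [] m
      have e₁ := sweepT_length false true [] [] m
      set n₁ := (sweepT false true [] [] m).val
      have s₂ := sweepT_time_le true true [] [] n₁
      have e₂ := sweepT_length true true [] [] n₁
      set n₂ := (sweepT true true [] [] n₁).val
      have s₃ := sweepT_time_le false false [] [] n₂.reverse
      have e₃ := sweepT_length false false [] [] n₂.reverse
      set n₃ := (sweepT false false [] [] n₂.reverse).val
      have s₄ := sweepT_time_le true false [] [] n₃
      have e₄ := sweepT_length true false [] [] n₃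
      set n₄ := (sweepT true false [] [] n₃).val
      simp only [List.length_nil, List.length_reverse] at s₁ s₂ s₃ s₄ e₃
      omega

theorem solveDirectlyT_val {Q : List (CPoint R)} (hQ : GeneralPosition Q) :
    (solveDirectlyT Q).val.Nodup ∧
    ∀ p, p ∈ (solveDirectlyT Q).val ↔ Participates Q.toFinset p := by
  set l := (mergeSortT CPoint.x Q.length Q).val with hl
  have hperm : l.Perm Q := mergeSortT_perm _ _ _
  have hgp : GeneralPosition l :=
    (hperm.pairwise_iff fun {a b} h => ⟨h.1.symm, h.2.symm⟩).2 hQ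
  have hsort : l.Pairwise fun a b => a.x < b.x :=
    ((mergeSortT_sorted CPoint.x Q.length Q le_rfl).and hgp).imp fun h => lt_of_le_of_ne h.1 h.2.1
  set es := l.map fun p => (toEntryT p).val with hes
  have hespt : es.map Entry.pt = l := by
    simp [hes, toEntryT, Function.comp_def]
  have hlen : es.length ≤ Q.length := by rw [hes, List.length_map, hperm.length_eq]
  obtain ⟨h₁, h₂, h₃⟩ := conquerT_spec Q.length es hlen (by rwa [hespt])
    (List.pairwise_map.2 hsort) (by simp [hes, toEntryT])
  rw [hespt] at h₁ h₃
  have hval : (solveDirectlyT Q).val =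
      (((conquerT Q.length es).val.filter fun e => e.found).map Entry.pt) := by
    simp only [solveDirectlyT, Timed.val_bind, lengthT_val, mapT_val, flatMapT_val]
    rw [← hl, ← hes]
    generalize (conquerT Q.length es).val = m
    induction m with
    | nil => rfl
    | cons e m ih =>
      rw [List.flatMap_cons, ih]
      cases h : e.found <;> simp [reportEntryT, h]
  have hfin : l.toFinset = Q.toFinset := by ext p; simp [hperm.mem_iff]
  rw [hfin] at h₃
  rw [hval]
  refine ⟨(h₁.nodup_iff.2 hgp.nodup).sublist (List.filter_sublist.map _), fun p => ?_⟩
  rw [List.mem_map]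
  constructor
  · rintro ⟨e, he, rfl⟩
    rw [List.mem_filter] at he
    exact (h₃ e he.1).1 he.2
  · intro hp
    have hpl : p ∈ (conquerT Q.length es).val.map Entry.pt := by
      rw [h₁.mem_iff, hperm.mem_iff]
      exact List.mem_toFinset.1 hp.1
    obtain ⟨e, he, rfl⟩ := List.mem_map.1 hpl
    exact ⟨e, List.mem_filter.2 ⟨he, (h₃ e he).2 hp⟩, rfl⟩

theorem solveDirectlyT_time_le (Q : List (CPoint R)) :
    (solveDirectlyT Q).time ≤ 200 * (Q.length * (Nat.clog 2 Q.length + 1)) + 20 := by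
  have h₁ := mergeSortT_time_le CPoint.x Q.length Q
  have hl := (mergeSortT_perm CPoint.x Q.length Q).length_eq
  set l := (mergeSortT CPoint.x Q.length Q).val with hl_def
  have h₂ := conquerT_time_le Q.length (l.map fun p => (toEntryT p).val)
  have h₃ := conquerT_length Q.length (l.map fun p => (toEntryT p).val)
  rw [List.length_map, hl] at h₂ h₃
  have h₄ : ((conquerT Q.length (l.map fun p => (toEntryT p).val)).val.flatMap
      fun e => (reportEntryT e).val).length ≤ 1 * Q.length := by
    refine (length_flatMap_le _ _ 1 fun e _ => ?_).trans (by rw [h₃])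
    cases h : e.found <;> simp [reportEntryT, h]
  have h₅ : (l.map fun p => (toEntryT p).time).sum = Q.length := by
    rw [← hl]; simp [toEntryT]
  have h₆ : ((conquerT Q.length (l.map fun p => (toEntryT p).val)).val.map
      fun e => (reportEntryT e).time).sum = Q.length := by
    simp [reportEntryT, h₃]
  have h₇ : Q.length ≤ Q.length * (Nat.clog 2 Q.length + 1) := Nat.le_mul_of_pos_right _ (by omega)
  simp only [solveDirectlyT, Timed.time_bind, Timed.time_tick, lengthT_val, lengthT_time,
    mapT_val, mapT_time, flatMapT_time, ← hl_def, h₅, h₆]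
  omega

end Direct

/-! ### Value and cost of one iteration -/

section Iteration

variable {R : Type}

theorem pruneT_val (cells : List (List (CPoint R) × Box R)) (v : List (CPoint R) × Box R → Bool) :
    (pruneT cells (cells.map v)).val = (cells.filter fun c => !v c).flatMap Prod.fst := by
  induction cells with
  | nil => simp [pruneT]
  | cons c cells ih => cases h : v c <;> simp [pruneT, h, ih]

theorem pruneT_time_le (cells : List (List (CPoint R) × Box R)) (vs : List Bool) :
    (pruneT cells vs).time ≤ (cells.flatMap Prod.fst).length + 2 * cells.length + 1 := by
  induction cells generalizing vs with
  | nil => simp [pruneT]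
  | cons c cells ih =>
    rcases vs with _ | ⟨v, vs⟩
    · simp [pruneT]
    · have := ih vs
      cases v <;> simp [pruneT] at * <;> omega

theorem startTestT_val (T : Tester R) (Q : List (CPoint R)) (c : List (CPoint R) × Box R) :
    (startTestT T Q c).val = T Q c.2 := rfl

variable [LinearOrder R]

/-- The nonempty cells of the kd-tree of an iteration with their bounding boxes. -/
def boxedCells (d : ℕ) (Q : List (CPoint R)) : List (List (CPoint R) × Box R) :=
  (kdPartitionT true d Q).val.flatMap fun cell => (withBoxT cell).val

theorem mem_boxedCells {d : ℕ} {Q : List (CPoint R)} {b : List (CPoint R) × Box R} :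
    b ∈ boxedCells d Q ↔ ∃ p l, p :: l ∈ (kdPartitionT true d Q).val ∧
      b = (p :: l, (boundingBoxT p l).val) := by
  rw [boxedCells, List.mem_flatMap]
  constructor
  · rintro ⟨cell, hcell, hb⟩
    rcases cell with _ | ⟨p, l⟩
    · simp [withBoxT] at hb
    · exact ⟨p, l, hcell, by simpa [withBoxT] using hb⟩
  · rintro ⟨p, l, h, rfl⟩
    exact ⟨p :: l, h, by simp [withBoxT]⟩

theorem map_fst_boxedCells (d : ℕ) (Q : List (CPoint R)) :
    (boxedCells d Q).map Prod.fst =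
      (kdPartitionT true d Q).val.filter fun cell => !cell.isEmpty := by
  unfold boxedCells
  generalize (kdPartitionT true d Q).val = cells
  induction cells with
  | nil => rfl
  | cons cell cells ih =>
    rw [List.flatMap_cons, List.map_append, ih]
    rcases cell with _ | ⟨p, l⟩ <;> simp [withBoxT]

theorem length_boxedCells_le (d : ℕ) {Q : List (CPoint R)} (hQ : GeneralPosition Q) :
    (boxedCells d Q).length ≤ 2 ^ d := by
  have h := congrArg List.length (map_fst_boxedCells d Q)
  rw [List.length_map] at h
  rw [h, ← kdPartitionT_length true d hQ]
  exact List.length_filter_le _ _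

theorem flatMap_fst_boxedCells (d : ℕ) (Q : List (CPoint R)) :
    (boxedCells d Q).flatMap Prod.fst = (kdPartitionT true d Q).val.flatten := by
  unfold boxedCells
  generalize (kdPartitionT true d Q).val = cells
  induction cells with
  | nil => rfl
  | cons cell cells ih =>
    rw [List.flatMap_cons, List.flatMap_append, ih, List.flatten_cons]
    rcases cell with _ | ⟨p, l⟩ <;> simp [withBoxT]

theorem withBoxT_time_le (cell : List (CPoint R)) : (withBoxT cell).time ≤ 5 * cell.length + 2 := by
  rcases cell with _ | ⟨p, l⟩ <;> simp [withBoxT, boundingBoxT_time]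
  omega

/-- The verdict on a cell. -/
def verdict (T : Tester R) (Q : List (CPoint R)) (c : List (CPoint R) × Box R) : Bool :=
  (T Q c.2).value fun q => q.isEmptyOn Q

theorem iterationT_val (T : Tester R) (k j : ℕ) (Q : List (CPoint R))
    (hT : ∀ c ∈ boxedCells (2 ^ j) Q, (T Q c.2).queries (fun q => q.isEmptyOn Q) ≤ k) :
    (iterationT T k j Q).val =
      ((boxedCells (2 ^ j) Q).filter fun c => !verdict T Q c).flatMap Prod.fst := by
  simp only [iterationT, Timed.val_bind, flatMapT_val, mapT_val, startTestT_val]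
  rw [SafetyTest.runAllT_val, List.map_map, ← boxedCells]
  · exact pruneT_val _ (verdict T Q)
  · intro t ht
    obtain ⟨c, hc, rfl⟩ := List.mem_map.1 ht
    exact hT c hc

theorem clog_two_mul_two_pow_le (d : ℕ) : Nat.clog 2 (2 * 2 ^ d + 1) ≤ d + 2 := by
  refine Nat.clog_le_of_le_pow ?_
  have : 1 ≤ 2 ^ d := Nat.one_le_two_pow
  rw [pow_add]
  omega

/-- Both the kd-tree of depth `2 ^ j` and the binary searches among `O(2 ^ 2 ^ j)` positions cost
`O(2 ^ j)` per point. Everything else but the own steps of the tests is linear in `|Q|` or bounded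
by the cube of the number of cells. -/
theorem iterationT_time_le (T : Tester R) (k j : ℕ) {Q : List (CPoint R)}
    (hQ : GeneralPosition Q) :
    (iterationT T k j Q).time ≤ 10000 * (k + 1) * (Q.length * 2 ^ j + (2 ^ 2 ^ j) ^ 3) +
      ((boxedCells (2 ^ j) Q).map fun c => (T Q c.2).steps fun q => q.isEmptyOn Q).sum := by
  have hkd := kdPartitionT_time_le true (2 ^ j) hQ
  have hflat := flatMap_fst_boxedCells (2 ^ j) Q
  have hflen := (kdPartitionT_flatten_perm true (2 ^ j) hQ).length_eq
  have hlen := kdPartitionT_length true (2 ^ j) hQ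
  have hblen := length_boxedCells_le (2 ^ j) hQ
  have hbox := flatMapT_time withBoxT (kdPartitionT true (2 ^ j) Q).val
  have hboxs := sum_map_le_of_le (kdPartitionT true (2 ^ j) Q).val _ _
    fun cell _ => withBoxT_time_le cell
  rw [sum_map_add_const _ List.length, ← List.length_flatten, hflen, hlen] at hboxs
  rw [← boxedCells, hlen] at hbox
  have hrun := SafetyTest.runAllT_time_le Q k ((boxedCells (2 ^ j) Q).map fun c => T Q c.2)
    (2 ^ 2 ^ j) (by simpa using hblen)
  rw [List.map_map] at hrun
  have hprune := pruneT_time_le (boxedCells (2 ^ j) Q)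
    (SafetyTest.runAllT Q k ((boxedCells (2 ^ j) Q).map fun c => T Q c.2)).val
  rw [hflat, hflen] at hprune
  have hstart : ((boxedCells (2 ^ j) Q).map fun c => (startTestT T Q c).time).sum =
      (boxedCells (2 ^ j) Q).length := by simp [startTestT]
  simp only [iterationT, Timed.time_bind, Timed.time_tick, flatMapT_val, mapT_val, mapT_time,
    startTestT_val]
  rw [← boxedCells, hstart]
  have hclog := clog_two_mul_two_pow_le (2 ^ j)
  have h₄ : 4 ^ 2 ^ j ≤ (2 ^ 2 ^ j) ^ 3 := by
    rw [← pow_mul, show (4 : ℕ) = 2 ^ 2 by norm_num, ← pow_mul]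
    exact Nat.pow_le_pow_right (by norm_num) (by omega)
  have hd : 1 ≤ 2 ^ j := Nat.one_le_two_pow
  have hr : 1 ≤ 2 ^ 2 ^ j := Nat.one_le_two_pow
  generalize hr_def : 2 ^ 2 ^ j = r at *
  generalize 2 ^ j = d at *
  have hr₃ : r ≤ r ^ 3 := Nat.le_self_pow (by norm_num) _
  have hr₄ : (r + 1) ^ 3 ≤ 8 * r ^ 3 := by
    calc (r + 1) ^ 3 ≤ (2 * r) ^ 3 := Nat.pow_le_pow_left (by omega) 3
      _ = 8 * r ^ 3 := by ring
  have hq : Q.length ≤ Q.length * d := Nat.le_mul_of_pos_right _ hd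
  have hbatch : Q.length * (8 * Nat.clog 2 (2 * r + 1) + 4) + 1004 * (r + 1) ^ 3 ≤
      28 * (Q.length * d) + 8032 * r ^ 3 := by
    have : Q.length * (8 * Nat.clog 2 (2 * r + 1) + 4) ≤ Q.length * (28 * d) :=
      Nat.mul_le_mul_left _ (by omega)
    nlinarith
  have hbatch' := Nat.mul_le_mul_left (k + 1) hbatch
  have hsteps : (List.map ((SafetyTest.steps fun q => q.isEmptyOn Q) ∘ fun c => T Q c.2)
      (boxedCells d Q)).sum =
      ((boxedCells d Q).map fun c => (T Q c.2).steps fun q => q.isEmptyOn Q).sum := rfl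
  have hk : 10000 * (k + 1) * (Q.length * d + r ^ 3) =
      (k + 1) * (28 * (Q.length * d) + 8032 * r ^ 3) +
      (k + 1) * (9972 * (Q.length * d) + 1968 * r ^ 3) := by ring
  have hk' : 9972 * (Q.length * d) + 1968 * r ^ 3 ≤
      (k + 1) * (9972 * (Q.length * d) + 1968 * r ^ 3) := Nat.le_mul_of_pos_left _ (by omega)
  omega

end Iteration

/-! ### What an iteration removes -/

section Pruning

/-- The bounding box of a cell that meets `B` and does not straddle a side of `B` lies in `B`. -/
theorem Box.Contains.of_not_straddles {R : Type} [LinearOrder R] {B : Box R}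
    {cell : List (CPoint R)} {a : CPoint R} (ha : a ∈ cell) (haB : B.Contains a)
    (h₁ : ¬ Straddles (fun p => p.x < B.xmin) cell) (h₂ : ¬ Straddles (fun p => p.x ≤ B.xmax) cell)
    (h₃ : ¬ Straddles (fun p => p.y < B.ymin) cell)
    (h₄ : ¬ Straddles (fun p => p.y ≤ B.ymax) cell) :
    ∀ p ∈ cell, B.Contains p := by
  intro p hp
  obtain ⟨⟨b₁, b₂⟩, b₃, b₄⟩ := haB
  refine ⟨⟨?_, ?_⟩, ?_, ?_⟩ <;> by_contra h
  · exact h₁ ⟨⟨p, hp, not_le.1 h⟩, a, ha, not_lt.2 b₁⟩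
  · exact h₂ ⟨⟨a, ha, b₂⟩, p, hp, h⟩
  · exact h₃ ⟨⟨p, hp, not_le.1 h⟩, a, ha, not_lt.2 b₃⟩
  · exact h₄ ⟨⟨a, ha, b₄⟩, p, hp, h⟩

/-- The sides of the bounding box are attained by points of the list, so it is a subbox of any box
that contains them. -/
theorem Box.SafeColor.boundingBoxT {R : Type} [LinearOrder R] {S : Finset (CPoint R)} {B : Box R}
    {c : Color} (hB : B.SafeColor S c) {p : CPoint R} {l : List (CPoint R)}
    (h : ∀ q ∈ p :: l, B.Contains q) : (boundingBoxT p l).val.SafeColor S c := by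
  obtain ⟨⟨q₁, m₁, e₁⟩, ⟨q₂, m₂, e₂⟩, ⟨q₃, m₃, e₃⟩, ⟨q₄, m₄, e₄⟩⟩ := boundingBoxT_sides p l
  obtain ⟨⟨b₁, b₂⟩, b₃, b₄⟩ := boundingBoxT_contains p l p (by simp)
  refine hB.of_subbox (b₁.trans b₂) (b₃.trans b₄) ?_ ?_ ?_ ?_
  · rw [e₁]; exact (h q₁ m₁).1.1
  · rw [e₂]; exact (h q₂ m₂).1.2
  · rw [e₃]; exact (h q₃ m₃).2.1
  · rw [e₄]; exact (h q₄ m₄).2.2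

variable {T : Tester ℝ} {S Q : List (CPoint ℝ)} {α c : ℝ} {k : ℕ}

theorem boxedCells_mem {d : ℕ} (hQ : GeneralPosition Q) {b : List (CPoint ℝ) × Box ℝ}
    (hb : b ∈ boxedCells d Q) : (∃ p ∈ Q, b.2.Contains p) ∧ (∀ p ∈ b.1, b.2.Contains p) := by
  obtain ⟨p, l, hcell, rfl⟩ := mem_boxedCells.1 hb
  refine ⟨⟨p, ?_, boundingBoxT_contains p l p (by simp)⟩, boundingBoxT_contains p l⟩
  exact (kdPartitionT_flatten_perm true d hQ).mem_iff.1 (List.mem_flatten.2 ⟨_, hcell, by simp⟩)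

theorem Tester.Valid.iterationT_val (hT : T.Valid S α c k) (hQ : GeneralPosition Q)
    (hc : Conforms Q.toFinset S.toFinset) (j : ℕ) :
    (iterationT T k j Q).val =
      ((boxedCells (2 ^ j) Q).filter fun b => !verdict T Q b).flatMap Prod.fst :=
  RedBlue.iterationT_val T k j Q fun _ hb => (hT Q hQ.nodup hc _ (boxedCells_mem hQ hb).1).2.2

theorem Tester.Valid.verdict_iff (hT : T.Valid S α c k) (hQ : GeneralPosition Q)
    (hc : Conforms Q.toFinset S.toFinset) {d : ℕ} {b : List (CPoint ℝ) × Box ℝ}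
    (hb : b ∈ boxedCells d Q) : verdict T Q b = true ↔ b.2.Safe Q.toFinset :=
  (hT Q hQ.nodup hc _ (boxedCells_mem hQ hb).1).1

theorem Tester.Valid.iterationT_subperm (hT : T.Valid S α c k) (hQ : GeneralPosition Q)
    (hc : Conforms Q.toFinset S.toFinset) (j : ℕ) : (iterationT T k j Q).val.Subperm Q := by
  rw [hT.iterationT_val hQ hc j]
  have h₁ : (((boxedCells (2 ^ j) Q).filter fun b => !verdict T Q b).flatMap Prod.fst).Sublist
      ((boxedCells (2 ^ j) Q).flatMap Prod.fst) := by
    exact List.filter_sublist.flatMap _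
  rw [flatMap_fst_boxedCells] at h₁
  exact h₁.subperm.trans (kdPartitionT_flatten_perm true (2 ^ j) hQ).subperm

theorem Tester.Valid.iterationT_generalPosition (hT : T.Valid S α c k) (hQ : GeneralPosition Q)
    (hc : Conforms Q.toFinset S.toFinset) (j : ℕ) :
    GeneralPosition (iterationT T k j Q).val := by
  obtain ⟨l, hl, hs⟩ := hT.iterationT_subperm hQ hc j
  exact (hl.pairwise_iff fun {a b} h => ⟨h.1.symm, h.2.symm⟩).1 (List.Pairwise.sublist hs hQ)

/-- A pruned cell lies in a box that is safe for the current set, so only points without part in the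
current set are lost; transitivity carries this back to `S`. -/
theorem Tester.Valid.iterationT_conforms (hT : T.Valid S α c k) (hS : GeneralPosition S)
    (hQ : GeneralPosition Q) (hc : Conforms Q.toFinset S.toFinset) (j : ℕ) :
    Conforms (iterationT T k j Q).val.toFinset S.toFinset := by
  refine hc.trans hS.toFinset ⟨fun p hp => ?_, fun p hp => ?_⟩
  · rw [List.mem_toFinset] at hp ⊢
    exact (hT.iterationT_subperm hQ hc j).subset hp
  · have hpQ : p ∈ (boxedCells (2 ^ j) Q).flatMap Prod.fst := by
      rw [flatMap_fst_boxedCells, (kdPartitionT_flatten_perm true (2 ^ j) hQ).mem_iff]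
      exact List.mem_toFinset.1 hp.1
    obtain ⟨b, hb, hpb⟩ := List.mem_flatMap.1 hpQ
    rw [List.mem_toFinset, hT.iterationT_val hQ hc j, List.mem_flatMap]
    refine ⟨b, List.mem_filter.2 ⟨hb, ?_⟩, hpb⟩
    rw [Bool.not_eq_true', ← Bool.not_eq_true, hT.verdict_iff hQ hc hb]
    exact fun hsafe => hsafe.not_participates hQ.toFinset ((boxedCells_mem hQ hb).2 p hpb) hp

open Classical in
/-- A cell that is not pruned and meets a safe subset straddles a side of the enclosing box. -/
theorem Tester.Valid.countP_cell_le (hT : T.Valid S α c k) (hS : GeneralPosition S)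
    (hQ : GeneralPosition Q) (hc : Conforms Q.toFinset S.toFinset) {d : ℕ}
    {b : List (CPoint ℝ) × Box ℝ} (hb : b ∈ boxedCells d Q) (hv : verdict T Q b = false)
    {A : Finset (CPoint ℝ)} {B : Box ℝ} (hA : ∀ p ∈ A, B.Contains p) (hB : B.Safe S.toFinset)
    {M : ℕ} (hM : b.1.length ≤ M) :
    b.1.countP (fun p => decide (p ∈ A)) ≤
      M * ((if Straddles (fun p => p.x < B.xmin) b.1 then 1 else 0) +
        (if Straddles (fun p => p.x ≤ B.xmax) b.1 then 1 else 0) +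
        (if Straddles (fun p => p.y < B.ymin) b.1 then 1 else 0) +
        (if Straddles (fun p => p.y ≤ B.ymax) b.1 then 1 else 0)) := by
  by_cases hA' : ∃ a ∈ b.1, a ∈ A
  · obtain ⟨a, hab, haA⟩ := hA'
    by_cases hstr : Straddles (fun p => p.x < B.xmin) b.1 ∨ Straddles (fun p => p.x ≤ B.xmax) b.1 ∨
        Straddles (fun p => p.y < B.ymin) b.1 ∨ Straddles (fun p => p.y ≤ B.ymax) b.1
    · refine (List.countP_le_length.trans hM).trans (Nat.le_mul_of_pos_right _ ?_)
      rcases hstr with h | h | h | h <;> rw [if_pos h] <;> omega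
    · exfalso
      simp only [not_or] at hstr
      obtain ⟨s₁, s₂, s₃, s₄⟩ := hstr
      have hin := Box.Contains.of_not_straddles hab (hA a haA) s₁ s₂ s₃ s₄
      obtain ⟨p, l, -, rfl⟩ := mem_boxedCells.1 hb
      rw [← Bool.not_eq_true, hT.verdict_iff hQ hc hb] at hv
      -- The enclosing box is safe for `S`, while the test concerns `Q`: safety is first passed to
      -- the smaller box and then to the smaller point set.
      refine hv (hB.imp ?_ ?_) <;> intro h <;>
        exact (h.boundingBoxT hin).of_conforms hS.toFinset hc
  · rw [List.countP_eq_zero.2]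
    · exact Nat.zero_le _
    · intro a ha
      simpa using fun haA => hA' ⟨a, ha, haA⟩

theorem sum_map_ite_eq_countP {α : Type} (l : List α) (P : α → Prop) [DecidablePred P] :
    (l.map fun a => if P a then 1 else 0).sum = l.countP fun a => decide (P a) := by
  induction l with
  | nil => rfl
  | cons a l ih =>
    rw [List.map_cons, List.sum_cons, ih, List.countP_cons]
    by_cases h : P a <;> simp [h, add_comm]

open Classical in
/-- Few points of a safe subset survive an iteration. -/
theorem Tester.Valid.countP_iterationT_le (hT : T.Valid S α c k) (hS : GeneralPosition S)
    (hQ : GeneralPosition Q) (hc : Conforms Q.toFinset S.toFinset) (j : ℕ)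
    {A : Finset (CPoint ℝ)} (hA : SafeSubset S.toFinset A)
    {M : ℕ} (hM : ∀ cell ∈ (kdPartitionT true (2 ^ j) Q).val, cell.length ≤ M) :
    (iterationT T k j Q).val.countP (fun p => decide (p ∈ A)) ≤
      M * (4 * 2 ^ ((2 ^ j + 1) / 2)) := by
  obtain ⟨B, hAB, hB⟩ := hA
  let str : List (CPoint ℝ) → ℕ := fun cell =>
    (if Straddles (fun p => p.x < B.xmin) cell then 1 else 0) +
    (if Straddles (fun p => p.x ≤ B.xmax) cell then 1 else 0) +
    (if Straddles (fun p => p.y < B.ymin) cell then 1 else 0) +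
    (if Straddles (fun p => p.y ≤ B.ymax) cell then 1 else 0)
  set cells := (kdPartitionT true (2 ^ j) Q).val with hcells
  have hcut : ∀ (w : Bool) (P : CPoint ℝ → Prop), IsCut w P →
      (cells.map fun cell => if Straddles P cell then 1 else 0).sum ≤ 2 ^ ((2 ^ j + 1) / 2) := by
    intro w P hP
    rw [sum_map_ite_eq_countP]
    -- The exponent for the worse of the two directions of the first split is used for all four
    -- sides.
    refine (countP_straddles_le hP true (2 ^ j) hQ).trans (Nat.pow_le_pow_right (by norm_num) ?_)
    split <;> omega
  have h₁ := hcut true (fun p => p.x < B.xmin) fun p q (h : q.x ≤ p.x) h' => h.trans_lt h'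
  have h₂ := hcut true (fun p => p.x ≤ B.xmax) fun p q (h : q.x ≤ p.x) h' => h.trans h'
  have h₃ := hcut false (fun p => p.y < B.ymin) fun p q (h : q.y ≤ p.y) h' => h.trans_lt h'
  have h₄ := hcut false (fun p => p.y ≤ B.ymax) fun p q (h : q.y ≤ p.y) h' => h.trans h'
  calc (iterationT T k j Q).val.countP (fun p => decide (p ∈ A))
      = (((boxedCells (2 ^ j) Q).filter fun b => !verdict T Q b).map
          fun b => b.1.countP fun p => decide (p ∈ A)).sum := by
        rw [hT.iterationT_val hQ hc j, List.countP_flatMap]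
        rfl
    _ ≤ (((boxedCells (2 ^ j) Q).filter fun b => !verdict T Q b).map fun b => M * str b.1).sum := by
        refine sum_map_le_of_le _ _ _ fun b hb => ?_
        rw [List.mem_filter, Bool.not_eq_true'] at hb
        refine hT.countP_cell_le hS hQ hc hb.1 hb.2 hAB hB ?_
        obtain ⟨p, l, hcell, rfl⟩ := mem_boxedCells.1 hb.1
        exact hM _ hcell
    _ ≤ ((boxedCells (2 ^ j) Q).map fun b => M * str b.1).sum :=
        List.Sublist.sum_le_sum (List.filter_sublist.map _) (by simp)
    _ = ((cells.filter fun cell => !cell.isEmpty).map fun cell => M * str cell).sum := by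
        rw [hcells, ← map_fst_boxedCells, List.map_map]
        rfl
    _ ≤ (cells.map fun cell => M * str cell).sum :=
        List.Sublist.sum_le_sum (List.filter_sublist.map _) (by simp)
    _ = M * (cells.map str).sum := by rw [List.sum_map_mul_left]
    _ ≤ M * (4 * 2 ^ ((2 ^ j + 1) / 2)) := by
        refine Nat.mul_le_mul_left _ ?_
        simp only [str, List.sum_map_add]
        omega

theorem Tester.Valid.iterationT_time_le (hT : T.Valid S α c k)
    (hQ : GeneralPosition Q) (hc : Conforms Q.toFinset S.toFinset) (j : ℕ) :
    ((iterationT T k j Q).time : ℝ) ≤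
      10000 * (k + 1) * (Q.length * 2 ^ j + (2 ^ 2 ^ j) ^ 3) +
      2 ^ 2 ^ j * (|c| * (S.length : ℝ) ^ (1 - α)) := by
  have h := RedBlue.iterationT_time_le T k j hQ
  have hpow : (0 : ℝ) ≤ (S.length : ℝ) ^ (1 - α) := Real.rpow_nonneg (Nat.cast_nonneg _) _
  have hsteps : (((boxedCells (2 ^ j) Q).map fun b =>
      (T Q b.2).steps fun q => q.isEmptyOn Q).sum : ℝ) ≤
      (boxedCells (2 ^ j) Q).length * (|c| * (S.length : ℝ) ^ (1 - α)) := by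
    -- The absolute value keeps the bound nonnegative even if there are no cells or `c` is negative,
    -- so that the number of cells can be replaced by its upper bound.
    have hle : ∀ b ∈ boxedCells (2 ^ j) Q, ((T Q b.2).steps (fun q => q.isEmptyOn Q) : ℝ) ≤
        |c| * (S.length : ℝ) ^ (1 - α) := fun b hb =>
      (hT Q hQ.nodup hc _ (boxedCells_mem hQ hb).1).2.1.trans
        (mul_le_mul_of_nonneg_right (le_abs_self c) hpow)
    generalize boxedCells (2 ^ j) Q = cells at hle
    induction cells with
    | nil => simp
    | cons b cells ih =>
      have h₁ := hle b (by simp)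
      have h₂ := ih fun b' hb' => hle b' (by simp [hb'])
      push_cast [List.map_cons, List.sum_cons, List.length_cons] at h₂ ⊢
      linarith
  have hlen : ((boxedCells (2 ^ j) Q).length : ℝ) ≤ 2 ^ 2 ^ j := by
    exact_mod_cast length_boxedCells_le (2 ^ j) hQ
  have h' : ((iterationT T k j Q).time : ℝ) ≤
      10000 * (k + 1) * (Q.length * 2 ^ j + (2 ^ 2 ^ j) ^ 3) +
      (((boxedCells (2 ^ j) Q).map fun b => (T Q b.2).steps fun q => q.isEmptyOn Q).sum : ℕ) := by
    exact_mod_cast h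
  refine h'.trans (add_le_add le_rfl (hsteps.trans ?_))
  exact mul_le_mul_of_nonneg_right hlen (mul_nonneg (abs_nonneg c) hpow)

end Pruning

/-! ### The sum behind the entropy bound -/

section Sums

/-- A geometric sum is less than twice its last term, and the last term counted is at most `y`. -/
theorem sum_two_pow_le (m : ℕ) {y : ℝ} (hy : 0 ≤ y) :
    ∑ i ∈ Finset.range m, (if (2 : ℝ) ^ i ≤ y then (2 : ℝ) ^ i else 0) ≤ 2 * y := by
  induction m with
  | zero => simpa using hy
  | succ m ih =>
    by_cases h : (2 : ℝ) ^ m ≤ y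
    · calc ∑ i ∈ Finset.range (m + 1), (if (2 : ℝ) ^ i ≤ y then (2 : ℝ) ^ i else 0)
          ≤ ∑ i ∈ Finset.range (m + 1), (2 : ℝ) ^ i :=
            Finset.sum_le_sum fun i _ => by split_ifs; exacts [le_rfl, by positivity]
        _ = 2 ^ (m + 1) - 1 := by
            rw [geom_sum_eq (by norm_num)]
            norm_num
        _ ≤ 2 * y := by rw [pow_succ]; linarith
    · rw [Finset.sum_range_succ, if_neg h, add_zero]
      exact ih

/-- From `exp x ≥ 1 + x + x ^ 2 / 2` at `x = (log 2 / 2) u ≥ 0.345 u`; the constant is `2 / 0.345 ^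
2 < 17`. -/
theorem sq_le_mul_two_rpow_half {u : ℝ} (hu : 0 ≤ u) : u ^ 2 ≤ 17 * (2 : ℝ) ^ (u / 2) := by
  have hlog : (0.69 : ℝ) ≤ Real.log 2 := by linarith [Real.log_two_gt_d9]
  rw [Real.rpow_def_of_pos (by norm_num)]
  have hx : 0.345 * u ≤ Real.log 2 * (u / 2) := by nlinarith
  have h := Real.quadratic_le_exp_of_nonneg (x := Real.log 2 * (u / 2)) (by positivity)
  have hsq : (0.345 * u) ^ 2 ≤ (Real.log 2 * (u / 2)) ^ 2 :=
    pow_le_pow_left₀ (by positivity) hx 2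
  have hnn : 0 ≤ Real.log 2 * (u / 2) := by positivity
  nlinarith

/-- The doubly exponential decay turns the geometric sum into a logarithm. -/
theorem sum_two_pow_mul_min_le (m : ℕ) {s n : ℝ} (hs : 0 < s) (hsn : s ≤ n) :
    ∑ i ∈ Finset.range m, (2 : ℝ) ^ i * min s (8 * n / 2 ^ 2 ^ i) ≤
      s * (4 * Real.logb 2 (n / s) + 46) := by
  have hn : 0 < n := hs.trans_le hsn
  set L := Real.logb 2 (n / s) with hL
  have hL₀ : 0 ≤ L := Real.logb_nonneg (by norm_num) ((one_le_div hs).2 hsn)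
  have hns : n / s = (2 : ℝ) ^ L :=
    (Real.rpow_logb (by norm_num) (by norm_num) (by positivity)).symm
  have hterm : ∀ i : ℕ, (2 : ℝ) ^ i * min s (8 * n / 2 ^ 2 ^ i) ≤
      s * ((if (2 : ℝ) ^ i ≤ 2 * (L + 3) then (2 : ℝ) ^ i else 0) + 17 * (1 / 2) ^ i) := by
    intro i
    have hi : (0 : ℝ) < 2 ^ i := by positivity
    -- Up to this threshold the bound `s` is used. Beyond it, with `u = 2 ^ i`, one has `8 n = s * 2
    -- ^ (L + 3) ≤ s * 2 ^ (u / 2)`, so the term is at most `s * u / 2 ^ (u / 2) ≤ 17 s / u`, a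
    -- geometric sequence in `i`. The two ranges contribute `4 (L + 3)` and 34, in units of `s`.
    by_cases h : (2 : ℝ) ^ i ≤ 2 * (L + 3)
    · rw [if_pos h]
      calc (2 : ℝ) ^ i * min s (8 * n / 2 ^ 2 ^ i) ≤ 2 ^ i * s :=
            mul_le_mul_of_nonneg_left (min_le_left _ _) hi.le
        _ = s * (2 ^ i + 0) := by ring
        _ ≤ s * (2 ^ i + 17 * (1 / 2) ^ i) := by gcongr; positivity
    · rw [if_neg h, zero_add]
      push Not at h
      set u : ℝ := 2 ^ i with hu
      have hpow : (2 : ℝ) ^ 2 ^ i = (2 : ℝ) ^ u := by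
        rw [hu, ← Real.rpow_natCast 2 (2 ^ i)]
        push_cast
        rfl
      have h8 : 8 * n = s * (2 : ℝ) ^ (L + 3) := by
        rw [Real.rpow_add (by norm_num), ← hns]
        have : (2 : ℝ) ^ (3 : ℝ) = 8 := by norm_num
        rw [this]
        field_simp
      have hle : (2 : ℝ) ^ (L + 3) ≤ (2 : ℝ) ^ (u / 2) :=
        Real.rpow_le_rpow_of_exponent_le (by norm_num) (by linarith)
      have hsq := sq_le_mul_two_rpow_half hi.le
      have hhalf : (2 : ℝ) ^ u = (2 : ℝ) ^ (u / 2) * (2 : ℝ) ^ (u / 2) := by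
        rw [← Real.rpow_add (by norm_num)]; ring_nf
      have hv : (0 : ℝ) < (2 : ℝ) ^ (u / 2) := by positivity
      have hinv : (1 / 2 : ℝ) ^ i = 1 / u := by rw [hu, div_pow, one_pow]
      rw [hinv]
      calc u * min s (8 * n / 2 ^ 2 ^ i) ≤ u * (8 * n / 2 ^ 2 ^ i) :=
            mul_le_mul_of_nonneg_left (min_le_right _ _) hi.le
        _ = u * (s * (2 : ℝ) ^ (L + 3) / ((2 : ℝ) ^ (u / 2) * (2 : ℝ) ^ (u / 2))) := by
            rw [hpow, h8, hhalf]
        _ ≤ u * (s * (2 : ℝ) ^ (u / 2) / ((2 : ℝ) ^ (u / 2) * (2 : ℝ) ^ (u / 2))) := by gcongr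
        _ = s * (u / (2 : ℝ) ^ (u / 2)) := by field_simp
        _ ≤ s * (17 * (1 / u)) := by
            gcongr
            rw [div_le_iff₀ hv, mul_one_div, div_mul_eq_mul_div, le_div_iff₀ hi]
            nlinarith
  calc ∑ i ∈ Finset.range m, (2 : ℝ) ^ i * min s (8 * n / 2 ^ 2 ^ i)
      ≤ ∑ i ∈ Finset.range m,
        s * ((if (2 : ℝ) ^ i ≤ 2 * (L + 3) then (2 : ℝ) ^ i else 0) + 17 * (1 / 2) ^ i) :=
        Finset.sum_le_sum fun i _ => hterm i
    _ = s * (∑ i ∈ Finset.range m, (if (2 : ℝ) ^ i ≤ 2 * (L + 3) then (2 : ℝ) ^ i else 0) +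
          17 * ∑ i ∈ Finset.range m, (1 / 2 : ℝ) ^ i) := by
        rw [← Finset.mul_sum, Finset.sum_add_distrib, ← Finset.mul_sum]
    _ ≤ s * (2 * (2 * (L + 3)) + 17 * 2) := by
        gcongr
        · exact sum_two_pow_le m (by positivity)
        · exact sum_geometric_two_le m
    _ = s * (4 * L + 46) := by ring

end Sums

/-! ### Entropy of partitions and counting by parts -/

section Entropy

variable {R : Type} [LinearOrder R]

theorem partitionEntropy_nonneg {S : Finset (CPoint R)} (P : Finpartition S) :
    0 ≤ partitionEntropy P := by
  refine Finset.sum_nonneg fun A hA => mul_nonneg (by positivity) ?_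
  have hA₀ : (0 : ℝ) < A.card := by
    exact_mod_cast Finset.card_pos.2 (Finset.nonempty_iff_ne_empty.2 (P.ne_bot hA))
  exact Real.logb_nonneg (by norm_num)
    ((one_le_div hA₀).2 (by exact_mod_cast Finset.card_le_card (P.le hA)))

theorem structuralEntropy_nonneg (S : Finset (CPoint R)) : 0 ≤ structuralEntropy S := by
  obtain ⟨P, -, h⟩ := (structuralEntropy_isLeast S).1
  rw [h]
  exact partitionEntropy_nonneg P

theorem card_mul_partitionEntropy {S : Finset (CPoint R)} (P : Finpartition S)
    (hS : S.Nonempty) : (S.card : ℝ) * partitionEntropy P =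
      ∑ A ∈ P.parts, (A.card : ℝ) * Real.logb 2 ((S.card : ℝ) / A.card) := by
  have : (S.card : ℝ) ≠ 0 := by exact_mod_cast (Finset.card_pos.2 hS).ne'
  rw [partitionEntropy, Finset.mul_sum]
  refine Finset.sum_congr rfl fun A _ => ?_
  field_simp

theorem length_le_sum_countP {α : Type} [DecidableEq α] (Q : List α) (parts : Finset (Finset α))
    (h : ∀ p ∈ Q, ∃ A ∈ parts, p ∈ A) :
    Q.length ≤ ∑ A ∈ parts, Q.countP fun p => decide (p ∈ A) := by
  induction Q with
  | nil => simp
  | cons p Q ih =>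
    obtain ⟨A, hA, hp⟩ := h p (by simp)
    have h₁ : 1 ≤ ∑ A ∈ parts, if p ∈ A then 1 else 0 :=
      (by simp [hp] : 1 ≤ if p ∈ A then 1 else 0).trans
        (Finset.single_le_sum (f := fun A => if p ∈ A then 1 else 0) (fun _ _ => Nat.zero_le _) hA)
    have h₂ := ih fun q hq => h q (by simp [hq])
    simp only [List.countP_cons, Finset.sum_add_distrib, List.length_cons, decide_eq_true_eq]
    omega

theorem countP_mem_le_card {α : Type} [DecidableEq α] {Q : List α} (hQ : Q.Nodup) (A : Finset α) :
    (Q.countP fun p => decide (p ∈ A)) ≤ A.card := by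
  rw [List.countP_eq_length_filter, ← List.toFinset_card_of_nodup (hQ.filter _)]
  refine Finset.card_le_card fun p hp => ?_
  simpa using (List.mem_filter.1 (List.mem_toFinset.1 hp)).2

end Entropy

/-! ### The remaining points, round by round -/

section Rounds

/-- The points that are left before iteration `j`. -/
noncomputable def remaining (T : Tester ℝ) (k : ℕ) (S : List (CPoint ℝ)) : ℕ → List (CPoint ℝ)
  | 0 => S
  | j + 1 => (iterationT T k j (remaining T k S j)).val

variable {T : Tester ℝ} {S : List (CPoint ℝ)} {α c : ℝ} {k : ℕ}

theorem iterateT_val (T : Tester ℝ) (k : ℕ) (S : List (CPoint ℝ)) (count j : ℕ) :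
    (iterateT T k count j (remaining T k S j)).val = remaining T k S (j + count) := by
  induction count generalizing j with
  | zero => rfl
  | succ count ih =>
    have := ih (j + 1)
    rw [show j + 1 + count = j + (count + 1) by omega] at this
    exact this

theorem iterateT_time (T : Tester ℝ) (k : ℕ) (S : List (CPoint ℝ)) (count j : ℕ) :
    (iterateT T k count j (remaining T k S j)).time =
      ∑ i ∈ Finset.range count, ((iterationT T k (j + i) (remaining T k S (j + i))).time + 1) +
        1 := by
  induction count generalizing j with
  | zero => rfl
  | succ count ih =>
    have h := ih (j + 1)
    rw [Finset.sum_range_succ']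
    simp only [iterateT, Timed.time_bind, Timed.time_tick]
    rw [show (iterationT T k j (remaining T k S j)).val = remaining T k S (j + 1) from rfl, h]
    simp only [add_zero, show ∀ i, j + 1 + i = j + (i + 1) from fun i => by omega]
    omega

theorem Tester.Valid.remaining (hT : T.Valid S α c k) (hS : GeneralPosition S) (j : ℕ) :
    GeneralPosition (remaining T k S j) ∧ Conforms (remaining T k S j).toFinset S.toFinset ∧
      (RedBlue.remaining T k S j).length ≤ S.length := by
  induction j with
  | zero => exact ⟨hS, Conforms.refl _, le_rfl⟩
  | succ j ih =>
    obtain ⟨h₁, h₂, h₃⟩ := ih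
    exact ⟨hT.iterationT_generalPosition h₁ h₂ j, hT.iterationT_conforms hS h₁ h₂ j,
      (hT.iterationT_subperm h₁ h₂ j).length_le.trans h₃⟩

open Classical in
-- Put `w = 2 ^ 2 ^ i`. Iteration `i + 1` has `w ^ 2` cells of at most `n / w ^ 2 + 1 ≤ 2 n / w ^ 2`
-- points, and at most `4 w` of them straddle a side of the enclosing box. For singletons, `w ^ 2 ≤
-- n` alone makes the bound at least 1.
theorem Tester.Valid.countP_remaining_le (hT : T.Valid S α c k) (hS : GeneralPosition S)
    {A : Finset (CPoint ℝ)} (hA : A.card = 1 ∨ SafeSubset S.toFinset A) {i : ℕ}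
    (hi : 2 ^ 2 ^ (i + 1) ≤ S.length) :
    (((RedBlue.remaining T k S (i + 2)).countP fun p => decide (p ∈ A) : ℕ) : ℝ) ≤
      min (A.card : ℝ) (8 * S.length / 2 ^ 2 ^ i) := by
  have hcard := countP_mem_le_card (hT.remaining hS (i + 2)).1.nodup A
  refine le_min (by exact_mod_cast hcard) ?_
  have hw : (0 : ℝ) < 2 ^ 2 ^ i := by positivity
  have hsq : (2 : ℕ) ^ 2 ^ (i + 1) = 2 ^ 2 ^ i * 2 ^ 2 ^ i := by rw [← pow_add]; ring_nf
  have hsq' : (2 : ℝ) ^ 2 ^ (i + 1) = 2 ^ 2 ^ i * 2 ^ 2 ^ i := by exact_mod_cast hsq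
  have hi' : (2 : ℝ) ^ 2 ^ i * 2 ^ 2 ^ i ≤ S.length := by rw [← hsq']; exact_mod_cast hi
  rcases hA with hA | hA
  · rw [hA] at hcard
    rw [le_div_iff₀ hw]
    have h₁ : (((RedBlue.remaining T k S (i + 2)).countP fun p => decide (p ∈ A) : ℕ) : ℝ) ≤ 1 := by
      exact_mod_cast hcard
    have h₂ : (1 : ℝ) ≤ 2 ^ 2 ^ i := one_le_pow₀ (by norm_num)
    nlinarith
  · obtain ⟨h₁, h₂, h₃⟩ := hT.remaining hS (i + 1)
    have hM : ∀ cell ∈ (kdPartitionT true (2 ^ (i + 1)) (RedBlue.remaining T k S (i + 1))).val,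
        cell.length ≤ S.length / 2 ^ 2 ^ (i + 1) + 1 := by
      intro cell hcell
      have h := kdPartitionT_cell_length_le true (2 ^ (i + 1)) h₁ cell hcell
      have hpos : 0 < 2 ^ 2 ^ (i + 1) := Nat.two_pow_pos _
      rw [← Nat.add_div_right _ hpos, Nat.le_div_iff_mul_le hpos, mul_comm]
      omega
    have h := hT.countP_iterationT_le hS h₁ h₂ (i + 1) hA hM
    -- The rounding is lost because `2 ^ (i + 1)` is even.
    have hexp : (2 ^ (i + 1) + 1) / 2 = 2 ^ i := by rw [pow_succ]; omega
    rw [hexp] at h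
    have h' : (((RedBlue.remaining T k S (i + 2)).countP fun p => decide (p ∈ A) : ℕ) : ℝ) ≤
        ((S.length / 2 ^ 2 ^ (i + 1) : ℕ) + 1) * (4 * 2 ^ 2 ^ i) := by exact_mod_cast h
    have hdiv : ((S.length / 2 ^ 2 ^ (i + 1) : ℕ) : ℝ) ≤ S.length / (2 ^ 2 ^ i * 2 ^ 2 ^ i) := by
      rw [← hsq']
      exact_mod_cast (Nat.cast_div_le (m := S.length) (n := 2 ^ 2 ^ (i + 1)) (α := ℝ))
    have hone : (1 : ℝ) ≤ S.length / (2 ^ 2 ^ i * 2 ^ 2 ^ i) := by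
      rwa [one_le_div (by positivity)]
    calc _ ≤ ((S.length / 2 ^ 2 ^ (i + 1) : ℕ) + 1) * (4 * (2 : ℝ) ^ 2 ^ i) := h'
      _ ≤ (S.length / (2 ^ 2 ^ i * 2 ^ 2 ^ i) + S.length / (2 ^ 2 ^ i * 2 ^ 2 ^ i)) *
          (4 * (2 : ℝ) ^ 2 ^ i) := by gcongr
      _ = 8 * S.length / 2 ^ 2 ^ i := by field_simp; ring

open Classical in
/-- The total size of the remaining point sets, weighted by the depths of the kd-trees. -/
theorem Tester.Valid.sum_remaining_le (hT : T.Valid S α c k) (hS : GeneralPosition S)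
    (hne : S ≠ []) {count : ℕ} (hcount : ∀ j < count, 2 ^ 2 ^ j ≤ S.length) :
    ∑ j ∈ Finset.range (count + 1), ((RedBlue.remaining T k S j).length : ℝ) * 2 ^ j ≤
      187 * (S.length * (structuralEntropy S.toFinset + 1)) := by
  obtain ⟨P, hP, hH⟩ := (structuralEntropy_isLeast S.toFinset).1
  have hcard : S.toFinset.card = S.length := List.toFinset_card_of_nodup hS.nodup
  have hSne : S.toFinset.Nonempty := by
    rw [List.toFinset_nonempty_iff]; exact hne
  have hent := card_mul_partitionEntropy P hSne
  rw [hcard, ← hH] at hent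
  have hH₀ := structuralEntropy_nonneg S.toFinset
  have hn : (0 : ℝ) ≤ S.length := Nat.cast_nonneg _
  have hsum : ∑ A ∈ P.parts, (A.card : ℝ) = S.length := by
    rw [← hcard]; exact_mod_cast P.sum_card_parts
  -- The decay is available from index 2 on. Exchanging the two sums lets each part of an optimal
  -- partition pay its share of the entropy.
  have hlate : ∀ m : ℕ, m + 1 ≤ count →
      ∑ i ∈ Finset.range m, ((RedBlue.remaining T k S (i + 2)).length : ℝ) * 2 ^ i ≤
        4 * (S.length * structuralEntropy S.toFinset) + 46 * S.length := by
    intro m hm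
    calc ∑ i ∈ Finset.range m, ((RedBlue.remaining T k S (i + 2)).length : ℝ) * 2 ^ i
        ≤ ∑ i ∈ Finset.range m, ∑ A ∈ P.parts,
            (2 : ℝ) ^ i * min (A.card : ℝ) (8 * S.length / 2 ^ 2 ^ i) := by
          refine Finset.sum_le_sum fun i hi => ?_
          have hi' := Finset.mem_range.1 hi
          have h₁ := length_le_sum_countP (RedBlue.remaining T k S (i + 2)) P.parts fun p hp => by
            have hpS := (hT.remaining hS (i + 2)).2.1.1 (List.mem_toFinset.2 hp)
            exact ⟨P.part p, P.part_mem.2 hpS, P.mem_part hpS⟩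
          have h₁' : ((RedBlue.remaining T k S (i + 2)).length : ℝ) ≤ ∑ A ∈ P.parts,
              (((RedBlue.remaining T k S (i + 2)).countP fun p => decide (p ∈ A) : ℕ) : ℝ) := by
            exact_mod_cast h₁
          rw [← Finset.mul_sum, mul_comm]
          refine mul_le_mul_of_nonneg_left (h₁'.trans (Finset.sum_le_sum fun A hA => ?_))
            (by positivity)
          exact hT.countP_remaining_le hS (hP A hA) (hcount (i + 1) (by omega))
      _ = ∑ A ∈ P.parts, ∑ i ∈ Finset.range m,
            (2 : ℝ) ^ i * min (A.card : ℝ) (8 * S.length / 2 ^ 2 ^ i) := Finset.sum_comm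
      _ ≤ ∑ A ∈ P.parts, (A.card : ℝ) * (4 * Real.logb 2 (S.length / A.card) + 46) := by
          refine Finset.sum_le_sum fun A hA => sum_two_pow_mul_min_le m ?_ ?_
          · exact_mod_cast Finset.card_pos.2 (Finset.nonempty_iff_ne_empty.2 (P.ne_bot hA))
          · rw [← hcard]
            exact_mod_cast Finset.card_le_card (P.le hA)
      _ = 4 * (S.length * structuralEntropy S.toFinset) + 46 * S.length := by
          rw [hent, ← hsum, Finset.mul_sum, Finset.mul_sum, ← Finset.sum_add_distrib]
          exact Finset.sum_congr rfl fun A _ => by rw [hsum]; ring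
  have hlen : ∀ j, ((RedBlue.remaining T k S j).length : ℝ) ≤ S.length := fun j => by
    exact_mod_cast (hT.remaining hS j).2.2
  have h0 := hlen 0
  have h1 := hlen 1
  -- Indices 0 and 1 cost at most `n + 2 n`. The shift by 2 multiplies the remaining sum by 4,
  -- whence `187 = 4 * 46 + 3`. The last index, `count`, stands for the direct algorithm.
  rcases count with _ | _ | m
  · simp only [zero_add, Finset.sum_range_one, pow_zero, mul_one]
    nlinarith
  · simp only [Finset.sum_range_succ, Finset.sum_range_zero, pow_zero, mul_one, zero_add, pow_one]
    nlinarith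
  · rw [Finset.sum_range_succ', Finset.sum_range_succ']
    have h := hlate (m + 1) le_rfl
    have he : ∑ i ∈ Finset.range (m + 1),
        ((RedBlue.remaining T k S (i + 1 + 1)).length : ℝ) * 2 ^ (i + 1 + 1) =
        4 * ∑ i ∈ Finset.range (m + 1), ((RedBlue.remaining T k S (i + 2)).length : ℝ) * 2 ^ i := by
      rw [Finset.mul_sum]
      exact Finset.sum_congr rfl fun i _ => by rw [pow_add, pow_add]; ring
    rw [he]
    simp only [zero_add, pow_one, pow_zero, mul_one]
    nlinarith

end Rounds

/-! ### The number of iterations -/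

section IterationCount

theorem two_pow_le_of_lt_iterationCount {δ : ℝ} {n j : ℕ} (h : j < iterationCount δ n) :
    (2 : ℝ) ^ j ≤ δ * Real.logb 2 n := by
  unfold iterationCount at h
  split_ifs at h with h₁
  · omega
  · push Not at h₁
    have h₂ : j ≤ ⌊Real.logb 2 (δ * Real.logb 2 n)⌋₊ := by omega
    have h₃ := (Nat.le_floor_iff (Real.logb_nonneg (by norm_num) h₁)).1 h₂
    rw [Real.le_logb_iff_rpow_le (by norm_num) (by linarith), Real.rpow_natCast] at h₃
    exact h₃

/-- The iterations stop late enough for `log n` to be at most `2 ^ N / δ`, also when none is carried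
out; this is what makes the direct algorithm affordable. -/
theorem lt_two_pow_iterationCount (δ : ℝ) (n : ℕ) :
    δ * Real.logb 2 n < (2 : ℝ) ^ iterationCount δ n := by
  unfold iterationCount
  split_ifs with h₁
  · simpa using h₁
  · push Not at h₁
    have h₂ := Nat.lt_floor_add_one (Real.logb 2 (δ * Real.logb 2 n))
    rw [Real.logb_lt_iff_lt_rpow (by norm_num) (by linarith)] at h₂
    exact_mod_cast h₂

theorem two_pow_two_pow_le_rpow {δ : ℝ} {n j : ℕ} (hn : 0 < n) (h : j < iterationCount δ n) :
    (2 : ℝ) ^ 2 ^ j ≤ (n : ℝ) ^ δ := by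
  have h₁ := two_pow_le_of_lt_iterationCount h
  have hn' : (0 : ℝ) < n := by exact_mod_cast hn
  calc (2 : ℝ) ^ 2 ^ j = (2 : ℝ) ^ ((2 : ℝ) ^ j) := by
        rw [← Real.rpow_natCast 2 (2 ^ j)]; push_cast; rfl
    _ ≤ (2 : ℝ) ^ (δ * Real.logb 2 n) := Real.rpow_le_rpow_of_exponent_le (by norm_num) h₁
    _ = (n : ℝ) ^ δ := by
        rw [mul_comm, Real.rpow_mul (by norm_num), Real.rpow_logb (by norm_num) (by norm_num) hn']

/-- A crude bound, obtained by comparing the count with the number of cells in the last iteration;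
it only has to multiply lower-order costs. -/
theorem iterationCount_le_rpow {δ : ℝ} {n : ℕ} (hn : 0 < n) :
    (iterationCount δ n : ℝ) ≤ (n : ℝ) ^ δ := by
  rcases h : iterationCount δ n with _ | m
  · simpa using Real.rpow_nonneg (Nat.cast_nonneg n) δ
  · refine le_trans ?_ (two_pow_two_pow_le_rpow (j := m) hn (by omega))
    have h₁ : m + 1 ≤ 2 ^ m := Nat.lt_two_pow_self
    have h₂ : 2 ^ m ≤ 2 ^ 2 ^ m := Nat.lt_two_pow_self.le
    exact_mod_cast h₁.trans h₂

theorem clog_two_le (n : ℕ) : (Nat.clog 2 n : ℝ) ≤ Real.logb 2 n + 1 := by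
  rcases Nat.lt_or_ge n 2 with h | h
  · interval_cases n <;> simp
  · have h₁ := Nat.pow_pred_clog_lt_self (b := 2) (by norm_num) (x := n) h
    have h₂ : (2 : ℝ) ^ ((Nat.clog 2 n).pred : ℝ) ≤ n := by
      rw [Real.rpow_natCast]; exact_mod_cast h₁.le
    have h₃ := (Real.le_logb_iff_rpow_le (by norm_num) (by positivity)).2 h₂
    have h₄ : 0 < Nat.clog 2 n := Nat.clog_pos (by norm_num) h
    have h₅ : (Nat.clog 2 n : ℝ) = (Nat.clog 2 n).pred + 1 := by
      exact_mod_cast (Nat.succ_pred_eq_of_pos h₄).symm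
    linarith

end IterationCount

/-! ### Total cost of the iterations and of the direct algorithm -/

section Main

variable {T : Tester ℝ} {S : List (CPoint ℝ)} {α c δ : ℝ} {k : ℕ}

theorem reportParticipatingT_val (δ : ℝ) (T : Tester ℝ) (k : ℕ) (S : List (CPoint ℝ)) :
    (reportParticipatingT δ T k S).val =
      (solveDirectlyT (remaining T k S (iterationCount δ S.length))).val := by
  have := iterateT_val T k S (iterationCount δ S.length) 0
  rw [zero_add] at this
  simp only [reportParticipatingT, Timed.val_bind, lengthT_val]
  rw [← this]
  rfl

theorem reportParticipatingT_time (δ : ℝ) (T : Tester ℝ) (k : ℕ) (S : List (CPoint ℝ)) :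
    (reportParticipatingT δ T k S).time = S.length + 3 +
      ∑ j ∈ Finset.range (iterationCount δ S.length),
        ((iterationT T k j (remaining T k S j)).time + 1) +
      (solveDirectlyT (remaining T k S (iterationCount δ S.length))).time := by
  have h₁ := iterateT_val T k S (iterationCount δ S.length) 0
  have h₂ := iterateT_time T k S (iterationCount δ S.length) 0
  simp only [zero_add] at h₁ h₂
  simp only [reportParticipatingT, Timed.time_bind, Timed.time_tick, lengthT_val, lengthT_time]
  rw [← h₁]
  change _ + (_ + ((iterateT T k (iterationCount δ S.length) 0 (remaining T k S 0)).time + _)) = _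
  rw [h₂]
  change _ + (_ + (_ + (solveDirectlyT
    (iterateT T k (iterationCount δ S.length) 0 (remaining T k S 0)).val).time)) = _
  omega

/-- There are at most `n ^ δ` iterations with at most `n ^ δ` cells each. The cubic overhead totals
`n ^ (4 δ)`, which needs `δ ≤ 1 / 4`; the own steps of the tests total `|c| n ^ (2 δ + 1 - α)`,
which needs `δ ≤ α / 2`. -/
theorem Tester.Valid.sum_iterationT_time_le (hT : T.Valid S α c k) (hS : GeneralPosition S)
    (hne : S ≠ []) (hδ : 0 < δ) (hδ₁ : δ ≤ 1 / 4) (hδ₂ : δ ≤ α / 2) :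
    ∑ j ∈ Finset.range (iterationCount δ S.length),
        (((iterationT T k j (RedBlue.remaining T k S j)).time : ℝ) + 1) ≤
      10000 * (k + 1) * (∑ j ∈ Finset.range (iterationCount δ S.length),
        ((RedBlue.remaining T k S j).length : ℝ) * 2 ^ j) +
      (10000 * (k + 1) + |c| + 1) * S.length := by
  have hnpos : 0 < S.length := List.length_pos_iff.2 hne
  have hn : (1 : ℝ) ≤ S.length := by exact_mod_cast hnpos
  have hn₀ : (0 : ℝ) < S.length := by linarith
  set n : ℝ := (S.length : ℝ) with hn_def
  set N := iterationCount δ S.length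
  have hN : (N : ℝ) ≤ n ^ δ := iterationCount_le_rpow hnpos
  have hNn : (N : ℝ) ≤ n := hN.trans
    ((Real.rpow_le_rpow_of_exponent_le hn (by linarith : δ ≤ 1)).trans (by rw [Real.rpow_one]))
  have hpos : 0 ≤ n ^ δ := Real.rpow_nonneg hn₀.le _
  have hpos' : 0 ≤ n ^ (1 - α) := Real.rpow_nonneg hn₀.le _
  have hterm : ∀ j ∈ Finset.range N,
      ((iterationT T k j (RedBlue.remaining T k S j)).time : ℝ) + 1 ≤
      10000 * (k + 1) * (((RedBlue.remaining T k S j).length : ℝ) * 2 ^ j) +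
      (10000 * (k + 1) * (n ^ δ) ^ 3 + n ^ δ * (|c| * n ^ (1 - α)) + 1) := by
    intro j hj
    obtain ⟨h₁, h₂, -⟩ := hT.remaining hS j
    have h := hT.iterationT_time_le h₁ h₂ j
    have hr := two_pow_two_pow_le_rpow hnpos (Finset.mem_range.1 hj)
    have hr₃ : ((2 : ℝ) ^ 2 ^ j) ^ 3 ≤ (n ^ δ) ^ 3 := pow_le_pow_left₀ (by positivity) hr 3
    have h₃ : (10000 * ((k : ℝ) + 1)) * ((2 : ℝ) ^ 2 ^ j) ^ 3 ≤ 10000 * (k + 1) * (n ^ δ) ^ 3 :=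
      mul_le_mul_of_nonneg_left hr₃ (by positivity)
    have h₄ : (2 : ℝ) ^ 2 ^ j * (|c| * n ^ (1 - α)) ≤ n ^ δ * (|c| * n ^ (1 - α)) :=
      mul_le_mul_of_nonneg_right hr (mul_nonneg (abs_nonneg c) hpos')
    rw [mul_add] at h
    linarith
  have hpow₁ : n ^ δ * (n ^ δ) ^ 3 ≤ n := by
    calc n ^ δ * (n ^ δ) ^ 3 = n ^ (δ * 4) := by
          rw [Real.rpow_mul hn₀.le, show (4 : ℝ) = ((4 : ℕ) : ℝ) by norm_num, Real.rpow_natCast]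
          ring
      _ ≤ n ^ (1 : ℝ) := Real.rpow_le_rpow_of_exponent_le hn (by linarith)
      _ = n := Real.rpow_one n
  have hpow₂ : n ^ δ * (n ^ δ * n ^ (1 - α)) ≤ n := by
    rw [← Real.rpow_add hn₀, ← Real.rpow_add hn₀]
    calc n ^ (δ + (δ + (1 - α))) ≤ n ^ (1 : ℝ) :=
          Real.rpow_le_rpow_of_exponent_le hn (by linarith)
      _ = n := Real.rpow_one n
  refine (Finset.sum_le_sum hterm).trans ?_
  rw [Finset.sum_add_distrib, ← Finset.mul_sum, Finset.sum_const, Finset.card_range, nsmul_eq_mul]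
  refine add_le_add le_rfl ?_
  have e₁ : (N : ℝ) * (10000 * (k + 1) * (n ^ δ) ^ 3) ≤ 10000 * (k + 1) * n := by
    calc (N : ℝ) * (10000 * (k + 1) * (n ^ δ) ^ 3) ≤ n ^ δ * (10000 * (k + 1) * (n ^ δ) ^ 3) :=
          mul_le_mul_of_nonneg_right hN (by positivity)
      _ = 10000 * (k + 1) * (n ^ δ * (n ^ δ) ^ 3) := by ring
      _ ≤ 10000 * (k + 1) * n := mul_le_mul_of_nonneg_left hpow₁ (by positivity)
  have e₂ : (N : ℝ) * (n ^ δ * (|c| * n ^ (1 - α))) ≤ |c| * n := by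
    calc (N : ℝ) * (n ^ δ * (|c| * n ^ (1 - α))) ≤ n ^ δ * (n ^ δ * (|c| * n ^ (1 - α))) :=
          mul_le_mul_of_nonneg_right hN (by positivity)
      _ = |c| * (n ^ δ * (n ^ δ * n ^ (1 - α))) := by ring
      _ ≤ |c| * n := mul_le_mul_of_nonneg_left hpow₂ (abs_nonneg c)
  nlinarith

/-- The logarithm is traded for `2 ^ N / δ`, so the cost takes the form of the summand of one more
iteration. -/
theorem Tester.Valid.solveDirectlyT_time_le (hT : T.Valid S α c k) (hS : GeneralPosition S)
    (hδ : 0 < δ) :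
    ((solveDirectlyT (RedBlue.remaining T k S (iterationCount δ S.length))).time : ℝ) ≤
      200 * (1 / δ + 2) * ((RedBlue.remaining T k S (iterationCount δ S.length)).length *
        2 ^ iterationCount δ S.length) + 20 := by
  set Q := RedBlue.remaining T k S (iterationCount δ S.length)
  have h : ((solveDirectlyT Q).time : ℝ) ≤
      200 * (Q.length * (Nat.clog 2 Q.length + 1)) + 20 := by
    exact_mod_cast RedBlue.solveDirectlyT_time_le Q
  have hlog : (Nat.clog 2 Q.length : ℝ) ≤ Real.logb 2 S.length + 1 := by
    refine le_trans ?_ (clog_two_le S.length)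
    exact_mod_cast Nat.clog_mono_right 2 (hT.remaining hS _).2.2
  have hδlog := (lt_two_pow_iterationCount δ S.length).le
  have hone : (1 : ℝ) ≤ 2 ^ iterationCount δ S.length := one_le_pow₀ (by norm_num)
  have hlog' : Real.logb 2 S.length ≤ 1 / δ * 2 ^ iterationCount δ S.length := by
    rw [one_div, ← div_eq_inv_mul, le_div_iff₀ hδ]
    linarith
  have hle : (Nat.clog 2 Q.length : ℝ) + 1 ≤ (1 / δ + 2) * 2 ^ iterationCount δ S.length := by
    linarith
  have := mul_le_mul_of_nonneg_left hle (Nat.cast_nonneg (α := ℝ) Q.length)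
  linarith

end Main

end RedBlue

/-! ### The main theorem -/

theorem mainTheorem3 (α c : ℝ) (hα : 0 < α) (k : ℕ) :
    ∃ δ₀ : ℝ, 0 < δ₀ ∧ ∀ δ : ℝ, 0 < δ → δ ≤ δ₀ →
      ∃ C : ℝ, ∀ S : List (RedBlue.CPoint ℝ), S ≠ [] → RedBlue.GeneralPosition S →
        ∀ T : RedBlue.Tester ℝ, T.Valid S α c k →
          (RedBlue.reportParticipatingT δ T k S).val.Nodup ∧
          (∀ p : RedBlue.CPoint ℝ, p ∈ (RedBlue.reportParticipatingT δ T k S).val ↔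
            RedBlue.Participates S.toFinset p) ∧
          ((RedBlue.reportParticipatingT δ T k S).time : ℝ) ≤
            C * ((S.length : ℝ) * (RedBlue.structuralEntropy S.toFinset + 1)) := by
  refine ⟨min (1 / 4) (α / 2), by positivity, fun δ hδ hδ₀ => ?_⟩
  have hδ₁ : δ ≤ 1 / 4 := hδ₀.trans (min_le_left _ _)
  have hδ₂ : δ ≤ α / 2 := hδ₀.trans (min_le_right _ _)
  -- The factor 187 comes from the weighted sum of the remaining sizes, which bounds both the
  -- iterations and the direct algorithm. The second summand covers the lower-order costs, and `24 =
  -- 1 + 3 + 20` the counting of `S` and additive constants, as `1 ≤ n ≤ n (H + 1)`.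
  refine ⟨187 * (10000 * (k + 1) + 200 * (1 / δ + 2)) + (10000 * (k + 1) + |c| + 1) + 24,
    fun S hne hS T hT => ?_⟩
  obtain ⟨hgp, hconf, -⟩ := hT.remaining hS (RedBlue.iterationCount δ S.length)
  obtain ⟨hnodup, hmem⟩ := RedBlue.solveDirectlyT_val hgp
  rw [RedBlue.reportParticipatingT_val]
  refine ⟨hnodup, fun p => (hmem p).trans (hconf.participates_iff hS.toFinset p), ?_⟩
  have hnpos : 0 < S.length := List.length_pos_iff.2 hne
  have hn : (1 : ℝ) ≤ S.length := by exact_mod_cast hnpos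
  have hH := RedBlue.structuralEntropy_nonneg S.toFinset
  -- All cell numbers are at most `n ^ δ ≤ n`, so each cell size may be rounded up at the cost of a
  -- factor 2.
  have hsum := hT.sum_remaining_le hS hne (count := RedBlue.iterationCount δ S.length)
    fun j hj => by
      have h₁ := RedBlue.two_pow_two_pow_le_rpow hnpos hj
      have h₂ : (S.length : ℝ) ^ δ ≤ S.length := by
        simpa using Real.rpow_le_rpow_of_exponent_le hn (by linarith : δ ≤ 1)
      exact_mod_cast h₁.trans h₂
  rw [Finset.sum_range_succ] at hsum
  have hiter := hT.sum_iterationT_time_le hS hne hδ hδ₁ hδ₂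
  have hdirect := hT.solveDirectlyT_time_le hS hδ
  rw [RedBlue.reportParticipatingT_time]
  push_cast
  set E := (S.length : ℝ) * (RedBlue.structuralEntropy S.toFinset + 1) with hE
  have hnE : (S.length : ℝ) ≤ E := by nlinarith
  set X := ∑ j ∈ Finset.range (RedBlue.iterationCount δ S.length),
    ((RedBlue.remaining T k S j).length : ℝ) * 2 ^ j with hX
  set Y := ((RedBlue.remaining T k S (RedBlue.iterationCount δ S.length)).length : ℝ) *
    2 ^ RedBlue.iterationCount δ S.length with hY
  have hX₀ : 0 ≤ X := Finset.sum_nonneg fun j _ => by positivity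
  have hY₀ : 0 ≤ Y := by positivity
  have e₁ : 10000 * ((k : ℝ) + 1) * X ≤ 10000 * (k + 1) * (187 * E) :=
    mul_le_mul_of_nonneg_left (by linarith) (by positivity)
  have e₂ : 200 * (1 / δ + 2) * Y ≤ 200 * (1 / δ + 2) * (187 * E) :=
    mul_le_mul_of_nonneg_left (by linarith) (by positivity)
  have e₃ : (10000 * ((k : ℝ) + 1) + |c| + 1) * S.length ≤ (10000 * (k + 1) + |c| + 1) * E :=
    mul_le_mul_of_nonneg_left hnE (by positivity)
  linarith
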